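/- Let $\ell\ge 1$, $k\ge 2$, $d\ge 1$ be integers, $I=(-1/2,1/2)$, $\lambda=\sqrt{1/k}$ and $\mu=(k-1)\ell d/2$. Let $d\gamma_d(x)=(2\pi)^{-d/2}e^{-|x|^2/2}dx$ on $\mathbb R^d$, and for $m\in\mathbb Z_+^d$ let $H_m(x)=H_{m_1}(x_1)\cdots H_{m_d}(x_d)$, where $H_n$ is the monic Hermite polynomial of degree $n$ orthogonal with respect to $d\gamma_1$; write $|m|=m_1+\dots+m_d$ and $m!=m_1!\cdots m_d!$. For $t\in\mathbb R$ let $\mathcal H^t$ be the operator on $L^2(\gamma_d)$ given by $\mathcal H^t H_m(x)=e^{2\pi|m|it}H_m(\sqrt{2/p}\,x)$ with $p=2k$. Let $\mathcal M$ be the set of $\ell\times k$ matrices $M=[m^{i,j}]$ with entries in $\mathbb Z_+^d$, and put $|M|=\sum_{i,j}|m^{i,j}|$, $M!=\prod_{i,j}m^{i,j}!$. Let $\mathcal F$ be the Hilbert space of all $\varphi:\mathcal M\to\mathbb C$ with $\|\varphi\|_{\mathcal F}^2=\sum_M|\varphi(M)|^2M!<\infty$ and inner product $\langle\varphi,\psi\rangle_{\mathcal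 F}=\sum_M\varphi(M)\overline{\psi(M)}M!$. For $\varphi:\mathcal M\to\mathbb C$ put $$\mathcal P\varphi(M)=\sum_{|N|=|M|}\varphi(N)\frac{P(M,N)}{M!},\qquad P(M,N)=\int_{(\mathbb R^d)^\ell}\prod_{i=1}^{\ell}\prod_{j=1}^{k}H_{m^{i,j}}(\lambda x^i)H_{n^{i,j}}(\lambda x^i)\,d\gamma_d(x^1)\cdots d\gamma_d(x^\ell).$$ For an integer $S\ge0$ let $\mathcal F_S$ be the space of $\varphi$ vanishing at every $M$ with $|M|\ne S$, and let $\mathcal P_S:\mathcal F_S\to\mathcal F_S$ be the restriction of $\mathcal P$. Then: (i) Let $g=\sum_m\alpha(m)H_m$ in $L^2(\gamma_d)$ and $\varphi(M)=\prod_{i,j}\alpha(m^{i,j})$. For every $t$ the series $\sum_m\alpha(m)e^{2\pi|m|it}H_m(\sqrt{2/p}\,x)$ converges in $L^2(\gamma_d)$ to $\mathcal H^tg$. Moreover $\varphi\in\mathcal F$ and $$\Big(\int|g|^2d\gamma_d\Big)^{k\ell}=\|\varphi\|_{\mathcal F}^2 .$$ The numbers $q_S=\sum_{|M|=S}\varphi(M)\overline{\mathcal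 P\varphi(M)}M!$ are real and nonnegative, and, as an identity in $[0,\infty]$, $$\int_I\Big(\int|\mathcal H^tg|^{2k}d\gamma_d\Big)^{\ell}dt=\sum_{S\ge0}q_S .$$ If $\mathcal P\varphi\in\mathcal F$, the left-hand side is finite and equals $\langle\varphi,\mathcal P\varphi\rangle_{\mathcal F}$. (ii) For each $S\ge 2$, $\mathcal P_S^2=\mathcal P_S$ if and only if $\mu=1$; for $S\in\{0,1\}$ one always has $\mathcal P_S^2=\mathcal P_S$. In particular, $\mathcal P_S^2=\mathcal P_S$ for all $S\ge0$ if and only if $\mu=1$. If $\mu=1$, then $\mathcal P$ maps all of $\mathcal F$ into $\mathcal F$, and it is an (orthogonal) projection there: $\mathcal P^2=\mathcal P$ and $\langle\mathcal P\varphi,\psi\rangle_{\mathcal F}=\langle\varphi,\mathcal P\psi\rangle_{\mathcal F}$ for all $\varphi,\psi\in\mathcal F$. (iii) If $\mu>1$, then for every $S\ge 0$ $$\|\mathcal P_S\|_{\mathcal F_S\to\mathcal F_S}=\frac{\mu(\mu+1)\cdots(\mu+\lfloor S/2\rfloor-1)}{\lfloor S/2\rfloor!},\qquad \|\mathcal P_S\|_{\mathcal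 F_S\to\mathcal F_S}\sim\frac{S^{\mu-1}}{2^{\mu-1}\Gamma(\mu)}\quad(S\to\infty),$$ and $\mathcal P$ is not bounded on $\mathcal F$: there is no constant $C$ with $\|\mathcal P\varphi\|_{\mathcal F}\le C\|\varphi\|_{\mathcal F}$ for all $\varphi\in\mathcal F$ with $\mathcal P\varphi\in\mathcal F$. -/

import Mathlib

open MeasureTheory ProbabilityTheory Filter Topology Asymptotics
open scoped ENNReal ComplexConjugate

noncomputable section

namespace HermiteStrichartz

/-! ### Gaussian measure and multivariate Hermite polynomials -/

/-- The standard normal distribution `dγ_d = (2π)^(-d/2) exp(-|x|²/2) dx` on `ℝ^d`,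
as the product of `d` copies of the standard normal distribution on `ℝ`. -/
abbrev gauss (d : ℕ) : Measure (Fin d → ℝ) := Measure.pi fun _ => gaussianReal 0 1

/-- The multivariate Hermite polynomial `H_m(x) = H_{m_1}(x_1) ⋯ H_{m_d}(x_d)`, built from the
monic Hermite polynomials that are orthogonal for the standard normal distribution. -/
def hermiteMv {d : ℕ} (m : Fin d → ℕ) (x : Fin d → ℝ) : ℝ :=
  ∏ a, Polynomial.aeval (x a) (Polynomial.hermite (m a))

/-- `|m| = m_1 + ⋯ + m_d`. -/
def deg {d : ℕ} (m : Fin d → ℕ) : ℕ := ∑ a, m a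

/-- `m! = m_1! ⋯ m_d!`. -/
def mfact {d : ℕ} (m : Fin d → ℕ) : ℕ := ∏ a, (m a).factorial

lemma integrable_aeval_gaussian (p : Polynomial ℝ) :
    Integrable (fun x : ℝ => p.eval x) (gaussianReal 0 1) := by
  induction p using Polynomial.induction_on' with
  | add p q hp hq =>
    simp only [Polynomial.eval_add]
    exact hp.add hq
  | monomial n a =>
    have h : Integrable (fun x : ℝ => x ^ n) (gaussianReal 0 1) := by
      have h1 := (memLp_id_gaussianReal (μ := 0) (v := 1) n).integrable_norm_pow'
      refine h1.mono' (by fun_prop) (ae_of_all _ fun x => ?_)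
      simp
    simpa using h.const_mul a

lemma memLp_hermiteMv {d : ℕ} (c : ℝ) (m : Fin d → ℕ) :
    MemLp (fun x : Fin d → ℝ => (hermiteMv m (c • x) : ℂ)) 2 (gauss d) := by
  have hc : Continuous fun x : Fin d → ℝ => (hermiteMv m (c • x) : ℂ) := by
    unfold hermiteMv
    refine Complex.continuous_ofReal.comp (continuous_finsetProd _ fun a _ => ?_)
    exact (Polynomial.continuous_aeval _).comp (by fun_prop)
  rw [memLp_two_iff_integrable_sq_norm hc.aestronglyMeasurable]
  have h := Integrable.fintype_prod (𝕜 := ℝ) (ι := Fin d)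
    (f := fun a (x : ℝ) => (Polynomial.aeval (c * x) (Polynomial.hermite (m a))) ^ 2)
    (μ := fun _ : Fin d => gaussianReal 0 1) (fun a => ?_)
  · refine h.congr (ae_of_all _ fun x => ?_)
    simp [hermiteMv, Finset.prod_pow, ← Finset.abs_prod]
  · have := integrable_aeval_gaussian
      (((((Polynomial.hermite (m a)).map (Int.castRingHom ℝ)).comp
        (Polynomial.C c * Polynomial.X))) ^ 2)
    refine this.congr (ae_of_all _ fun x => ?_)
    simp [Polynomial.eval_comp, Polynomial.aeval_def, Polynomial.eval_map]

/-- The function `x ↦ H_m(c x)` as an element of `L²(γ_d)`. -/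
def hermiteLp {d : ℕ} (c : ℝ) (m : Fin d → ℕ) : Lp ℂ 2 (gauss d) :=
  (memLp_hermiteMv c m).toLp _

/-- The coefficient of `H_m` in the Hermite expansion of `g`. -/
def hermiteCoeff {d : ℕ} (g : Lp ℂ 2 (gauss d)) (m : Fin d → ℕ) : ℂ :=
  (∫ x, (hermiteMv m x : ℂ) * g x ∂(gauss d)) / (mfact m : ℂ)

/-- The operator `H^t : H_m(x) ↦ e^{2π |m| i t} H_m(√(2/p) x)`, extended to `g ∈ L²(γ_d)` through
the Hermite expansion of `g` (series in `L²(γ_d)`). -/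
def hermiteFlow {d : ℕ} (p t : ℝ) (g : Lp ℂ 2 (gauss d)) : Lp ℂ 2 (gauss d) :=
  ∑' m : Fin d → ℕ,
    (hermiteCoeff g m * Complex.exp (2 * Real.pi * (deg m : ℂ) * Complex.I * t)) •
      hermiteLp √(2 / p) m

/-- The quantity `∫_I (∫ |H^t g|^{2k} dγ_d)^ℓ dt`, `I = (-1/2, 1/2)`, `p = 2k`,
with values in `[0, ∞]`. -/
def spaceTime {d : ℕ} (k l : ℕ) (g : Lp ℂ 2 (gauss d)) : ℝ≥0∞ :=
  ∫⁻ t in Set.Ioo (-1 / 2 : ℝ) (1 / 2),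
    (∫⁻ x, ‖hermiteFlow (2 * k) t g x‖ₑ ^ (2 * k) ∂(gauss d)) ^ l

/-! ### Matrices of multi-indices, the space `ℱ` and the operator `𝒫` -/

/-- `ℓ × k` matrices whose entries are multi-indices in `ℕ^d`. -/
abbrev Mat (l k d : ℕ) : Type := Fin l → Fin k → Fin d → ℕ

variable {l k d : ℕ}

/-- `|M| = ∑_{i,j} |m^{i,j}|`. -/
def matDeg (M : Mat l k d) : ℕ := ∑ i, ∑ j, deg (M i j)

/-- `M! = ∏_{i,j} m^{i,j}!`. -/
def matFact (M : Mat l k d) : ℕ := ∏ i, ∏ j, mfact (M i j)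

/-- The finite set of matrices with `|M| = S`. -/
def slice (l k d S : ℕ) : Finset (Mat l k d) :=
  (Finset.Iic (fun _ _ _ => S : Mat l k d)).filter fun M => matDeg M = S

lemma mem_slice {S : ℕ} {M : Mat l k d} : M ∈ slice l k d S ↔ matDeg M = S := by
  simp only [slice, Finset.mem_filter, Finset.mem_Iic, and_iff_right_iff_imp]
  rintro rfl i j a
  calc M i j a ≤ deg (M i j) :=
        Finset.single_le_sum (f := fun a => M i j a) (fun _ _ => Nat.zero_le _) (Finset.mem_univ a)
    _ ≤ ∑ j, deg (M i j) :=
        Finset.single_le_sum (f := fun j => deg (M i j)) (fun _ _ => Nat.zero_le _)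
          (Finset.mem_univ j)
    _ ≤ matDeg M :=
        Finset.single_le_sum (f := fun i => ∑ j, deg (M i j)) (fun _ _ => Nat.zero_le _)
          (Finset.mem_univ i)

/-- The coefficient `P(M,N) = ∫ ∏_{i,j} H_{m^{i,j}}(λ x^i) H_{n^{i,j}}(λ x^i) dγ_d(x^1)⋯dγ_d(x^ℓ)`
with `λ = √(1/k)`. -/
def coeffP (M N : Mat l k d) : ℝ :=
  ∫ x : Fin l → Fin d → ℝ,
    ∏ i, ∏ j, (hermiteMv (M i j) (√(1 / (k : ℝ)) • x i) * hermiteMv (N i j) (√(1 / (k : ℝ)) • x i))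
    ∂(Measure.pi fun _ : Fin l => gauss d)

/-- The operator `𝒫φ(M) = ∑_{|N| = |M|} φ(N) P(M,N) / M!`, on all functions `φ : Mat → ℂ`. -/
def opP (l k d : ℕ) : (Mat l k d → ℂ) →ₗ[ℂ] (Mat l k d → ℂ) where
  toFun φ M := ∑ N ∈ slice l k d (matDeg M), φ N * ((coeffP M N / matFact M : ℝ) : ℂ)
  map_add' φ ψ := by
    funext M
    simp [add_mul, Finset.sum_add_distrib]
  map_smul' c φ := by
    funext M
    simp [mul_assoc, Finset.mul_sum]

/-- The space `ℱ` of functions `φ` with `∑_M |φ(M)|² M! < ∞`. -/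
def spaceF (l k d : ℕ) : Submodule ℂ (Mat l k d → ℂ) where
  carrier := {φ | Summable fun M => ‖φ M‖ ^ 2 * (matFact M : ℝ)}
  zero_mem' := by simp
  add_mem' {φ ψ} hφ hψ := by
    refine Summable.of_nonneg_of_le (fun M => by positivity) (fun M => ?_)
      ((hφ.add hψ).mul_left 2)
    have h1 : ‖φ M + ψ M‖ ^ 2 ≤ 2 * (‖φ M‖ ^ 2 + ‖ψ M‖ ^ 2) := by
      have := norm_add_le (φ M) (ψ M)
      nlinarith [sq_nonneg (‖φ M‖ - ‖ψ M‖), norm_nonneg (φ M + ψ M)]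
    calc ‖(φ + ψ) M‖ ^ 2 * (matFact M : ℝ)
        ≤ (2 * (‖φ M‖ ^ 2 + ‖ψ M‖ ^ 2)) * (matFact M : ℝ) := by
          simpa using mul_le_mul_of_nonneg_right h1 (Nat.cast_nonneg (matFact M))
      _ = _ := by ring
  smul_mem' c φ hφ := by
    refine (Summable.mul_left (‖c‖ ^ 2) hφ).congr fun M => ?_
    simp [mul_pow, mul_assoc]

/-- The inner product `⟨φ,ψ⟩ = ∑_M φ(M) conj(ψ(M)) M!` of `ℱ`. -/
def innerF (φ ψ : Mat l k d → ℂ) : ℂ := ∑' M, φ M * conj (ψ M) * (matFact M : ℂ)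

/-- The norm `‖φ‖ = (∑_M |φ(M)|² M!)^{1/2}` of `ℱ`. -/
def normF (φ : Mat l k d → ℂ) : ℝ := √(∑' M, ‖φ M‖ ^ 2 * (matFact M : ℝ))

/-- The subspace `ℱ_S` of functions vanishing at every `M` with `|M| ≠ S`. -/
def spaceFS (l k d S : ℕ) : Submodule ℂ (Mat l k d → ℂ) where
  carrier := {φ | ∀ M, matDeg M ≠ S → φ M = 0}
  zero_mem' := by simp
  add_mem' hφ hψ M hM := by simp [hφ M hM, hψ M hM]
  smul_mem' c φ hφ M hM := by simp [hφ M hM]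

lemma opP_mem_spaceFS (S : ℕ) : ∀ φ ∈ spaceFS l k d S, opP l k d φ ∈ spaceFS l k d S := by
  intro φ hφ M hM
  refine Finset.sum_eq_zero fun N hN => ?_
  rw [hφ N (by rw [mem_slice.1 hN]; exact hM), zero_mul]

/-- `𝒫_S`, the restriction of `𝒫` to `ℱ_S`. -/
def opPS (l k d S : ℕ) : spaceFS l k d S →ₗ[ℂ] spaceFS l k d S :=
  (opP l k d).restrict (opP_mem_spaceFS S)

/-- The set of quotients `‖𝒫_S φ‖ / ‖φ‖` for `φ ∈ ℱ_S`, `φ ≠ 0`. -/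
def ratioPS (l k d S : ℕ) : Set ℝ :=
  {r | ∃ φ : spaceFS l k d S, φ ≠ 0 ∧
    r = normF (opPS l k d S φ : Mat l k d → ℂ) / normF (φ : Mat l k d → ℂ)}

/-- The operator norm of `𝒫_S` on `ℱ_S`. -/
def normPS (l k d S : ℕ) : ℝ := sSup (ratioPS l k d S)

/-- The tensor product `φ(M) = ∏_{i,j} α(m^{i,j})`. -/
def tensor (l k : ℕ) (α : (Fin d → ℕ) → ℂ) : Mat l k d → ℂ := fun M => ∏ i, ∏ j, α (M i j)

/-- The contribution `∑_{|M| = S} φ(M) conj(𝒫φ(M)) M!` of degree `S` to `⟨φ, 𝒫φ⟩`. -/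
def formS (S : ℕ) (φ : Mat l k d → ℂ) : ℂ :=
  ∑ M ∈ slice l k d S, φ M * conj (opP l k d φ M) * (matFact M : ℂ)

/-- `μ = (k-1) ℓ d / 2`. -/
def mu (l k d : ℕ) : ℝ := ((k : ℝ) - 1) * l * d / 2

end HermiteStrichartz

end

open HermiteStrichartz

/-! A function on the matrices with |M| = S is encoded as a homogeneous polynomial of degree S in
variables X_(t,j), where t = (i,a) runs over T = `Fin l × Fin d`. The norm of ℱ_S becomes the
Fischer norm, for which multiplication by X_J is adjoint to ∂_J. The map X^N ↦ H_N, formally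
exp(-Δ/2), is an isometry into L² of the Gaussian measure (`integral_hermEval_mul`). Then P(M,N) is
the L² pairing of two Hermite polynomials restricted to the subspace X_(t,j) = c x_t with c = λ,
which is isometrically embedded because k c² = 1.

Split Δ into its parts along and across this subspace, and let A be -1/2 times the part across. The
restriction of H_p is then the Hermite polynomial of the restriction of exp(A) p
(`hermEval_restrict`). The terms of different order r have different degrees, hence are orthogonal,
so on degree S one gets 𝒫 = ∑_r raise_r lower_r with raise_r adjoint to lower_r
(`integral_hermEval_restrict`, `slicePoly_opP`). The directions across have dimension ℓd(k-1) = 2μ,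
and with q equal to -1/2 times the squared length in these directions, A(q^(r+1) F) = (r+1)(r+μ) q^r
F whenever F depends on the averages only. Hence lower_r raise_s = δ_rs μ(μ+1)⋯(μ+r-1)/r!
(`lower_raise`): 𝒫_S is positive and self-adjoint, and its nonzero eigenvalues are these numbers
with 2r ≤ S. They are all 1 when μ = 1. The value at r = 1 is μ, which settles idempotency. For μ >
1 they increase to infinity in r, which gives the norm, its asymptotics through Euler's limit for Γ,
and unboundedness.

For the space-time identity with finitely many coefficients, expand and integrate in t: only pairs
with |M| = |N| survive (`energy_of_finite`). In general the left side is only lower semicontinuous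
in the coefficients, so two inequalities are proved. For "≤", damp the coefficients by r^|m|;
polynomial growth of the eigenvalues then allows truncations to be removed by dominated convergence,
and r → 1 follows by lower semicontinuity (`energy_le_tsum`). For "≥", Fejér means in time have
finitely many coefficients and do not increase the left side, which is convex and invariant under
time shifts (`tsum_le_energy`). -/

noncomputable section

namespace HermiteStrichartz

/-! ### Laplacian and squared length across the averages; lowering and raising operators -/

section Algebra

open MvPolynomial

set_option linter.unusedSectionVars false

variable {T : Type*} [Fintype T] [DecidableEq T] {k : ℕ}

/-- The normalized average `u_t = c ∑_j X_(t,j)`. -/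
def avgVar (k : ℕ) (c : ℂ) (t : T) : MvPolynomial (T × Fin k) ℂ := ∑ j, C c * X (t, j)

/-- The algebra map `X_t ↦ u_t`. -/
def embed (T : Type*) (k : ℕ) (c : ℂ) : MvPolynomial T ℂ →ₐ[ℂ] MvPolynomial (T × Fin k) ℂ :=
  aeval (avgVar k c)

/-- Restriction to the subspace `{X_(t,j) = c X_t}`. -/
def restr (T : Type*) (k : ℕ) (c : ℂ) : MvPolynomial (T × Fin k) ℂ →ₐ[ℂ] MvPolynomial T ℂ :=
  aeval fun J => C c * X J.1

/-- The derivation dual to `u_t`. -/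
def avgDeriv (k : ℕ) (c : ℂ) (t : T) :
    Derivation ℂ (MvPolynomial (T × Fin k) ℂ) (MvPolynomial (T × Fin k) ℂ) :=
  ∑ j, c • pderiv (t, j)

/-- The component of `X_J` orthogonal to all averages. -/
def fluctVar (c : ℂ) (J : T × Fin k) : MvPolynomial (T × Fin k) ℂ :=
  X J - C c * avgVar k c J.1

/-- The derivation dual to `fluctVar`. -/
def fluctDeriv (c : ℂ) (J : T × Fin k) :
    Derivation ℂ (MvPolynomial (T × Fin k) ℂ) (MvPolynomial (T × Fin k) ℂ) :=
  pderiv J - c • avgDeriv k c J.1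

/-- `-1/2` times the Laplacian in the directions orthogonal to the averages. -/
def fluctLap (T : Type*) [Fintype T] (k : ℕ) (c : ℂ) :
    Module.End ℂ (MvPolynomial (T × Fin k) ℂ) :=
  ∑ J : T × Fin k, (-1 / 2 : ℂ) •
    ((fluctDeriv c J : Module.End ℂ (MvPolynomial (T × Fin k) ℂ)) * (fluctDeriv c J).toLinearMap)

/-- `-1/2` times the squared length in the directions orthogonal to the averages. -/
def fluctSq (T : Type*) [Fintype T] (k : ℕ) (c : ℂ) : MvPolynomial (T × Fin k) ℂ :=
  ∑ J : T × Fin k, C (-1 / 2) * fluctVar c J ^ 2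

lemma fluctLap_apply (c : ℂ) (p : MvPolynomial (T × Fin k) ℂ) :
    fluctLap T k c p = ∑ J : T × Fin k, (-1 / 2 : ℂ) • fluctDeriv c J (fluctDeriv c J p) := by
  simp [fluctLap, LinearMap.sum_apply]

lemma avgDeriv_apply (c : ℂ) (t : T) (p : MvPolynomial (T × Fin k) ℂ) :
    avgDeriv k c t p = ∑ j, c • pderiv (t, j) p := by
  have h : ⇑(∑ j, c • pderiv (R := ℂ) (t, j)) =
      ∑ j, ⇑(c • pderiv (R := ℂ) ((t, j) : T × Fin k)) :=
    map_sum Derivation.coeFnAddMonoidHom _ _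
  rw [avgDeriv, h]
  simp

lemma fluctDeriv_apply (c : ℂ) (J : T × Fin k) (p : MvPolynomial (T × Fin k) ℂ) :
    fluctDeriv c J p = pderiv J p - c • avgDeriv k c J.1 p := by
  simp [fluctDeriv]

lemma avgDeriv_X (c : ℂ) (t : T) (K : T × Fin k) :
    avgDeriv k c t (X K) = C (if t = K.1 then c else 0) := by
  obtain ⟨t', j'⟩ := K
  simp only [avgDeriv_apply, pderiv_X, smul_eq_C_mul, Pi.single_apply, Prod.mk.injEq]
  by_cases h : t' = t
  · subst h; simp
  · simp [h, Ne.symm h]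

lemma fluctDeriv_X (c : ℂ) (J K : T × Fin k) :
    fluctDeriv c J (X K) = C ((if J = K then 1 else 0) - if J.1 = K.1 then c ^ 2 else 0) := by
  rw [fluctDeriv_apply, avgDeriv_X, pderiv_X, smul_eq_C_mul, Pi.single_apply, ← C_mul, C_sub]
  congr 1
  · by_cases h : K = J
    · simp [h]
    · simp [h, Ne.symm h]
  · congr 1
    split_ifs <;> ring

/-- The value within one fibre is c(1 - k c²), which vanishes: the normalization of c is what makes
the averages orthonormal. -/
lemma fluctDeriv_avgVar {c : ℂ} (hc : (k : ℂ) * c ^ 2 = 1) (J : T × Fin k) (t : T) :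
    fluctDeriv c J (avgVar k c t) = 0 := by
  obtain ⟨t', j'⟩ := J
  simp only [avgVar, map_sum, Derivation.leibniz, Derivation.leibniz, fluctDeriv_X, smul_eq_mul]
  have h0 : fluctDeriv c (t', j') (C c) = 0 := by
    rw [← algebraMap_eq, Derivation.map_algebraMap]
  simp only [h0, mul_zero, add_zero, ← C_mul, ← map_sum, Prod.mk.injEq]
  rw [C_eq_zero]
  by_cases h : t' = t
  · subst h
    simp only [true_and, if_true, ← Finset.mul_sum, Finset.sum_sub_distrib, Finset.sum_const,
      Finset.card_univ, Fintype.card_fin, nsmul_eq_mul, hc]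
    simp
  · simp [h]

lemma fluctDeriv_C (c a : ℂ) (J : T × Fin k) : fluctDeriv c J (C a) = 0 := by
  rw [← algebraMap_eq, Derivation.map_algebraMap]

lemma fluctDeriv_embed {c : ℂ} (hc : (k : ℂ) * c ^ 2 = 1) (J : T × Fin k)
    (f : MvPolynomial T ℂ) : fluctDeriv c J (embed T k c f) = 0 := by
  induction f using MvPolynomial.induction_on with
  | C a => rw [embed, aeval_C, algebraMap_eq, fluctDeriv_C]
  | add p q hp hq => simp [hp, hq]
  | mul_X p i hp =>
    rw [map_mul, Derivation.leibniz, hp]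
    simp [embed, fluctDeriv_avgVar hc]

lemma sum_fluctVar {c : ℂ} (hc : (k : ℂ) * c ^ 2 = 1) (t : T) :
    ∑ j : Fin k, fluctVar c (t, j) = 0 := by
  simp only [fluctVar, Finset.sum_sub_distrib, Finset.sum_const, Finset.card_univ,
    Fintype.card_fin, avgVar, ← Finset.mul_sum, nsmul_eq_mul]
  have : (k : MvPolynomial (T × Fin k) ℂ) * (C c * (C c * ∑ j, X (t, j)))
      = C ((k : ℂ) * c ^ 2) * ∑ j, X (t, j) := by
    simp only [C_mul, C_pow]
    rw [show (C (k : ℂ) : MvPolynomial (T × Fin k) ℂ) = k from map_natCast C k]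
    ring
  rw [this, hc]
  simp

lemma sum_fluctDeriv {c : ℂ} (hc : (k : ℂ) * c ^ 2 = 1) (t : T) (p : MvPolynomial (T × Fin k) ℂ) :
    ∑ j : Fin k, fluctDeriv c (t, j) p = 0 := by
  simp only [fluctDeriv_apply, Finset.sum_sub_distrib, Finset.sum_const, Finset.card_univ,
    Fintype.card_fin, avgDeriv_apply, ← Finset.smul_sum, smul_smul]
  rw [← Nat.cast_smul_eq_nsmul ℂ, smul_smul]
  rw [show (k : ℂ) * (c * c) = 1 by rw [← hc]; ring]
  simp

lemma fluctDeriv_fluctVar {c : ℂ} (hc : (k : ℂ) * c ^ 2 = 1) (J K : T × Fin k) :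
    fluctDeriv c J (fluctVar c K) = C ((if J = K then 1 else 0) - if J.1 = K.1 then c ^ 2 else 0) := by
  rw [fluctVar, map_sub, Derivation.leibniz, fluctDeriv_avgVar hc, fluctDeriv_C, fluctDeriv_X]
  simp

/-- Contraction with the orthogonal projection matrix acts as the identity on families with
vanishing fibre sums. -/
lemma sum_projection_mul {c : ℂ} (v : T × Fin k → MvPolynomial (T × Fin k) ℂ)
    (hv : ∀ t, ∑ j, v (t, j) = 0) (J : T × Fin k) :
    ∑ K, C ((if J = K then 1 else 0) - if J.1 = K.1 then c ^ 2 else 0) * v K = v J := by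
  simp only [C_sub, sub_mul, Finset.sum_sub_distrib]
  have h1 : ∑ K, (C (if J = K then (1 : ℂ) else 0) : MvPolynomial (T × Fin k) ℂ) * v K = v J := by
    rw [Finset.sum_eq_single J]
    · simp
    · intro K _ hK; simp [Ne.symm hK]
    · simp
  have h2 : ∑ K, (C (if J.1 = K.1 then c ^ 2 else 0) : MvPolynomial (T × Fin k) ℂ) * v K = 0 := by
    rw [Fintype.sum_prod_type]
    refine Finset.sum_eq_zero fun t _ => ?_
    change ∑ j, C (if J.1 = t then c ^ 2 else 0) * v (t, j) = 0
    rw [← Finset.mul_sum, hv, mul_zero]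
  rw [h1, h2, sub_zero]

lemma fluctDeriv_fluctSq {c : ℂ} (hc : (k : ℂ) * c ^ 2 = 1) (J : T × Fin k) :
    fluctDeriv c J (fluctSq T k c) = - fluctVar c J := by
  have h : fluctDeriv c J (fluctSq T k c) =
      - ∑ K, C ((if J = K then 1 else 0) - if J.1 = K.1 then c ^ 2 else 0) * fluctVar c K := by
    rw [fluctSq, map_sum, ← Finset.sum_neg_distrib]
    refine Finset.sum_congr rfl fun K _ => ?_
    rw [Derivation.leibniz, Derivation.leibniz_pow, fluctDeriv_fluctVar hc, fluctDeriv_C]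
    have h2 : (C (-1 / 2) : MvPolynomial (T × Fin k) ℂ) * 2 = -1 := by
      rw [show (2 : MvPolynomial (T × Fin k) ℂ) = C 2 from (map_ofNat C 2).symm, ← C_mul]
      norm_num
    simp only [smul_eq_mul, nsmul_eq_mul, Nat.cast_ofNat, mul_zero, add_zero]
    generalize C ((if J = K then (1:ℂ) else 0) - if J.1 = K.1 then c ^ 2 else 0) = e
    simp only [Nat.add_one_sub_one, pow_one]
    linear_combination (fluctVar c K * e) * h2
  rw [h, sum_projection_mul _ (sum_fluctVar hc)]

/-- The radial Laplacian in dimension 2m. The part r(r+1) comes from the squared gradient, since the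
squares of the `fluctVar` sum to -2q. The part m(r+1) comes from the trace of the projection, ∑_J (1
- c²) = |T|(k-1) = 2m. -/
lemma fluctLap_fluctSq_pow_mul {c m : ℂ} (hc : (k : ℂ) * c ^ 2 = 1)
    (hm : 2 * m = (Fintype.card T : ℂ) * (k - 1)) (r : ℕ) (F : MvPolynomial (T × Fin k) ℂ)
    (hF : ∀ J, fluctDeriv c J F = 0) :
    fluctLap T k c (fluctSq T k c ^ (r + 1) * F) =
      C ((r + 1) * (r + m)) * (fluctSq T k c ^ r * F) := by
  set q := fluctSq T k c with hq
  have h1 : ∀ J, fluctDeriv c J (q ^ (r + 1) * F) = -(r + 1) * (q ^ r * fluctVar c J * F) := by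
    intro J
    rw [Derivation.leibniz, hF, Derivation.leibniz_pow, hq, fluctDeriv_fluctSq hc]
    simp only [smul_eq_mul, nsmul_eq_mul, Nat.add_one_sub_one]
    push_cast
    ring
  have h2 : ∀ J, fluctDeriv c J (q ^ r * fluctVar c J * F) =
      (-(r : MvPolynomial (T × Fin k) ℂ) * q ^ (r - 1) * fluctVar c J ^ 2 + q ^ r * C (1 - c ^ 2)) * F := by
    intro J
    rw [Derivation.leibniz, hF, Derivation.leibniz, Derivation.leibniz_pow, hq,
      fluctDeriv_fluctSq hc, fluctDeriv_fluctVar hc]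
    simp only [smul_eq_mul, nsmul_eq_mul, if_true]
    ring
  have h3 : ∀ J, fluctDeriv c J (fluctDeriv c J (q ^ (r + 1) * F)) =
      -((r : MvPolynomial (T × Fin k) ℂ) + 1) *
      ((-(r : MvPolynomial (T × Fin k) ℂ) * q ^ (r - 1) * fluctVar c J ^ 2 + q ^ r * C (1 - c ^ 2)) * F) := by
    intro J
    rw [h1, Derivation.leibniz, h2]
    have : fluctDeriv c J (-((r : MvPolynomial (T × Fin k) ℂ) + 1)) = 0 := by
      rw [show (-((r : MvPolynomial (T × Fin k) ℂ) + 1)) = C (-((r : ℂ) + 1)) by simp,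
        fluctDeriv_C]
    rw [this]
    simp
  rw [fluctLap_apply]
  simp only [h3, smul_eq_C_mul]
  have h4 : ∑ J : T × Fin k, (C (-1 / 2) : MvPolynomial (T × Fin k) ℂ) *
      (-((r : MvPolynomial (T × Fin k) ℂ) + 1) *
      ((-(r : MvPolynomial (T × Fin k) ℂ) * q ^ (r - 1) * fluctVar c J ^ 2 + q ^ r * C (1 - c ^ 2)) * F))
      = ((r : MvPolynomial (T × Fin k) ℂ) + 1) * (r : MvPolynomial (T × Fin k) ℂ) * q ^ (r - 1) * F * q +
        ∑ J : T × Fin k, C ((r + 1) / 2 * (1 - c ^ 2)) * (q ^ r * F) := by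
    rw [hq, fluctSq, Finset.mul_sum, ← Finset.sum_add_distrib]
    refine Finset.sum_congr rfl fun J _ => ?_
    rw [← fluctSq]
    have e1 : (C ((r + 1 : ℂ) / 2 * (1 - c ^ 2)) : MvPolynomial (T × Fin k) ℂ) =
        - C (-1 / 2) * ((r : MvPolynomial (T × Fin k) ℂ) + 1) * C (1 - c ^ 2) := by
      rw [show ((r : MvPolynomial (T × Fin k) ℂ) + 1) = C ((r : ℂ) + 1) by simp, ← C_neg, ← C_mul,
        ← C_mul]
      congr 1; ring
    rw [e1]
    ring
  rw [h4]
  -- At r = 0 the truncated exponent is harmless because of the factor r.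
  have h5 : (r : MvPolynomial (T × Fin k) ℂ) * q ^ (r - 1) * q = r * q ^ r := by
    cases r with
    | zero => simp
    | succ r => rw [Nat.add_sub_cancel, pow_succ]; ring
  rw [Finset.sum_const, Finset.card_univ, nsmul_eq_mul, Fintype.card_prod, Fintype.card_fin]
  have e2 : (((Fintype.card T * k : ℕ) : MvPolynomial (T × Fin k) ℂ)) * (C ((r + 1) / 2 * (1 - c ^ 2)) * (q ^ r * F))
      = C ((r + 1) * m) * (q ^ r * F) := by
    rw [show ((Fintype.card T * k : ℕ) : MvPolynomial (T × Fin k) ℂ) = C ((Fintype.card T * k : ℕ) : ℂ)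
      from (map_natCast C _).symm, ← mul_assoc, ← C_mul]
    congr 2
    push_cast
    linear_combination (-(r + 1) * (Fintype.card T) / 2 : ℂ) * hc - (r + 1 : ℂ) / 2 * hm
  rw [e2]
  have e3 : (C ((r + 1 : ℂ) * (r + m)) : MvPolynomial (T × Fin k) ℂ) =
      ((r : MvPolynomial (T × Fin k) ℂ) + 1) * (r : MvPolynomial (T × Fin k) ℂ) + C ((r + 1) * m) := by
    rw [show ((r : MvPolynomial (T × Fin k) ℂ) + 1) = C ((r : ℂ) + 1) by simp,
     show ((r : MvPolynomial (T × Fin k) ℂ)) = C (r : ℂ) by simp, ← C_mul, ← C_add]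
    congr 1; ring
  rw [e3]
  linear_combination ((r : MvPolynomial (T × Fin k) ℂ) + 1) * F * h5

/-- The commutator is a derivation that kills every variable, so it is zero. -/
lemma derivation_comm_of_const {σ : Type*} (D E : Derivation ℂ (MvPolynomial σ ℂ) (MvPolynomial σ ℂ))
    (hD : ∀ i, ∃ a, D (X i) = C a) (hE : ∀ i, ∃ a, E (X i) = C a) (p : MvPolynomial σ ℂ) :
    D (E p) = E (D p) := by
  have h : ⁅D, E⁆ = 0 := by
    refine MvPolynomial.derivation_ext fun i => ?_
    obtain ⟨a, ha⟩ := hD i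
    obtain ⟨b, hb⟩ := hE i
    simp only [Derivation.commutator_apply, ha, hb, ← algebraMap_eq, Derivation.map_algebraMap]
    simp
  have h2 := congrArg (fun F => F p) h
  simpa [Derivation.commutator_apply, sub_eq_zero] using h2

lemma fluctDeriv_comm (c : ℂ) (J K : T × Fin k) (p : MvPolynomial (T × Fin k) ℂ) :
    fluctDeriv c J (fluctDeriv c K p) = fluctDeriv c K (fluctDeriv c J p) :=
  derivation_comm_of_const _ _ (fun _ => ⟨_, fluctDeriv_X c _ _⟩) (fun _ => ⟨_, fluctDeriv_X c _ _⟩) p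

lemma fluctDeriv_pderiv_comm (c : ℂ) (J K : T × Fin k) (p : MvPolynomial (T × Fin k) ℂ) :
    fluctDeriv c J (pderiv K p) = pderiv K (fluctDeriv c J p) :=
  derivation_comm_of_const _ _ (fun _ => ⟨_, fluctDeriv_X c _ _⟩)
    (fun i => ⟨Pi.single (M := fun _ => ℂ) K 1 i, by
      rw [pderiv_X, Pi.single_apply, Pi.single_apply]; split_ifs <;> simp⟩) p

lemma fluctLap_fluctDeriv (c : ℂ) (K : T × Fin k) (p : MvPolynomial (T × Fin k) ℂ) :
    fluctLap T k c (fluctDeriv c K p) = fluctDeriv c K (fluctLap T k c p) := by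
  simp only [fluctLap_apply, map_sum, Derivation.map_smul]
  refine Finset.sum_congr rfl fun J _ => ?_
  rw [fluctDeriv_comm c J K, fluctDeriv_comm c J K]

lemma fluctLap_pderiv (c : ℂ) (K : T × Fin k) (p : MvPolynomial (T × Fin k) ℂ) :
    fluctLap T k c (pderiv K p) = pderiv K (fluctLap T k c p) := by
  simp only [fluctLap_apply, map_sum, Derivation.map_smul]
  refine Finset.sum_congr rfl fun J _ => ?_
  rw [fluctDeriv_pderiv_comm, fluctDeriv_pderiv_comm]

lemma fluctLap_pow_pderiv (c : ℂ) (r : ℕ) (K : T × Fin k) (p : MvPolynomial (T × Fin k) ℂ) :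
    (fluctLap T k c ^ r) (pderiv K p) = pderiv K ((fluctLap T k c ^ r) p) := by
  induction r generalizing p with
  | zero => rfl
  | succ r ih => rw [pow_succ, Module.End.mul_apply, Module.End.mul_apply, fluctLap_pderiv, ih]

/-- The commutator of the Laplacian across with X_K is -D_K. The Leibniz rule yields the D_J
contracted with the projection matrix, and the contraction returns D_K because the D_J sum to zero
over each fibre. -/
lemma fluctLap_X_mul {c : ℂ} (hc : (k : ℂ) * c ^ 2 = 1) (K : T × Fin k)
    (p : MvPolynomial (T × Fin k) ℂ) :
    fluctLap T k c (X K * p) = X K * fluctLap T k c p - fluctDeriv c K p := by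
  rw [← sum_projection_mul (c := c) (fun J => fluctDeriv c J p) (fun t => sum_fluctDeriv hc t p) K]
  simp only [fluctLap_apply, Finset.mul_sum, ← Finset.sum_sub_distrib]
  refine Finset.sum_congr rfl fun J _ => ?_
  have e : (if J = K then (1 : ℂ) else 0) - (if J.1 = K.1 then c ^ 2 else 0) =
      (if K = J then (1 : ℂ) else 0) - (if K.1 = J.1 then c ^ 2 else 0) := by
    simp only [eq_comm]
  simp only [Derivation.leibniz, fluctDeriv_X, smul_eq_mul, map_add, fluctDeriv_C, ← e]
  simp only [smul_eq_C_mul]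
  have h2 : (C (-1 / 2) : MvPolynomial (T × Fin k) ℂ) * 2 = -1 := by
    rw [show (2 : MvPolynomial (T × Fin k) ℂ) = C 2 from (map_ofNat C 2).symm, ← C_mul]
    norm_num
  generalize C ((if J = K then (1:ℂ) else 0) - if J.1 = K.1 then c ^ 2 else 0) = a
  linear_combination (a * fluctDeriv c J p) * h2

lemma fluctLap_pow_X_mul {c : ℂ} (hc : (k : ℂ) * c ^ 2 = 1) (r : ℕ) (K : T × Fin k)
    (p : MvPolynomial (T × Fin k) ℂ) :
    (fluctLap T k c ^ (r + 1)) (X K * p) = X K * (fluctLap T k c ^ (r + 1)) p -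
      (r + 1 : ℂ) • fluctDeriv c K ((fluctLap T k c ^ r) p) := by
  induction r with
  | zero => simp [fluctLap_X_mul hc]
  | succ r ih =>
    rw [pow_succ', Module.End.mul_apply, ih, map_sub, fluctLap_X_mul hc, map_smul,
      fluctLap_fluctDeriv, ← Module.End.mul_apply, ← Module.End.mul_apply, ← pow_succ', ← pow_succ']
    push_cast
    module

lemma restr_avgVar {c : ℂ} (hc : (k : ℂ) * c ^ 2 = 1) (t : T) :
    restr T k c (avgVar k c t) = X t := by
  simp only [avgVar, restr, map_sum, map_mul, aeval_X, aeval_C, algebraMap_eq]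
  rw [Finset.sum_const, Finset.card_univ, Fintype.card_fin, nsmul_eq_mul,
    show (k : MvPolynomial T ℂ) = C (k : ℂ) from (map_natCast C _).symm, ← mul_assoc, ← mul_assoc,
    ← C_mul, ← C_mul, show (k : ℂ) * c * c = 1 by rw [← hc]; ring]
  simp

lemma restr_embed {c : ℂ} (hc : (k : ℂ) * c ^ 2 = 1) (f : MvPolynomial T ℂ) :
    restr T k c (embed T k c f) = f := by
  have h : (restr T k c).comp (embed T k c) = AlgHom.id ℂ _ := by
    refine MvPolynomial.algHom_ext fun t => ?_
    simp [embed, restr_avgVar hc]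
  exact congrArg (fun F => F f) h

lemma restr_fluctSq {c : ℂ} (hc : (k : ℂ) * c ^ 2 = 1) : restr T k c (fluctSq T k c) = 0 := by
  simp only [fluctSq, map_sum, map_mul, map_pow]
  refine Finset.sum_eq_zero fun J _ => ?_
  have : restr T k c (fluctVar c J) = 0 := by
    rw [fluctVar, map_sub, map_mul, restr_avgVar hc]
    simp [restr]
  simp [this]

/-- The chain rule along the subspace X_(t,j) = c X_t. -/
lemma pderiv_restr {c : ℂ} (t : T) (p : MvPolynomial (T × Fin k) ℂ) :
    pderiv t (restr T k c p) = restr T k c (avgDeriv k c t p) := by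
  induction p using MvPolynomial.induction_on with
  | C a =>
    have h : avgDeriv k c t (C a) = 0 := by rw [← algebraMap_eq, Derivation.map_algebraMap]
    rw [h, restr, aeval_C, algebraMap_eq, pderiv_C, map_zero]
  | add p q hp hq => simp [hp, hq]
  | mul_X p K hp =>
    rw [map_mul, Derivation.leibniz, hp, Derivation.leibniz, avgDeriv_X]
    simp only [restr, map_add, smul_eq_mul, map_mul, aeval_X, aeval_C, algebraMap_eq,
      Derivation.leibniz, pderiv_C, pderiv_X, Pi.single_apply]
    by_cases h : t = K.1
    · simp [h]
    · simp [h, Ne.symm h]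

/-- The part of `exp(A)` of order `r`, restricted to the averages. -/
def lower (T : Type*) [Fintype T] (k : ℕ) (c : ℂ) (r : ℕ) :
    MvPolynomial (T × Fin k) ℂ →ₗ[ℂ] MvPolynomial T ℂ :=
  (r.factorial : ℂ)⁻¹ • (restr T k c).toLinearMap ∘ₗ (fluctLap T k c ^ r)

/-- The adjoint of `lower`. -/
def raise (T : Type*) [Fintype T] (k : ℕ) (c : ℂ) (r : ℕ) :
    MvPolynomial T ℂ →ₗ[ℂ] MvPolynomial (T × Fin k) ℂ :=
  (r.factorial : ℂ)⁻¹ • LinearMap.mulLeft ℂ (fluctSq T k c ^ r) ∘ₗ (embed T k c).toLinearMap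

lemma lower_apply (c : ℂ) (r : ℕ) (p : MvPolynomial (T × Fin k) ℂ) :
    lower T k c r p = (r.factorial : ℂ)⁻¹ • restr T k c ((fluctLap T k c ^ r) p) := rfl

lemma raise_apply (c : ℂ) (r : ℕ) (f : MvPolynomial T ℂ) :
    raise T k c r f = (r.factorial : ℂ)⁻¹ • (fluctSq T k c ^ r * embed T k c f) := rfl

lemma fluctLap_embed {c : ℂ} (hc : (k : ℂ) * c ^ 2 = 1) (f : MvPolynomial T ℂ) :
    fluctLap T k c (embed T k c f) = 0 := by
  simp [fluctLap_apply, fluctDeriv_embed hc]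

lemma fluctLap_raise_succ {c m : ℂ} (hc : (k : ℂ) * c ^ 2 = 1)
    (hm : 2 * m = (Fintype.card T : ℂ) * (k - 1)) (r : ℕ) (f : MvPolynomial T ℂ) :
    fluctLap T k c (raise T k c (r + 1) f) = (m + r) • raise T k c r f := by
  rw [raise_apply, map_smul, fluctLap_fluctSq_pow_mul hc hm r _ (fun J => fluctDeriv_embed hc J f),
    raise_apply, ← smul_eq_C_mul, smul_smul, smul_smul]
  congr 1
  have : (r.factorial : ℂ) ≠ 0 := Nat.cast_ne_zero.2 r.factorial_ne_zero
  have h2 : (r + 1 : ℂ) ≠ 0 := by exact_mod_cast r.succ_ne_zero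
  rw [Nat.factorial_succ]
  push_cast
  field_simp
  ring

lemma fluctLap_pow_raise_self {c m : ℂ} (hc : (k : ℂ) * c ^ 2 = 1)
    (hm : 2 * m = (Fintype.card T : ℂ) * (k - 1)) (r : ℕ) (f : MvPolynomial T ℂ) :
    (fluctLap T k c ^ r) (raise T k c r f) = (∏ j ∈ Finset.range r, (m + j)) • embed T k c f := by
  induction r with
  | zero => simp [raise_apply]
  | succ r ih =>
    rw [pow_succ, Module.End.mul_apply, fluctLap_raise_succ hc hm, map_smul, ih, smul_smul,
      Finset.prod_range_succ, mul_comm]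

lemma fluctLap_pow_raise_add {c m : ℂ} (hc : (k : ℂ) * c ^ 2 = 1)
    (hm : 2 * m = (Fintype.card T : ℂ) * (k - 1)) (r s : ℕ) (f : MvPolynomial T ℂ) :
    ∃ a : ℂ, (fluctLap T k c ^ r) (raise T k c (r + s) f) = a • raise T k c s f := by
  induction r with
  | zero => exact ⟨1, by simp⟩
  | succ r ih =>
    obtain ⟨a, ha⟩ := ih
    refine ⟨(m + (r + s : ℕ)) * a, ?_⟩
    rw [pow_succ, Module.End.mul_apply, add_right_comm, fluctLap_raise_succ hc hm, map_smul, ha,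
      smul_smul]

lemma lower_raise_self {c m : ℂ} (hc : (k : ℂ) * c ^ 2 = 1)
    (hm : 2 * m = (Fintype.card T : ℂ) * (k - 1)) (r : ℕ) (f : MvPolynomial T ℂ) :
    lower T k c r (raise T k c r f) =
      ((∏ j ∈ Finset.range r, (m + j)) / (r.factorial : ℂ)) • f := by
  rw [lower_apply, fluctLap_pow_raise_self hc hm, map_smul, restr_embed hc, smul_smul]
  congr 1
  ring

/-- If r < s, a positive power of q is left over and restricts to zero. If r > s, all powers of q
are used up and one more Laplacian kills the image of `embed`. -/
lemma lower_raise_of_ne {c m : ℂ} (hc : (k : ℂ) * c ^ 2 = 1)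
    (hm : 2 * m = (Fintype.card T : ℂ) * (k - 1)) {r s : ℕ} (h : r ≠ s) (f : MvPolynomial T ℂ) :
    lower T k c r (raise T k c s f) = 0 := by
  rw [lower_apply]
  rcases lt_or_gt_of_ne h with h | h
  · obtain ⟨n, rfl⟩ := Nat.exists_eq_add_of_lt h
    obtain ⟨a, ha⟩ := fluctLap_pow_raise_add hc hm r (n + 1) f
    rw [add_assoc, ha, raise_apply, map_smul, map_smul, map_mul, map_pow, restr_fluctSq hc]
    simp
  · obtain ⟨n, rfl⟩ := Nat.exists_eq_add_of_lt h
    rw [show s + n + 1 = (n + 1) + s by ring, pow_add, Module.End.mul_apply,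
      fluctLap_pow_raise_self hc hm, map_smul, pow_succ, Module.End.mul_apply, fluctLap_embed hc]
    simp

lemma fluctDeriv_isHomogeneous (c : ℂ) (J : T × Fin k) {p : MvPolynomial (T × Fin k) ℂ} {n : ℕ}
    (hp : p.IsHomogeneous n) : (fluctDeriv c J p).IsHomogeneous (n - 1) := by
  rw [fluctDeriv_apply, avgDeriv_apply]
  refine hp.pderiv.sub ?_
  rw [smul_eq_C_mul]
  refine IsHomogeneous.C_mul (IsHomogeneous.sum _ _ _ fun j _ => ?_) _
  rw [smul_eq_C_mul]
  exact hp.pderiv.C_mul _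

lemma fluctDeriv_eq_zero (c : ℂ) (J : T × Fin k) {p : MvPolynomial (T × Fin k) ℂ}
    (hp : p.IsHomogeneous 0) : fluctDeriv c J p = 0 := by
  rw [← totalDegree_zero_iff_isHomogeneous, totalDegree_eq_zero_iff_eq_C] at hp
  rw [hp]
  exact fluctDeriv_C _ _ _

lemma fluctLap_isHomogeneous (c : ℂ) {p : MvPolynomial (T × Fin k) ℂ} {n : ℕ}
    (hp : p.IsHomogeneous n) : (fluctLap T k c p).IsHomogeneous (n - 2) := by
  rw [fluctLap_apply]
  refine IsHomogeneous.sum _ _ _ fun J _ => ?_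
  rw [smul_eq_C_mul]
  exact (fluctDeriv_isHomogeneous c J (fluctDeriv_isHomogeneous c J hp)).C_mul _

lemma fluctLap_eq_zero (c : ℂ) {p : MvPolynomial (T × Fin k) ℂ} {n : ℕ}
    (hp : p.IsHomogeneous n) (hn : n < 2) : fluctLap T k c p = 0 := by
  rw [fluctLap_apply]
  refine Finset.sum_eq_zero fun J _ => ?_
  have h := fluctDeriv_isHomogeneous c J hp
  rw [show n - 1 = 0 by omega] at h
  rw [fluctDeriv_eq_zero c J h, smul_zero]

lemma fluctLap_pow_isHomogeneous (c : ℂ) (r : ℕ) {p : MvPolynomial (T × Fin k) ℂ} {n : ℕ}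
    (hp : p.IsHomogeneous n) : ((fluctLap T k c ^ r) p).IsHomogeneous (n - 2 * r) := by
  induction r with
  | zero => simpa using hp
  | succ r ih =>
    rw [pow_succ', Module.End.mul_apply, show n - 2 * (r + 1) = n - 2 * r - 2 by omega]
    exact fluctLap_isHomogeneous c ih

lemma fluctLap_pow_eq_zero (c : ℂ) {r : ℕ} {p : MvPolynomial (T × Fin k) ℂ} {n : ℕ}
    (hp : p.IsHomogeneous n) (hr : n < 2 * r) : (fluctLap T k c ^ r) p = 0 := by
  obtain ⟨s, rfl⟩ := Nat.exists_eq_succ_of_ne_zero (show r ≠ 0 by omega)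
  rw [Nat.succ_eq_add_one, pow_succ', Module.End.mul_apply]
  exact fluctLap_eq_zero c (fluctLap_pow_isHomogeneous c s hp) (by omega)

lemma lower_eq_zero (c : ℂ) {r : ℕ} {p : MvPolynomial (T × Fin k) ℂ} {n : ℕ}
    (hp : p.IsHomogeneous n) (hr : n < 2 * r) : lower T k c r p = 0 := by
  rw [lower_apply, fluctLap_pow_eq_zero c hp hr]
  simp

lemma restr_isHomogeneous (c : ℂ) {p : MvPolynomial (T × Fin k) ℂ} {n : ℕ}
    (hp : p.IsHomogeneous n) : (restr T k c p).IsHomogeneous n := by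
  have := hp.aeval (fun J : T × Fin k => (C c * X J.1 : MvPolynomial T ℂ)) (n := 1)
    (fun J => (isHomogeneous_X ℂ J.1).C_mul c)
  simpa [restr] using this

lemma lower_isHomogeneous (c : ℂ) (r : ℕ) {p : MvPolynomial (T × Fin k) ℂ} {n : ℕ}
    (hp : p.IsHomogeneous n) : (lower T k c r p).IsHomogeneous (n - 2 * r) := by
  rw [lower_apply, smul_eq_C_mul]
  exact (restr_isHomogeneous c (fluctLap_pow_isHomogeneous c r hp)).C_mul _

lemma avgVar_isHomogeneous (c : ℂ) (t : T) : (avgVar k c t).IsHomogeneous 1 :=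
  IsHomogeneous.sum _ _ _ fun _ _ => (isHomogeneous_X ℂ _).C_mul c

lemma fluctSq_isHomogeneous (c : ℂ) : (fluctSq T k c).IsHomogeneous 2 := by
  refine IsHomogeneous.sum _ _ _ fun J _ => IsHomogeneous.C_mul ?_ _
  exact (((isHomogeneous_X ℂ J).sub ((avgVar_isHomogeneous c _).C_mul c)).pow 2)

lemma raise_isHomogeneous (c : ℂ) (r : ℕ) {f : MvPolynomial T ℂ} {n : ℕ}
    (hf : f.IsHomogeneous n) : (raise T k c r f).IsHomogeneous (2 * r + n) := by
  rw [raise_apply, smul_eq_C_mul]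
  refine (((fluctSq_isHomogeneous c).pow r).mul ?_).C_mul _
  simpa [embed] using hf.aeval (avgVar k c) (n := 1) (fun t => avgVar_isHomogeneous c t)

end Algebra

/-! ### Hermite polynomials in one variable -/

section Hermite1D

open Polynomial

lemma derivative_hermite_succ (n : ℕ) :
    derivative (hermite (n + 1)) = ((n : ℤ) + 1) • hermite n := by
  induction n with
  | zero => simp
  | succ n ih =>
    rw [hermite_succ (n + 1), derivative_sub, derivative_mul, ih, derivative_X, derivative_smul]
    nth_rw 1 [hermite_succ n]
    simp only [zsmul_eq_mul]
    push_cast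
    rw [hermite_succ n]
    ring

lemma integrable_polynomial_mul_gaussianPDF (p : ℝ[X]) :
    Integrable (fun x => p.eval x * gaussianPDFReal 0 1 x) := by
  have h := integrable_aeval_gaussian p
  rw [gaussianReal_of_var_ne_zero _ one_ne_zero,
    integrable_withDensity_iff_integrable_smul' (measurable_gaussianPDF _ _)
      (ae_of_all _ fun x => gaussianPDF_lt_top)] at h
  refine h.congr (ae_of_all _ fun x => ?_)
  simp [toReal_gaussianPDF, mul_comm]

/-- Integration by parts: the Gaussian density v satisfies v' = -x v. -/
lemma integral_X_mul_gaussian (p : ℝ[X]) :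
    ∫ x, x * p.eval x ∂(gaussianReal 0 1) = ∫ x, (derivative p).eval x ∂(gaussianReal 0 1) := by
  rw [integral_gaussianReal_eq_integral_smul one_ne_zero,
    integral_gaussianReal_eq_integral_smul one_ne_zero]
  have hv : ∀ x : ℝ, HasDerivAt (gaussianPDFReal 0 1) (-x * gaussianPDFReal 0 1 x) x := by
    intro x
    rw [gaussianPDFReal_def]
    have h1 : HasDerivAt (fun x : ℝ => -(x - 0) ^ 2 / (2 * ((1 : NNReal) : ℝ))) (-x) x := by
      have := ((((hasDerivAt_id x).sub_const 0).pow 2).neg).div_const (2 * ((1 : NNReal) : ℝ))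
      refine this.congr_deriv ?_
      simp
      ring
    refine ((h1.exp).const_mul _).congr_deriv ?_
    ring
  have h := integral_mul_deriv_eq_deriv_mul_of_integrable (u := fun x => p.eval x)
    (v := gaussianPDFReal 0 1) (fun x _ => p.hasDerivAt x) (fun x _ => hv x) ?_ ?_ ?_
  · rw [← neg_inj, ← integral_neg]
    simp only [smul_eq_mul]
    rw [show (fun x : ℝ => -(gaussianPDFReal 0 1 x * (x * p.eval x))) =
      fun x => p.eval x * (-x * gaussianPDFReal 0 1 x) from funext fun x => by ring, h]
    simp only [mul_comm]
  · refine (integrable_polynomial_mul_gaussianPDF (-X * p)).congr (ae_of_all _ fun x => ?_)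
    simp; ring
  · exact integrable_polynomial_mul_gaussianPDF _
  · exact integrable_polynomial_mul_gaussianPDF _

/-- The Hermite polynomial with real coefficients. -/
def hermiteReal (n : ℕ) : ℝ[X] := (hermite n).map (Int.castRingHom ℝ)

lemma eval_hermiteReal (n : ℕ) (x : ℝ) : (hermiteReal n).eval x = aeval x (hermite n) := by
  rw [hermiteReal, eval_map, aeval_def]
  rfl

lemma hermiteReal_succ (n : ℕ) :
    hermiteReal (n + 1) = X * hermiteReal n - derivative (hermiteReal n) := by
  simp [hermiteReal, hermite_succ, derivative_map]

lemma derivative_hermiteReal (n : ℕ) :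
    derivative (hermiteReal n) = (n : ℝ) • hermiteReal (n - 1) := by
  cases n with
  | zero => simp [hermiteReal]
  | succ n =>
    rw [hermiteReal, derivative_map, derivative_hermite_succ, Nat.add_sub_cancel, hermiteReal]
    simp [smul_eq_C_mul]

/-- The creation operator x - d/dx, which produces H_(n+1) from H_n, is the adjoint of d/dx. -/
lemma integral_hermite_succ_mul (n : ℕ) (p : ℝ[X]) :
    ∫ x, (hermiteReal (n + 1) * p).eval x ∂(gaussianReal 0 1) =
      ∫ x, (hermiteReal n * derivative p).eval x ∂(gaussianReal 0 1) := by
  have h1 := integral_X_mul_gaussian (hermiteReal n * p)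
  rw [derivative_mul] at h1
  have h2 : ∀ x : ℝ, (hermiteReal (n + 1) * p).eval x =
      x * (hermiteReal n * p).eval x - (derivative (hermiteReal n) * p).eval x := by
    intro x
    rw [hermiteReal_succ]
    simp
    ring
  simp only [h2]
  rw [integral_sub, h1]
  · simp only [eval_add]
    rw [integral_add (integrable_aeval_gaussian _) (integrable_aeval_gaussian _)]
    ring
  · refine (integrable_aeval_gaussian (X * (hermiteReal n * p))).congr (ae_of_all _ fun x => ?_)
    simp
  · exact integrable_aeval_gaussian _

lemma integral_hermite_mul_hermite (m n : ℕ) :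
    ∫ x, (hermiteReal m).eval x * (hermiteReal n).eval x ∂(gaussianReal 0 1) =
      if m = n then (n.factorial : ℝ) else 0 := by
  simp only [← eval_mul]
  induction m generalizing n with
  | zero =>
    cases n with
    | zero => simp [hermiteReal]
    | succ n =>
      rw [mul_comm, integral_hermite_succ_mul]
      simp [hermiteReal]
  | succ m ih =>
    rw [integral_hermite_succ_mul, derivative_hermiteReal]
    cases n with
    | zero => simp
    | succ n =>
      simp only [Nat.add_sub_cancel, mul_smul_comm, eval_smul, smul_eq_mul]
      rw [integral_const_mul, ih]
      simp only [Nat.add_right_cancel_iff]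
      split_ifs
      · rw [Nat.factorial_succ]; push_cast; ring
      · simp

end Hermite1D

/-! ### The Fischer inner product and the Hermite isometry -/

section Fischer

open MvPolynomial

variable {σ : Type*} [Fintype σ]

/-- The linear map sending `X^N` to the multivariate Hermite polynomial of index `N`. -/
def hermEval (σ : Type*) [Fintype σ] : MvPolynomial σ ℂ →ₗ[ℂ] ((σ → ℝ) → ℂ) :=
  (basisMonomials σ ℂ).constr ℂ fun N x => ((∏ i, (hermiteReal (N i)).eval (x i) : ℝ) : ℂ)

lemma hermEval_monomial (N : σ →₀ ℕ) (a : ℂ) (x : σ → ℝ) :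
    hermEval σ (monomial N a) x = a * ((∏ i, (hermiteReal (N i)).eval (x i) : ℝ) : ℂ) := by
  have h : (monomial N a : MvPolynomial σ ℂ) = a • basisMonomials σ ℂ N := by
    rw [coe_basisMonomials, smul_monomial, smul_eq_mul, mul_one]
  rw [h, map_smul, hermEval, Module.Basis.constr_basis]
  rfl

/-- The Fischer inner product, for which `⟨X^M, X^N⟩ = δ_{MN} N!`. -/
def fischer (σ : Type*) [Fintype σ] :
    MvPolynomial σ ℂ →ₗ[ℂ] (MvPolynomial σ ℂ →ₗ⋆[ℂ] ℂ) :=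
  (basisMonomials σ ℂ).constr ℂ fun N =>
    { toFun := fun q => conj (q.coeff N) * ((∏ i, (N i).factorial : ℕ) : ℂ)
      map_add' := fun p q => by simp [add_mul]
      map_smul' := fun a q => by simp [mul_assoc] }

lemma fischer_monomial (N : σ →₀ ℕ) (a : ℂ) (q : MvPolynomial σ ℂ) :
    fischer σ (monomial N a) q = a * conj (q.coeff N) * ((∏ i, (N i).factorial : ℕ) : ℂ) := by
  have h : (monomial N a : MvPolynomial σ ℂ) = a • basisMonomials σ ℂ N := by
    rw [coe_basisMonomials, smul_monomial, smul_eq_mul, mul_one]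
  rw [h, map_smul, fischer, Module.Basis.constr_basis, mul_assoc]
  rfl

lemma fischer_conj_symm (p q : MvPolynomial σ ℂ) : conj (fischer σ p q) = fischer σ q p := by
  classical
  induction p using MvPolynomial.induction_on' with
  | add p p' hp hp' => simp [hp, hp']
  | monomial M a =>
    induction q using MvPolynomial.induction_on' with
    | add q q' hq hq' => simp [hq, hq']
    | monomial N b =>
      rw [fischer_monomial, fischer_monomial, coeff_monomial, coeff_monomial]
      by_cases h : M = N
      · subst h; simp [mul_comm]
      · simp [h, Ne.symm h]

lemma fischer_X_mul [DecidableEq σ] (i : σ) (p q : MvPolynomial σ ℂ) :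
    fischer σ (X i * p) q = fischer σ p (pderiv i q) := by
  induction p using MvPolynomial.induction_on' with
  | add p p' hp hp' => rw [mul_add]; simp [hp, hp']
  | monomial M a =>
    rw [mul_comm, X, monomial_mul, mul_one, fischer_monomial, fischer_monomial, coeff_pderiv]
    have h : ∏ j, ((M + Finsupp.single i 1 : σ →₀ ℕ) j).factorial = (M i + 1) * ∏ j, (M j).factorial := by
      rw [← Finset.mul_prod_erase _ _ (Finset.mem_univ i),
        ← Finset.mul_prod_erase (s := Finset.univ) (fun j => (M j).factorial) (Finset.mem_univ i),
        ← mul_assoc]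
      congr 1
      · simp [Nat.factorial_succ]
      · refine Finset.prod_congr rfl fun j hj => ?_
        simp [(Finset.ne_of_mem_erase hj).symm]
    rw [h]
    simp
    ring

lemma fischer_self (p : MvPolynomial σ ℂ) :
    fischer σ p p = ((∑ M ∈ p.support, ‖p.coeff M‖ ^ 2 * (∏ i, (M i).factorial : ℕ) : ℝ) : ℂ) := by
  have h : ∀ q, fischer σ p q = ∑ M ∈ p.support, p.coeff M * conj (q.coeff M) *
      ((∏ i, (M i).factorial : ℕ) : ℂ) := by
    intro q
    conv_lhs => rw [p.as_sum]
    rw [map_sum, LinearMap.sum_apply]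
    exact Finset.sum_congr rfl fun M _ => fischer_monomial _ _ _
  rw [h]
  push_cast
  refine Finset.sum_congr rfl fun M _ => ?_
  rw [Complex.mul_conj, Complex.normSq_eq_norm_sq]
  push_cast
  rfl

lemma fischer_self_re_nonneg (p : MvPolynomial σ ℂ) : 0 ≤ (fischer σ p p).re := by
  rw [fischer_self, Complex.ofReal_re]
  positivity

lemma fischer_eq_zero_of_degree_ne {p q : MvPolynomial σ ℂ} {m n : ℕ} (hp : p.IsHomogeneous m)
    (hq : q.IsHomogeneous n) (h : m ≠ n) : fischer σ p q = 0 := by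
  rw [p.as_sum, map_sum, LinearMap.sum_apply]
  refine Finset.sum_eq_zero fun M hM => ?_
  rw [fischer_monomial, hq.coeff_eq_zero, map_zero]
  · simp
  · intro hd
    have := hp (mem_support_iff.1 hM)
    rw [Finsupp.degree_eq_weight_one] at hd
    exact h (this.symm.trans hd)

/-- The recurrence H_(n+1) = x H_n - H_n', where H_n' = n H_(n-1) is read as differentiation of the
symbol p. This is the recursion that drives `hermEval_restrict`. -/
lemma hermEval_X_mul [DecidableEq σ] (i : σ) (p : MvPolynomial σ ℂ) (x : σ → ℝ) :
    hermEval σ (X i * p) x = x i * hermEval σ p x - hermEval σ (pderiv i p) x := by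
  induction p using MvPolynomial.induction_on' with
  | add p q hp hq => rw [mul_add]; simp only [map_add, Pi.add_apply, hp, hq]; ring
  | monomial M a =>
    rw [mul_comm, X, monomial_mul, mul_one, pderiv_monomial, hermEval_monomial, hermEval_monomial,
      hermEval_monomial]
    simp only [← Finset.mul_prod_erase (Finset.univ : Finset σ) _ (Finset.mem_univ i)]
    have h1 : ∏ j ∈ Finset.univ.erase i, (hermiteReal ((M + Finsupp.single i 1 : σ →₀ ℕ) j)).eval (x j) =
        ∏ j ∈ Finset.univ.erase i, (hermiteReal (M j)).eval (x j) :=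
      Finset.prod_congr rfl fun j hj => by
        simp [(Finset.ne_of_mem_erase hj).symm]
    have h2 : ∏ j ∈ Finset.univ.erase i, (hermiteReal ((M - Finsupp.single i 1 : σ →₀ ℕ) j)).eval (x j) =
        ∏ j ∈ Finset.univ.erase i, (hermiteReal (M j)).eval (x j) :=
      Finset.prod_congr rfl fun j hj => by
        simp [(Finset.ne_of_mem_erase hj).symm]
    rw [h1, h2]
    simp only [Finsupp.add_apply, Finsupp.single_eq_same, Finsupp.tsub_apply, hermiteReal_succ,
      derivative_hermiteReal, Polynomial.eval_sub, Polynomial.eval_mul, Polynomial.eval_X,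
      Polynomial.eval_smul, smul_eq_mul]
    push_cast
    ring

lemma memLp_hermEval (p : MvPolynomial σ ℂ) :
    MemLp (hermEval σ p) 2 (Measure.pi fun _ : σ => gaussianReal 0 1) := by
  induction p using MvPolynomial.induction_on' with
  | add p q hp hq => rw [map_add]; exact hp.add hq
  | monomial M a =>
    have hc : Continuous (hermEval σ (monomial M a)) := by
      rw [show hermEval σ (monomial M a) = _ from funext fun x => hermEval_monomial M a x]
      refine continuous_const.mul (Complex.continuous_ofReal.comp ?_)
      exact continuous_finsetProd _ fun i _ => (Polynomial.continuous _).comp (continuous_apply i)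
    rw [memLp_two_iff_integrable_sq_norm hc.aestronglyMeasurable]
    have h := Integrable.fintype_prod (𝕜 := ℝ) (ι := σ)
      (f := fun i (x : ℝ) => (hermiteReal (M i) ^ 2).eval x)
      (μ := fun _ : σ => gaussianReal 0 1) (fun i => integrable_aeval_gaussian _)
    refine (h.const_mul (‖a‖ ^ 2)).congr (ae_of_all _ fun x => ?_)
    simp [hermEval_monomial, mul_pow, ← Finset.prod_pow]

lemma integral_hermEval_mul (p q : MvPolynomial σ ℂ) :
    ∫ x, hermEval σ p x * conj (hermEval σ q x) ∂(Measure.pi fun _ : σ => gaussianReal 0 1) =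
      fischer σ p q := by
  classical
  have hint : ∀ p q : MvPolynomial σ ℂ, Integrable
      (fun x => hermEval σ p x * conj (hermEval σ q x))
      (Measure.pi fun _ : σ => gaussianReal 0 1) :=
    fun p q => (memLp_hermEval p).integrable_mul (memLp_hermEval q).star
  induction p using MvPolynomial.induction_on' with
  | add p p' hp hp' =>
    simp only [map_add, Pi.add_apply, LinearMap.add_apply, add_mul]
    rw [integral_add (hint _ _) (hint _ _), hp, hp']
  | monomial M a =>
    induction q using MvPolynomial.induction_on' with
    | add q q' hq hq' =>
      simp only [map_add, Pi.add_apply, mul_add]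
      rw [integral_add (hint _ _) (hint _ _), hq, hq']
    | monomial N b =>
      have h : ∀ x : σ → ℝ, hermEval σ (monomial M a) x * conj (hermEval σ (monomial N b) x) =
          a * conj b * ((∏ i, ((hermiteReal (M i)).eval (x i) * (hermiteReal (N i)).eval (x i)) : ℝ) : ℂ) := by
        intro x
        rw [hermEval_monomial, hermEval_monomial, map_mul, Complex.conj_ofReal,
          Finset.prod_mul_distrib]
        push_cast
        ring
      simp only [h]
      rw [integral_const_mul, integral_complex_ofReal,
        integral_fintype_prod_eq_prod (fun i x => (hermiteReal (M i)).eval x * (hermiteReal (N i)).eval x)]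
      simp only [integral_hermite_mul_hermite]
      rw [fischer_monomial, coeff_monomial]
      by_cases hMN : M = N
      · subst hMN; simp
      · obtain ⟨i, hi⟩ := DFunLike.ne_iff.1 hMN
        rw [Finset.prod_eq_zero (Finset.mem_univ i) (by simp [hi])]
        simp [Ne.symm hMN]

end Fischer

/-! ### The kernel of restricted Hermite polynomials as a sum of raise-lower products -/

section Kernel

open MvPolynomial

set_option linter.unusedSectionVars false

variable {T : Type*} [Fintype T] [DecidableEq T] {k : ℕ}

lemma lower_C (c a : ℂ) (r : ℕ) :
    lower T k c r (C a) = if r = 0 then C a else 0 := by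
  split_ifs with h
  · subst h
    simp [lower_apply, restr, algebraMap_eq]
  · exact lower_eq_zero c (isHomogeneous_C _ a) (by omega)

/-- The iterated commutator with X_K after restriction: its factor r + 1 is absorbed by (r+1)!, and
the averaged part of D_K becomes a derivative in X_(K.1). -/
lemma lower_X_mul {c : ℂ} (hc : (k : ℂ) * c ^ 2 = 1) (r : ℕ) (K : T × Fin k)
    (p : MvPolynomial (T × Fin k) ℂ) :
    lower T k c (r + 1) (X K * p) = C c * X K.1 * lower T k c (r + 1) p -
      (lower T k c r (pderiv K p) - c • pderiv K.1 (lower T k c r p)) := by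
  have h0 : (r.factorial : ℂ) ≠ 0 := Nat.cast_ne_zero.2 r.factorial_ne_zero
  have h2 : (r + 1 : ℂ) ≠ 0 := by exact_mod_cast r.succ_ne_zero
  have hX : restr T k c (X K) = C c * X K.1 := by simp [restr]
  rw [lower_apply, fluctLap_pow_X_mul hc, map_sub, map_mul, hX, map_smul, smul_sub, smul_smul,
    lower_apply, lower_apply, lower_apply, fluctDeriv_apply, fluctLap_pow_pderiv, map_sub, map_smul,
    Derivation.map_smul, pderiv_restr, mul_smul_comm]
  congr 1
  rw [show ((r + 1).factorial : ℂ)⁻¹ * (r + 1) = (r.factorial : ℂ)⁻¹ by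
    rw [Nat.factorial_succ]; push_cast; field_simp]
  module

lemma lower_zero_X_mul (c : ℂ) (K : T × Fin k) (p : MvPolynomial (T × Fin k) ℂ) :
    lower T k c 0 (X K * p) = C c * X K.1 * lower T k c 0 p := by
  simp [lower_apply, restr]

/-- Hermite expansion of the restriction of a Hermite polynomial to the subspace of points
constant along the fibres. -/
lemma hermEval_restrict {c : ℝ} (hc : (k : ℂ) * (c : ℂ) ^ 2 = 1) (x : T → ℝ) (n : ℕ) :
    ∀ p : MvPolynomial (T × Fin k) ℂ, p.IsHomogeneous n → ∀ R, n < 2 * R →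
      hermEval _ p (fun J => c * x J.1) =
        ∑ r ∈ Finset.range R, hermEval T (lower T k c r p) x := by
  induction n using Nat.strong_induction_on with
  | _ n ih =>
    -- By linearity monomials suffice. One variable is split off, and the recurrences for `hermEval`
    -- and `lower` are compared.
    have hmon : ∀ M : T × Fin k →₀ ℕ, M.degree = n → ∀ R, n < 2 * R →
        hermEval _ (monomial M (1 : ℂ)) (fun J => c * x J.1) =
          ∑ r ∈ Finset.range R, hermEval T (lower T k c r (monomial M 1)) x := by
      intro M hM R hR
      by_cases hM0 : M = 0
      · subst hM0
        obtain ⟨R, rfl⟩ := Nat.exists_eq_succ_of_ne_zero (show R ≠ 0 by omega)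
        have h1 : (monomial (0 : T × Fin k →₀ ℕ) (1 : ℂ)) = C 1 := rfl
        have h2 : (C 1 : MvPolynomial T ℂ) = monomial 0 1 := rfl
        rw [Finset.sum_range_succ', Finset.sum_eq_zero, hermEval_monomial]
        · simp only [h1, lower_C, if_true, h2, hermEval_monomial]
          simp [hermiteReal]
        · intro r _
          rw [h1, lower_C, if_neg (by omega), map_zero, Pi.zero_apply]
      · obtain ⟨K, hK⟩ := Finsupp.ne_iff.1 hM0
        obtain ⟨M', rfl⟩ : ∃ M', M = M' + Finsupp.single K 1 := by
          refine ⟨M - Finsupp.single K 1, (tsub_add_cancel_of_le ?_).symm⟩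
          rw [Finsupp.single_le_iff]
          exact Nat.one_le_iff_ne_zero.2 hK
        have hdeg : M'.degree + 1 = n := by
          rw [← hM, map_add, Finsupp.degree_single]
        have hmul : monomial (M' + Finsupp.single K 1) (1 : ℂ) = X K * monomial M' 1 := by
          rw [mul_comm, X, monomial_mul, mul_one]
        have hhom : (monomial M' (1 : ℂ)).IsHomogeneous M'.degree := isHomogeneous_monomial _ rfl
        set p := monomial M' (1 : ℂ)
        have i1 := ih M'.degree (by omega) p hhom R (by omega)
        -- In the recurrence ∂_K p enters with order shifted by one, so the cutoff R - 1 is the one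
        -- needed. A constant p is treated apart, as its degree cannot drop.
        have i2 : hermEval _ (pderiv K p) (fun J => (c : ℝ) * x J.1) =
            ∑ r ∈ Finset.range (R - 1), hermEval T (lower T k c r (pderiv K p)) x := by
          rcases Nat.eq_zero_or_pos M'.degree with h0 | h0
          · have : pderiv K p = 0 := by
              rw [h0, ← totalDegree_zero_iff_isHomogeneous, totalDegree_eq_zero_iff_eq_C] at hhom
              rw [hhom, pderiv_C]
            simp [this]
          · have hlt : M'.degree - 1 < 2 * (R - 1) := by clear hK; omega
            exact ih (M'.degree - 1) (by clear hK; omega) _ hhom.pderiv _ hlt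
        -- The degree of p is at most 2(R - 1), so the last piece is constant. This supplies the
        -- boundary term when the shifted sums are matched in `e2`.
        have hlast : pderiv K.1 (lower T k c (R - 1) p) = 0 := by
          have h := lower_isHomogeneous (c : ℂ) (R - 1) hhom
          rw [show M'.degree - 2 * (R - 1) = 0 by clear hK; omega,
            ← totalDegree_zero_iff_isHomogeneous, totalDegree_eq_zero_iff_eq_C] at h
          rw [h, pderiv_C]
        obtain ⟨R, rfl⟩ := Nat.exists_eq_succ_of_ne_zero (show R ≠ 0 by omega)
        simp only [Nat.succ_eq_add_one, Nat.add_sub_cancel] at i1 i2 hlast ⊢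
        rw [hmul, hermEval_X_mul, i1, i2]
        conv_rhs => rw [Finset.sum_range_succ', lower_zero_X_mul]
        simp only [lower_X_mul hc, map_sub, Pi.sub_apply, ← smul_eq_C_mul, map_smul, smul_mul_assoc,
          Pi.smul_apply, hermEval_X_mul, Finset.sum_sub_distrib, smul_eq_mul]
        have e1 : ∑ r ∈ Finset.range (R + 1), hermEval T (lower T k c r p) x =
            ∑ r ∈ Finset.range R, hermEval T (lower T k c (r + 1) p) x +
              hermEval T (lower T k c 0 p) x := Finset.sum_range_succ' _ _
        have e2 : ∑ r ∈ Finset.range R, hermEval T (pderiv K.1 (lower T k c (r + 1) p)) x +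
              hermEval T (pderiv K.1 (lower T k c 0 p)) x =
            ∑ r ∈ Finset.range R, hermEval T (pderiv K.1 (lower T k c r p)) x := by
          rw [← Finset.sum_range_succ' (fun r => hermEval T (pderiv K.1 (lower T k c r p)) x),
            Finset.sum_range_succ, hlast]
          simp
        rw [← Finset.mul_sum, ← Finset.mul_sum, Finset.sum_sub_distrib, ← Finset.mul_sum]
        rw [e1]
        push_cast
        linear_combination (c : ℂ) * e2
    intro p hp R hR
    rw [p.as_sum]
    simp only [map_sum, Finset.sum_apply]
    rw [Finset.sum_comm]
    refine Finset.sum_congr rfl fun M hM => ?_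
    have hd : M.degree = n := by
      have := hp (mem_support_iff.1 hM)
      rw [Finsupp.degree_eq_weight_one]
      exact this
    have h1 : monomial M (p.coeff M) = p.coeff M • monomial M (1 : ℂ) := by
      rw [smul_monomial, smul_eq_mul, mul_one]
    rw [h1]
    simp only [map_smul, Pi.smul_apply, hmon M hd R hR, Finset.smul_sum]

lemma fischer_smul_left {σ : Type*} [Fintype σ] (a : ℂ) (p q : MvPolynomial σ ℂ) :
    fischer σ (a • p) q = a * fischer σ p q := by simp

lemma fischer_smul_right {σ : Type*} [Fintype σ] (a : ℝ) (p q : MvPolynomial σ ℂ) :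
    fischer σ p ((a : ℂ) • q) = a * fischer σ p q := by
  rw [LinearMap.map_smulₛₗ, Complex.conj_ofReal, smul_eq_mul]

lemma fischer_avgVar_mul (c : ℝ) (t : T) (p q : MvPolynomial (T × Fin k) ℂ) :
    fischer _ (avgVar k c t * p) q = fischer _ p (avgDeriv k c t q) := by
  simp only [avgVar, Finset.sum_mul, map_sum, LinearMap.sum_apply, avgDeriv_apply]
  refine Finset.sum_congr rfl fun j _ => ?_
  rw [mul_assoc, ← smul_eq_C_mul, fischer_smul_left, fischer_smul_right, fischer_X_mul]

lemma fischer_fluctVar_mul (c : ℝ) (J : T × Fin k) (p q : MvPolynomial (T × Fin k) ℂ) :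
    fischer _ (fluctVar (c : ℂ) J * p) q = fischer _ p (fluctDeriv (c : ℂ) J q) := by
  rw [fluctVar, sub_mul, map_sub, LinearMap.sub_apply, fischer_X_mul, mul_assoc, ← smul_eq_C_mul,
    fischer_smul_left, fischer_avgVar_mul, fluctDeriv_apply, map_sub, fischer_smul_right]

lemma fischer_fluctSq_mul (c : ℝ) (p q : MvPolynomial (T × Fin k) ℂ) :
    fischer _ (fluctSq T k c * p) q = fischer _ p (fluctLap T k c q) := by
  rw [fluctSq, Finset.sum_mul, map_sum, LinearMap.sum_apply, fluctLap_apply, map_sum]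
  refine Finset.sum_congr rfl fun J _ => ?_
  rw [mul_assoc, ← smul_eq_C_mul, fischer_smul_left, pow_two, mul_assoc, fischer_fluctVar_mul,
    fischer_fluctVar_mul, show (-1 / 2 : ℂ) = ((-1 / 2 : ℝ) : ℂ) by push_cast; rfl,
    fischer_smul_right]

lemma fischer_fluctSq_pow_mul (c : ℝ) (r : ℕ) (p q : MvPolynomial (T × Fin k) ℂ) :
    fischer _ (fluctSq T k c ^ r * p) q = fischer _ p ((fluctLap T k c ^ r) q) := by
  induction r generalizing q with
  | zero => simp
  | succ r ih =>
    rw [pow_succ', mul_assoc, fischer_fluctSq_mul, ih, pow_succ, Module.End.mul_apply]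

/-- Both sides obey the same recursion in f: multiplication by u_t is adjoint to `avgDeriv`, which
restriction turns into ∂_t. Against a constant only the constant term counts, and restriction
preserves it. -/
lemma fischer_embed (c : ℝ) (f : MvPolynomial T ℂ) (q : MvPolynomial (T × Fin k) ℂ) :
    fischer _ (embed T k c f) q = fischer _ f (restr T k c q) := by
  induction f using MvPolynomial.induction_on generalizing q with
  | C a =>
    have h1 : (C a : MvPolynomial T ℂ) = monomial 0 a := rfl
    have h2 : (C a : MvPolynomial (T × Fin k) ℂ) = monomial 0 a := rfl
    rw [embed, aeval_C, algebraMap_eq, h1, h2, fischer_monomial, fischer_monomial]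
    have h3 : coeff 0 (restr T k c q) = coeff 0 q := by
      have h4 : (constantCoeff : MvPolynomial T ℂ →+* ℂ).comp (restr T k c).toRingHom =
          constantCoeff := by
        refine MvPolynomial.ringHom_ext (fun a => ?_) fun J => ?_
        · simp [restr, algebraMap_eq]
        · simp [restr]
      exact congrArg (fun F => F q) h4
    rw [h3]
    simp
  | add p p' hp hp' => simp [hp, hp']
  | mul_X p t hp =>
    rw [mul_comm, map_mul, show embed T k c (X t) = avgVar k c t by simp [embed],
      fischer_avgVar_mul, hp, fischer_X_mul, pderiv_restr]

lemma fischer_raise (c : ℝ) (r : ℕ) (f : MvPolynomial T ℂ) (q : MvPolynomial (T × Fin k) ℂ) :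
    fischer _ (raise T k c r f) q = fischer _ f (lower T k c r q) := by
  rw [raise_apply, lower_apply, fischer_smul_left, fischer_fluctSq_pow_mul, fischer_embed,
    show (r.factorial : ℂ)⁻¹ = (((r.factorial : ℝ)⁻¹ : ℝ) : ℂ) by push_cast; rfl,
    fischer_smul_right]

/-- The operator `∑_{r < R} raise_r lower_r`. -/
def polyP (T : Type*) [Fintype T] (k : ℕ) (c : ℂ) (R : ℕ) :
    MvPolynomial (T × Fin k) ℂ →ₗ[ℂ] MvPolynomial (T × Fin k) ℂ :=
  ∑ r ∈ Finset.range R, raise T k c r ∘ₗ lower T k c r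

lemma polyP_apply (c : ℂ) (R : ℕ) (p : MvPolynomial (T × Fin k) ℂ) :
    polyP T k c R p = ∑ r ∈ Finset.range R, raise T k c r (lower T k c r p) := by
  simp [polyP, LinearMap.sum_apply]

lemma fischer_polyP (c : ℝ) (R : ℕ) (p q : MvPolynomial (T × Fin k) ℂ) :
    fischer _ (polyP T k c R p) q =
      ∑ r ∈ Finset.range R, fischer _ (lower T k c r p) (lower T k c r q) := by
  rw [polyP_apply, map_sum, LinearMap.sum_apply]
  exact Finset.sum_congr rfl fun r _ => fischer_raise c r _ _

lemma polyP_isHomogeneous (c : ℂ) (R : ℕ) {p : MvPolynomial (T × Fin k) ℂ} {n : ℕ}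
    (hp : p.IsHomogeneous n) : (polyP T k c R p).IsHomogeneous n := by
  rw [polyP_apply]
  refine IsHomogeneous.sum _ _ _ fun r _ => ?_
  by_cases h : n < 2 * r
  · rw [lower_eq_zero c hp h, map_zero]
    exact isHomogeneous_zero _ _ _
  · have := raise_isHomogeneous (k := k) c r (lower_isHomogeneous c r hp)
    rwa [show 2 * r + (n - 2 * r) = n by omega] at this

/-- Expand both restrictions by `hermEval_restrict` and use the Hermite isometry on T. The cross
terms pair forms of different degrees n - 2r and n - 2s, and the diagonal ones reassemble by
adjointness of `raise` and `lower`. -/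
lemma integral_hermEval_restrict {c : ℝ} (hc : (k : ℂ) * (c : ℂ) ^ 2 = 1) {n R : ℕ}
    (hR : n < 2 * R) {p q : MvPolynomial (T × Fin k) ℂ} (hp : p.IsHomogeneous n)
    (hq : q.IsHomogeneous n) :
    ∫ x : T → ℝ, hermEval _ p (fun J => c * x J.1) * conj (hermEval _ q (fun J => c * x J.1))
      ∂(Measure.pi fun _ => gaussianReal 0 1) = fischer _ (polyP T k c R p) q := by
  have h1 : ∀ x : T → ℝ, hermEval _ p (fun J => c * x J.1) *
      conj (hermEval _ q (fun J => c * x J.1)) =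
      ∑ r ∈ Finset.range R, ∑ s ∈ Finset.range R, hermEval T (lower T k c r p) x *
        conj (hermEval T (lower T k c s q) x) := by
    intro x
    rw [hermEval_restrict hc x n p hp R hR, hermEval_restrict hc x n q hq R hR, map_sum,
      Finset.sum_mul_sum]
  simp only [h1]
  have hint : ∀ p q : MvPolynomial T ℂ, Integrable
      (fun x => hermEval T p x * conj (hermEval T q x))
      (Measure.pi fun _ : T => gaussianReal 0 1) :=
    fun p q => (memLp_hermEval p).integrable_mul (memLp_hermEval q).star
  rw [integral_finsetSum _ fun r _ => integrable_finsetSum _ fun s _ => hint _ _, fischer_polyP]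
  refine Finset.sum_congr rfl fun r hr => ?_
  rw [integral_finsetSum _ fun s _ => hint _ _]
  simp only [integral_hermEval_mul]
  refine Finset.sum_eq_single_of_mem r hr fun s _ hs => ?_
  -- Subtraction is truncated, so n - 2r and n - 2s are only known to differ once the orders beyond
  -- n/2, which contribute zero, are discarded.
  by_cases h : n < 2 * r
  · rw [lower_eq_zero _ hp h]; simp
  by_cases h' : n < 2 * s
  · rw [lower_eq_zero _ hq h']; simp
  exact fischer_eq_zero_of_degree_ne (lower_isHomogeneous _ r hp) (lower_isHomogeneous _ s hq)
    (by omega)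

/-- The eigenvalues `μ(μ+1)⋯(μ+r-1)/r!`. -/
def eigP (m : ℝ) (r : ℕ) : ℝ := (∏ j ∈ Finset.range r, (m + j)) / (r.factorial : ℝ)

lemma lower_raise {c : ℂ} {m : ℝ} (hc : (k : ℂ) * c ^ 2 = 1)
    (hm : 2 * (m : ℂ) = (Fintype.card T : ℂ) * (k - 1)) (r s : ℕ) (f : MvPolynomial T ℂ) :
    lower T k c r (raise T k c s f) = if r = s then (eigP m r : ℂ) • f else 0 := by
  split_ifs with h
  · subst h
    rw [lower_raise_self hc hm]
    simp [eigP]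
  · exact lower_raise_of_ne hc hm h f

/-- The spectral content of the operator in a form that needs no eigenbasis: each `lower`
intertwines it with a scalar. -/
lemma lower_polyP {c : ℂ} {m : ℝ} (hc : (k : ℂ) * c ^ 2 = 1)
    (hm : 2 * (m : ℂ) = (Fintype.card T : ℂ) * (k - 1)) {r R : ℕ} (hr : r < R)
    (p : MvPolynomial (T × Fin k) ℂ) :
    lower T k c r (polyP T k c R p) = (eigP m r : ℂ) • lower T k c r p := by
  rw [polyP_apply, map_sum]
  simp only [lower_raise hc hm]
  rw [Finset.sum_ite_eq, if_pos (Finset.mem_range.2 hr)]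

lemma polyP_raise {c : ℂ} {m : ℝ} (hc : (k : ℂ) * c ^ 2 = 1)
    (hm : 2 * (m : ℂ) = (Fintype.card T : ℂ) * (k - 1)) {r R : ℕ} (hr : r < R)
    (f : MvPolynomial T ℂ) :
    polyP T k c R (raise T k c r f) = (eigP m r : ℂ) • raise T k c r f := by
  rw [polyP_apply]
  simp only [lower_raise hc hm, apply_ite (raise T k c _), map_smul, map_zero]
  rw [Finset.sum_ite_eq', if_pos (Finset.mem_range.2 hr)]

end Kernel

/-! ### From polynomials to matrices of multi-indices: the operator 𝒫 on one degree -/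

section Matrices

variable {l k d : ℕ}

open MvPolynomial

/-- The exponent vector of a matrix of multi-indices. -/
def matExp : Mat l k d ≃ ((Fin l × Fin d) × Fin k →₀ ℕ) where
  toFun M := Finsupp.equivFunOnFinite.symm fun J => M J.1.1 J.2 J.1.2
  invFun N := fun i j a => N ((i, a), j)
  left_inv M := rfl
  right_inv N := by ext J; rfl

lemma matExp_apply (M : Mat l k d) (J : (Fin l × Fin d) × Fin k) :
    matExp M J = M J.1.1 J.2 J.1.2 := rfl

lemma degree_matExp (M : Mat l k d) : (matExp M).degree = matDeg M := by
  rw [Finsupp.degree_eq_sum, matDeg]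
  simp only [matExp_apply, deg, Fintype.sum_prod_type]
  exact Finset.sum_congr rfl fun i _ => Finset.sum_comm

lemma prod_factorial_matExp (M : Mat l k d) : ∏ J, (matExp M J).factorial = matFact M := by
  simp only [matFact, mfact, matExp_apply, Fintype.prod_prod_type]
  exact Finset.prod_congr rfl fun i _ => Finset.prod_comm

/-- The homogeneous polynomial of degree `S` with coefficients `φ(M)`. -/
def slicePoly (S : ℕ) (φ : Mat l k d → ℂ) : MvPolynomial ((Fin l × Fin d) × Fin k) ℂ :=
  ∑ M ∈ slice l k d S, monomial (matExp M) (φ M)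

lemma slicePoly_isHomogeneous (S : ℕ) (φ : Mat l k d → ℂ) :
    (slicePoly S φ).IsHomogeneous S :=
  IsHomogeneous.sum _ _ _ fun M hM =>
    isHomogeneous_monomial _ ((degree_matExp M).trans (mem_slice.1 hM))

lemma coeff_slicePoly (S : ℕ) (φ : Mat l k d → ℂ) (M : Mat l k d) :
    coeff (matExp M) (slicePoly S φ) = if matDeg M = S then φ M else 0 := by
  simp only [slicePoly, coeff_sum, coeff_monomial, EmbeddingLike.apply_eq_iff_eq]
  rw [Finset.sum_ite_eq']
  simp only [mem_slice]

lemma ext_of_isHomogeneous {S : ℕ} {p q : MvPolynomial ((Fin l × Fin d) × Fin k) ℂ}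
    (hp : p.IsHomogeneous S) (hq : q.IsHomogeneous S)
    (h : ∀ M : Mat l k d, matDeg M = S → coeff (matExp M) p = coeff (matExp M) q) : p = q := by
  ext N
  obtain ⟨M, rfl⟩ := matExp.surjective N
  by_cases hM : matDeg M = S
  · exact h M hM
  · rw [hp.coeff_eq_zero, hq.coeff_eq_zero] <;> rwa [degree_matExp]

lemma fischer_monomial_right {σ : Type*} [Fintype σ] (N : σ →₀ ℕ) (q : MvPolynomial σ ℂ) :
    fischer σ q (monomial N 1) = q.coeff N * ((∏ i, (N i).factorial : ℕ) : ℂ) := by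
  rw [← fischer_conj_symm, fischer_monomial]
  simp

lemma fischer_slicePoly (S : ℕ) (φ ψ : Mat l k d → ℂ) :
    fischer _ (slicePoly S φ) (slicePoly S ψ) =
      ∑ M ∈ slice l k d S, φ M * conj (ψ M) * (matFact M : ℂ) := by
  rw [slicePoly, map_sum, LinearMap.sum_apply]
  refine Finset.sum_congr rfl fun M hM => ?_
  rw [fischer_monomial, coeff_slicePoly, if_pos (mem_slice.1 hM), prod_factorial_matExp]

lemma hermEval_matExp (M : Mat l k d) (c : ℝ) (x : Fin l × Fin d → ℝ) :
    hermEval _ (monomial (matExp M) 1) (fun J => c * x J.1) =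
      ((∏ t, ∏ j, (hermiteReal (M t.1 j t.2)).eval (c * x t) : ℝ) : ℂ) := by
  rw [hermEval_monomial, one_mul, Fintype.prod_prod_type]
  rfl

/-- The Gaussian measure and the Hermite products both factor over the coordinates (i,a), so the
iterated product measure of the definition may be replaced by the one on `Fin l × Fin d → ℝ`. -/
lemma coeffP_eq_prod (M N : Mat l k d) :
    coeffP M N = ∏ t : Fin l × Fin d, ∫ y, ∏ j, ((hermiteReal (M t.1 j t.2)).eval (√(1 / (k : ℝ)) * y) *
      (hermiteReal (N t.1 j t.2)).eval (√(1 / (k : ℝ)) * y)) ∂(gaussianReal 0 1) := by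
  rw [coeffP, integral_fintype_prod_eq_prod (𝕜 := ℝ) (fun i (x : Fin d → ℝ) =>
    ∏ j, (hermiteMv (M i j) (√(1 / (k : ℝ)) • x) * hermiteMv (N i j) (√(1 / (k : ℝ)) • x))),
    Fintype.prod_prod_type]
  refine Finset.prod_congr rfl fun i _ => ?_
  rw [← integral_fintype_prod_eq_prod (𝕜 := ℝ) (fun a (y : ℝ) =>
    ∏ j, ((hermiteReal (M i j a)).eval (√(1 / (k : ℝ)) * y) *
      (hermiteReal (N i j a)).eval (√(1 / (k : ℝ)) * y)))]
  congr 1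
  funext x
  rw [Finset.prod_comm]
  refine Finset.prod_congr rfl fun j _ => ?_
  simp only [hermiteMv, eval_hermiteReal, Finset.prod_mul_distrib, Pi.smul_apply, smul_eq_mul]

lemma coeffP_eq_integral_hermEval (M N : Mat l k d) :
    (coeffP M N : ℂ) = ∫ x : Fin l × Fin d → ℝ,
      hermEval _ (monomial (matExp M) 1) (fun J => √(1 / (k : ℝ)) * x J.1) *
      conj (hermEval _ (monomial (matExp N) 1) (fun J => √(1 / (k : ℝ)) * x J.1))
        ∂(Measure.pi fun _ => gaussianReal 0 1) := by
  simp only [hermEval_matExp, Complex.conj_ofReal, ← Complex.ofReal_mul]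
  rw [integral_complex_ofReal, coeffP_eq_prod, ← integral_fintype_prod_eq_prod (𝕜 := ℝ)
    (fun (t : Fin l × Fin d) (y : ℝ) => ∏ j, ((hermiteReal (M t.1 j t.2)).eval (√(1 / (k : ℝ)) * y) *
      (hermiteReal (N t.1 j t.2)).eval (√(1 / (k : ℝ)) * y)))]
  simp only [Finset.prod_mul_distrib]

lemma coeffP_comm (M N : Mat l k d) : coeffP M N = coeffP N M := by
  simp only [coeffP, mul_comm]

lemma scale_sq (hk : 2 ≤ k) : (k : ℂ) * ((√(1 / (k : ℝ)) : ℝ) : ℂ) ^ 2 = 1 := by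
  rw [← Complex.ofReal_pow, Real.sq_sqrt (by positivity)]
  push_cast
  have : (k : ℂ) ≠ 0 := by exact_mod_cast (by omega : k ≠ 0)
  field_simp

lemma two_mul_mu (l k d : ℕ) :
    2 * (mu l k d : ℂ) = (Fintype.card (Fin l × Fin d) : ℂ) * (k - 1) := by
  simp [mu]
  ring

/-- `polyP` with the parameters of the problem. -/
def slicePolyP (l k d S : ℕ) :
    MvPolynomial ((Fin l × Fin d) × Fin k) ℂ →ₗ[ℂ] MvPolynomial ((Fin l × Fin d) × Fin k) ℂ :=
  polyP (Fin l × Fin d) k ((√(1 / (k : ℝ)) : ℝ) : ℂ) (S + 1)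

lemma fischer_slicePolyP_monomial (hk : 2 ≤ k) {S : ℕ} {M N : Mat l k d} (hM : matDeg M = S)
    (hN : matDeg N = S) :
    fischer _ (slicePolyP l k d S (monomial (matExp M) 1)) (monomial (matExp N) 1) =
      (coeffP M N : ℂ) := by
  rw [coeffP_eq_integral_hermEval, integral_hermEval_restrict (scale_sq hk) (n := S) (R := S + 1)
    (by omega) (isHomogeneous_monomial _ ((degree_matExp M).trans hM))
    (isHomogeneous_monomial _ ((degree_matExp N).trans hN)), slicePolyP]

lemma matFact_pos (M : Mat l k d) : 0 < matFact M :=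
  Finset.prod_pos fun _ _ => Finset.prod_pos fun _ _ => Finset.prod_pos fun _ _ =>
    Nat.factorial_pos _

/-- A Fischer pairing with the monomial of M returns the coefficient times M!, which is the
denominator in 𝒫. The pairing itself is P(M,N) by the integral formula, since the cutoff S + 1
exceeds S/2 for every S, including S = 0. -/
lemma slicePoly_opP (hk : 2 ≤ k) (S : ℕ) (φ : Mat l k d → ℂ) :
    slicePoly S (opP l k d φ) = slicePolyP l k d S (slicePoly S φ) := by
  refine ext_of_isHomogeneous (slicePoly_isHomogeneous _ _)
    (polyP_isHomogeneous _ _ (slicePoly_isHomogeneous _ _)) fun M hM => ?_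
  have hM0 : (matFact M : ℂ) ≠ 0 := Nat.cast_ne_zero.2 (matFact_pos M).ne'
  rw [coeff_slicePoly, if_pos hM]
  refine mul_right_cancel₀ hM0 ?_
  have h := fischer_monomial_right (matExp M) (slicePolyP l k d S (slicePoly S φ))
  rw [prod_factorial_matExp] at h
  rw [← h]
  have h2 : slicePoly S φ = ∑ N ∈ slice l k d S, φ N • monomial (matExp N) (1 : ℂ) := by
    refine Finset.sum_congr rfl fun N _ => ?_
    rw [smul_monomial, smul_eq_mul, mul_one]
  rw [h2]
  simp only [map_sum, map_smul, LinearMap.sum_apply, LinearMap.smul_apply]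
  simp only [opP, LinearMap.coe_mk, AddHom.coe_mk, hM]
  rw [Finset.sum_mul]
  refine Finset.sum_congr rfl fun N hN => ?_
  rw [fischer_slicePolyP_monomial hk (mem_slice.1 hN) hM, coeffP_comm N M]
  push_cast
  rw [smul_eq_mul]
  field_simp

/-- The squared norm of the degree-`S` part of `φ`. -/
def sliceSq (S : ℕ) (φ : Mat l k d → ℂ) : ℝ :=
  ∑ M ∈ slice l k d S, ‖φ M‖ ^ 2 * (matFact M : ℝ)

lemma sliceSq_nonneg (S : ℕ) (φ : Mat l k d → ℂ) : 0 ≤ sliceSq S φ :=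
  Finset.sum_nonneg fun _ _ => by positivity

lemma fischer_slicePoly_self (S : ℕ) (φ : Mat l k d → ℂ) :
    fischer _ (slicePoly S φ) (slicePoly S φ) = (sliceSq S φ : ℂ) := by
  rw [fischer_slicePoly, sliceSq]
  push_cast
  refine Finset.sum_congr rfl fun M _ => ?_
  rw [Complex.mul_conj, Complex.normSq_eq_norm_sq]
  push_cast
  rfl

lemma formS_eq_fischer (hk : 2 ≤ k) (S : ℕ) (φ : Mat l k d → ℂ) :
    formS S φ = fischer _ (slicePoly S φ) (slicePolyP l k d S (slicePoly S φ)) := by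
  rw [← slicePoly_opP hk, fischer_slicePoly, formS]

/-- The squared Fischer norm of the component of order `r` of the degree-`S` part of `φ`. -/
def compSq (S r : ℕ) (φ : Mat l k d → ℂ) : ℝ :=
  (fischer _ (lower (Fin l × Fin d) k ((√(1 / (k : ℝ)) : ℝ) : ℂ) r (slicePoly S φ))
    (lower (Fin l × Fin d) k ((√(1 / (k : ℝ)) : ℝ) : ℂ) r (slicePoly S φ))).re

lemma compSq_nonneg (S r : ℕ) (φ : Mat l k d → ℂ) : 0 ≤ compSq S r φ := fischer_self_re_nonneg _

lemma ofReal_compSq (S r : ℕ) (φ : Mat l k d → ℂ) :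
    (compSq S r φ : ℂ) =
    fischer _ (lower (Fin l × Fin d) k ((√(1 / (k : ℝ)) : ℝ) : ℂ) r (slicePoly S φ))
    (lower (Fin l × Fin d) k ((√(1 / (k : ℝ)) : ℝ) : ℂ) r (slicePoly S φ)) := by
  rw [compSq, fischer_self, Complex.ofReal_re]

lemma compSq_eq_zero {S r : ℕ} (h : S < 2 * r) (φ : Mat l k d → ℂ) : compSq S r φ = 0 := by
  rw [compSq, lower_eq_zero _ (slicePoly_isHomogeneous S φ) h]
  simp

/-- As 𝒫 = ∑ lower_r* lower_r, its quadratic form is a sum of squared norms; this is the source of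
reality and positivity. -/
lemma formS_eq_sum (hk : 2 ≤ k) (S : ℕ) (φ : Mat l k d → ℂ) :
    formS S φ = ((∑ r ∈ Finset.range (S + 1), compSq S r φ : ℝ) : ℂ) := by
  rw [formS_eq_fischer hk, ← fischer_conj_symm, slicePolyP, fischer_polyP, map_sum]
  push_cast
  refine Finset.sum_congr rfl fun r _ => ?_
  rw [fischer_conj_symm, ofReal_compSq]

lemma sliceSq_opP (hk : 2 ≤ k) (S : ℕ) (φ : Mat l k d → ℂ) :
    sliceSq S (opP l k d φ) =
      ∑ r ∈ Finset.range (S + 1), eigP (mu l k d) r * compSq S r φ := by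
  rw [← Complex.ofReal_inj, ← fischer_slicePoly_self, slicePoly_opP hk, slicePolyP, fischer_polyP]
  push_cast
  refine Finset.sum_congr rfl fun r hr => ?_
  rw [lower_polyP (scale_sq hk) (two_mul_mu l k d) (Finset.mem_range.1 hr), fischer_smul_right,
    ofReal_compSq]

/-- Comparing sums over r gives ‖𝒫φ‖² ≤ B⟨φ,𝒫φ⟩. Inserting this into 0 ≤ ‖Bφ - 𝒫φ‖² gives ⟨φ,𝒫φ⟩ ≤
B‖φ‖², and then the norm bound. The eigenvectors need not be known to span. -/
lemma formS_bounds (hk : 2 ≤ k) {S : ℕ} {B : ℝ}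
    (hB : ∀ r, 2 * r ≤ S → eigP (mu l k d) r ≤ B) (φ : Mat l k d → ℂ) :
    sliceSq S (opP l k d φ) ≤ B ^ 2 * sliceSq S φ ∧ (formS S φ).re ≤ B * sliceSq S φ := by
  -- The eigenvalue of order 0 is the empty product 1.
  have hB0 : 0 < B := lt_of_lt_of_le (by simp [eigP]) (hB 0 (by omega))
  have h1 : sliceSq S (opP l k d φ) ≤ B * (formS S φ).re := by
    rw [sliceSq_opP hk, formS_eq_sum hk, Complex.ofReal_re, Finset.mul_sum]
    refine Finset.sum_le_sum fun r _ => ?_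
    by_cases h : S < 2 * r
    · simp [compSq_eq_zero h]
    · exact mul_le_mul_of_nonneg_right (hB r (by omega)) (compSq_nonneg _ _ _)
  have h2 : 0 ≤ B ^ 2 * sliceSq S φ - 2 * B * (formS S φ).re + sliceSq S (opP l k d φ) := by
    have h3 := fischer_self_re_nonneg ((B : ℂ) • slicePoly S φ - slicePoly S (opP l k d φ))
    have h4 : fischer _ (slicePoly S φ) (slicePoly S (opP l k d φ)) = formS S φ := by
      rw [slicePoly_opP hk, formS_eq_fischer hk]
    have h5 : fischer _ (slicePoly S (opP l k d φ)) (slicePoly S φ) = formS S φ := by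
      rw [← fischer_conj_symm, h4, formS_eq_sum hk, Complex.conj_ofReal]
    have h6 : fischer _ ((B : ℂ) • slicePoly S φ - slicePoly S (opP l k d φ))
        ((B : ℂ) • slicePoly S φ - slicePoly S (opP l k d φ)) =
        (B : ℂ) ^ 2 * (sliceSq S φ : ℂ) - 2 * B * formS S φ + (sliceSq S (opP l k d φ) : ℂ) := by
      rw [map_sub, map_sub, LinearMap.sub_apply, LinearMap.sub_apply, fischer_smul_right,
        fischer_smul_right, fischer_smul_left, fischer_smul_left, h4, h5, fischer_slicePoly_self,
        fischer_slicePoly_self]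
      ring
    rw [h6, formS_eq_sum hk] at h3
    rw [formS_eq_sum hk, Complex.ofReal_re]
    have h7 : ((B : ℂ) ^ 2 * (sliceSq S φ : ℂ) - 2 * B *
        ((∑ r ∈ Finset.range (S + 1), compSq S r φ : ℝ) : ℂ) + (sliceSq S (opP l k d φ) : ℂ)) =
        ((B ^ 2 * sliceSq S φ - 2 * B * (∑ r ∈ Finset.range (S + 1), compSq S r φ) +
          sliceSq S (opP l k d φ) : ℝ) : ℂ) := by push_cast; rfl
    rw [h7, Complex.ofReal_re] at h3
    exact h3
  constructor
  · nlinarith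
  · have : B * (formS S φ).re ≤ B * (B * sliceSq S φ) := by nlinarith
    exact le_of_mul_le_mul_left this hB0

lemma opP_opP_apply (hk : 2 ≤ k) {S : ℕ} (h : ∀ r, 2 * r ≤ S → eigP (mu l k d) r = 1)
    (φ : Mat l k d → ℂ) {M : Mat l k d} (hM : matDeg M = S) :
    opP l k d (opP l k d φ) M = opP l k d φ M := by
  have h1 : slicePoly S (opP l k d (opP l k d φ)) = slicePoly S (opP l k d φ) := by
    rw [slicePoly_opP hk, slicePoly_opP hk]
    set p := slicePoly S φ with hp
    have hhom : p.IsHomogeneous S := slicePoly_isHomogeneous S φ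
    conv_lhs => rw [slicePolyP, polyP_apply]
    rw [slicePolyP, polyP_apply]
    refine Finset.sum_congr rfl fun r hr => ?_
    rw [← polyP_apply, lower_polyP (scale_sq hk) (two_mul_mu l k d) (Finset.mem_range.1 hr)]
    by_cases h2 : S < 2 * r
    · rw [lower_eq_zero _ hhom h2]; simp
    · rw [h r (by omega)]; simp
  have h2 := congrArg (coeff (matExp M)) h1
  rwa [coeff_slicePoly, coeff_slicePoly, if_pos hM, if_pos hM] at h2

lemma eigP_pos {m : ℝ} (hm : 0 < m) (r : ℕ) : 0 < eigP m r :=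
  div_pos (Finset.prod_pos fun j _ => by positivity) (by positivity)

lemma mu_pos (hl : 1 ≤ l) (hk : 2 ≤ k) (hd : 1 ≤ d) : 0 < mu l k d := by
  have h1 : (1 : ℝ) ≤ l := by exact_mod_cast hl
  have h2 : (2 : ℝ) ≤ k := by exact_mod_cast hk
  have h3 : (1 : ℝ) ≤ d := by exact_mod_cast hd
  have h4 : (0 : ℝ) < (k : ℝ) - 1 := by linarith
  unfold mu
  positivity

/-- Every `eigP μ r` with `2 r ≤ S` is an eigenvalue of the restriction of `𝒫` to degree `S`. -/
lemma exists_eigenvector (hl : 1 ≤ l) (hk : 2 ≤ k) (hd : 1 ≤ d) {S r : ℕ} (hr : 2 * r ≤ S) :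
    ∃ φ ∈ spaceFS l k d S, φ ≠ 0 ∧ opP l k d φ = (eigP (mu l k d) r : ℂ) • φ := by
  set c : ℂ := ((√(1 / (k : ℝ)) : ℝ) : ℂ) with hc
  let t : Fin l × Fin d := (⟨0, hl⟩, ⟨0, hd⟩)
  -- Any nonzero form of degree S - 2r would serve; raising it by r gives degree S.
  set f : MvPolynomial (Fin l × Fin d) ℂ := X t ^ (S - 2 * r) with hf
  set p := raise (Fin l × Fin d) k c r f with hp
  have hf0 : f ≠ 0 := pow_ne_zero _ (X_ne_zero t)
  have hfhom : f.IsHomogeneous (S - 2 * r) := isHomogeneous_X_pow _ _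
  have hphom : p.IsHomogeneous S := by
    have := raise_isHomogeneous (k := k) c r hfhom
    rwa [show 2 * r + (S - 2 * r) = S by omega] at this
  have heig : slicePolyP l k d S p = (eigP (mu l k d) r : ℂ) • p :=
    polyP_raise (scale_sq hk) (two_mul_mu l k d) (by omega) f
  -- Lowering p returns f times the eigenvalue, which is positive because μ > 0.
  have hp0 : p ≠ 0 := by
    intro h0
    have := lower_raise (scale_sq hk) (two_mul_mu l k d) r r f
    rw [← hc, ← hp, h0, map_zero, if_pos rfl, eq_comm, smul_eq_zero] at this
    rcases this with h | h
    · exact (eigP_pos (mu_pos hl hk hd) r).ne' (by exact_mod_cast h)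
    · exact hf0 h
  set φ : Mat l k d → ℂ := fun M => coeff (matExp M) p with hφ
  have hφp : slicePoly S φ = p :=
    ext_of_isHomogeneous (slicePoly_isHomogeneous _ _) hphom fun M hM => by
      rw [coeff_slicePoly, if_pos hM]
  have hmem : φ ∈ spaceFS l k d S := fun M hM =>
    hphom.coeff_eq_zero (by rwa [degree_matExp])
  refine ⟨φ, hmem, ?_, ?_⟩
  · intro h0
    apply hp0
    rw [← hφp, h0, slicePoly]
    simp
  · funext M
    by_cases hM : matDeg M = S
    · have h1 := coeff_slicePoly S (opP l k d φ) M
      rw [if_pos hM, slicePoly_opP hk, hφp, heig, coeff_smul] at h1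
      rw [← h1]
      rfl
    · rw [opP_mem_spaceFS S φ hmem M hM, Pi.smul_apply, hmem M hM, smul_zero]

end Matrices

/-! ### Monotonicity and growth of the eigenvalues -/

section Eigenvalues

lemma eigP_succ (m : ℝ) (r : ℕ) : eigP m (r + 1) = eigP m r * ((m + r) / (r + 1)) := by
  have h : (r.factorial : ℝ) ≠ 0 := Nat.cast_ne_zero.2 r.factorial_ne_zero
  have h2 : (r + 1 : ℝ) ≠ 0 := by exact_mod_cast r.succ_ne_zero
  rw [eigP, eigP, Finset.prod_range_succ, Nat.factorial_succ]
  push_cast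
  field_simp

lemma eigP_monotone {m : ℝ} (hm : 1 ≤ m) : Monotone (eigP m) := by
  refine monotone_nat_of_le_succ fun r => ?_
  rw [eigP_succ]
  refine le_mul_of_one_le_right (eigP_pos (by linarith) r).le ?_
  rw [one_le_div (by positivity)]
  linarith

lemma eigP_mono_left {m m' : ℝ} (hm : 0 ≤ m) (h : m ≤ m') (r : ℕ) : eigP m r ≤ eigP m' r := by
  unfold eigP
  gcongr

lemma eigP_one_left (r : ℕ) : eigP 1 r = 1 := by
  induction r with
  | zero => simp [eigP]
  | succ r ih =>
    rw [eigP_succ, ih, one_mul, add_comm, div_self]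
    positivity

/-- The ratio of consecutive terms is 1 + (n-1)/(r+1), and Bernoulli bounds it by the ratio of the
right-hand sides. Only polynomial growth matters, for the damped series below. -/
lemma eigP_natCast_le (n r : ℕ) : eigP n r ≤ ((r : ℝ) + 1) ^ n := by
  induction r with
  | zero => simp [eigP]
  | succ r ih =>
    have h1 : (0 : ℝ) < (r : ℝ) + 1 := by positivity
    rw [eigP_succ]
    have h2 : ((n : ℝ) + r) / (r + 1) ≤ (1 + 1 / ((r : ℝ) + 1)) ^ n := by
      refine le_trans ?_ (one_add_mul_le_pow (a := 1 / ((r : ℝ) + 1)) ?_ n)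
      · rw [div_le_iff₀ h1]
        field_simp
        linarith
      · have : 0 ≤ 1 / ((r : ℝ) + 1) := by positivity
        linarith
    calc eigP n r * ((n + r) / (r + 1)) ≤ ((r : ℝ) + 1) ^ n * (1 + 1 / ((r : ℝ) + 1)) ^ n := by
          refine mul_le_mul ih h2 (by positivity) (by positivity)
      _ = (((r + 1 : ℕ) : ℝ) + 1) ^ n := by
          rw [← mul_pow]
          congr 1
          push_cast
          field_simp

/-- Euler's limit for Γ(m), inverted; the factor n/(m+n) removes the last factor m + n of the
product in `Real.GammaSeq`. -/
lemma tendsto_eigP_div {m : ℝ} (hm : 0 < m) :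
    Tendsto (fun n : ℕ => eigP m n / (n : ℝ) ^ (m - 1)) atTop (𝓝 (Real.Gamma m)⁻¹) := by
  have h1 := Real.GammaSeq_tendsto_Gamma m
  have h2 := h1.inv₀ (Real.Gamma_pos_of_pos hm).ne'
  have h3 : Tendsto (fun n : ℕ => ((n : ℝ) / (m + n))) atTop (𝓝 1) := by
    have := tendsto_natCast_div_add_atTop (𝕜 := ℝ) m
    refine this.congr fun n => by rw [add_comm]
  have h4 := h2.mul h3
  rw [mul_one] at h4
  refine h4.congr' ?_
  filter_upwards [eventually_gt_atTop 0] with n hn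
  have hn' : (0 : ℝ) < n := by exact_mod_cast hn
  have h5 : (n.factorial : ℝ) ≠ 0 := Nat.cast_ne_zero.2 n.factorial_ne_zero
  have h6 : (n : ℝ) ^ m ≠ 0 := (Real.rpow_pos_of_pos hn' m).ne'
  have h7 : m + n ≠ 0 := by positivity
  rw [Real.GammaSeq, Finset.prod_range_succ, eigP, Real.rpow_sub_one hn'.ne']
  field_simp

lemma tendsto_eigP_atTop {m : ℝ} (hm : 1 < m) : Tendsto (eigP m) atTop atTop := by
  have h1 := tendsto_eigP_div (by linarith : 0 < m)
  have h2 : Tendsto (fun n : ℕ => (n : ℝ) ^ (m - 1)) atTop atTop :=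
    (tendsto_rpow_atTop (by linarith)).comp tendsto_natCast_atTop_atTop
  have h3 := h1.pos_mul_atTop (inv_pos.2 (Real.Gamma_pos_of_pos (by linarith : 0 < m))) h2
  refine h3.congr' ?_
  filter_upwards [eventually_gt_atTop 0] with n hn
  have hn' : (0 : ℝ) < n := by exact_mod_cast hn
  exact div_mul_cancel₀ _ (Real.rpow_pos_of_pos hn' _).ne'

lemma tendsto_half_div : Tendsto (fun S : ℕ => ((S / 2 : ℕ) : ℝ) / S) atTop (𝓝 (1 / 2)) := by
  have h := (tendsto_nat_floor_mul_div_atTop (R := ℝ) (a := 1 / 2) (by norm_num)).comp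
    tendsto_natCast_atTop_atTop
  refine h.congr fun S => ?_
  simp only [Function.comp]
  congr 2
  rw [one_div_mul_eq_div]
  exact_mod_cast Nat.floor_div_eq_div (K := ℝ) S 2

/-- With n = ⌊S/2⌋, multiply the limit of n^(1-m) times the eigenvalue by that of (n/S)^(m-1), which
is 2^(1-m). -/
lemma eigP_half_isEquivalent {m : ℝ} (hm : 0 < m) :
    (fun S : ℕ => eigP m (S / 2)) ~[atTop]
      (fun S : ℕ => (S : ℝ) ^ (m - 1) / ((2 : ℝ) ^ (m - 1) * Real.Gamma m)) := by
  have hG := Real.Gamma_pos_of_pos hm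
  refine isEquivalent_of_tendsto_one ?_
  have hhalf : Tendsto (fun S : ℕ => S / 2) atTop atTop :=
    Nat.tendsto_div_const_atTop (by norm_num)
  have h1 := (tendsto_eigP_div hm).comp hhalf
  have h2 : Tendsto (fun S : ℕ => (((S / 2 : ℕ) : ℝ) / S) ^ (m - 1)) atTop
      (𝓝 ((1 / 2 : ℝ) ^ (m - 1))) :=
    tendsto_half_div.rpow_const (Or.inl (by norm_num))
  have h3 := (h1.mul h2).mul_const ((2 : ℝ) ^ (m - 1) * Real.Gamma m)
  have h4 : (Real.Gamma m)⁻¹ * (1 / 2 : ℝ) ^ (m - 1) * ((2 : ℝ) ^ (m - 1) * Real.Gamma m) = 1 := by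
    have h5 : (1 / 2 : ℝ) ^ (m - 1) * (2 : ℝ) ^ (m - 1) = 1 := by
      rw [← Real.mul_rpow (by norm_num) (by norm_num)]
      norm_num
    calc _ = ((1 / 2 : ℝ) ^ (m - 1) * (2 : ℝ) ^ (m - 1)) * ((Real.Gamma m)⁻¹ * Real.Gamma m) := by ring
      _ = 1 := by rw [h5, inv_mul_cancel₀ hG.ne', one_mul]
  rw [h4] at h3
  refine h3.congr' ?_
  filter_upwards [eventually_ge_atTop 2] with S hS
  have hS' : (0 : ℝ) < S := by exact_mod_cast (by omega : 0 < S)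
  have hS2 : (0 : ℝ) < ((S / 2 : ℕ) : ℝ) := by exact_mod_cast (by omega : 0 < S / 2)
  have e1 := (Real.rpow_pos_of_pos hS' (m - 1)).ne'
  have e2 := (Real.rpow_pos_of_pos hS2 (m - 1)).ne'
  have e3 := (Real.rpow_pos_of_pos (by norm_num : (0 : ℝ) < 2) (m - 1)).ne'
  simp only [Function.comp, Pi.div_apply]
  rw [Real.div_rpow hS2.le hS'.le]
  field_simp

end Eigenvalues

/-! ### Norm, idempotency, symmetry and unboundedness -/

section Operators

variable {l k d : ℕ}

lemma normF_sq_of_mem {S : ℕ} {φ : Mat l k d → ℂ} (hφ : φ ∈ spaceFS l k d S) :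
    normF φ = √(sliceSq S φ) := by
  rw [normF, sliceSq]
  congr 1
  refine tsum_eq_sum fun M hM => ?_
  rw [hφ M (by rwa [mem_slice] at hM)]
  simp

lemma spaceFS_le_spaceF (S : ℕ) : spaceFS l k d S ≤ spaceF l k d := by
  intro φ hφ
  refine summable_of_ne_finset_zero (s := slice l k d S) fun M hM => ?_
  rw [hφ M (by rwa [mem_slice] at hM)]
  simp

lemma normF_pos {S : ℕ} {φ : Mat l k d → ℂ} (hφ : φ ∈ spaceFS l k d S) (h0 : φ ≠ 0) :
    0 < normF φ := by
  rw [normF_sq_of_mem hφ, Real.sqrt_pos]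
  obtain ⟨M, hM⟩ := Function.ne_iff.1 h0
  have hMS : M ∈ slice l k d S := by
    rw [mem_slice]
    by_contra h
    exact hM (hφ M h)
  refine Finset.sum_pos' (fun _ _ => by positivity) ⟨M, hMS, ?_⟩
  have := matFact_pos M
  have h2 : 0 < ‖φ M‖ := norm_pos_iff.2 hM
  positivity

lemma normF_smul (a : ℂ) (φ : Mat l k d → ℂ) : normF (a • φ) = ‖a‖ * normF φ := by
  rw [normF, normF]
  simp only [Pi.smul_apply, smul_eq_mul, norm_mul, mul_pow, mul_assoc]
  rw [tsum_mul_left, Real.sqrt_mul (by positivity), Real.sqrt_sq (norm_nonneg _)]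

lemma opPS_apply (S : ℕ) (φ : spaceFS l k d S) :
    (opPS l k d S φ : Mat l k d → ℂ) = opP l k d φ := rfl

/-- For μ ≥ 1 the eigenvalues increase with r, so the largest order r = ⌊S/2⌋ dominates, and its
eigenvector attains the bound. -/
lemma isGreatest_ratioPS (hl : 1 ≤ l) (hk : 2 ≤ k) (hd : 1 ≤ d) (hmu : 1 ≤ mu l k d) (S : ℕ) :
    IsGreatest (ratioPS l k d S) (eigP (mu l k d) (S / 2)) := by
  have hpos := eigP_pos (mu_pos hl hk hd) (S / 2)
  constructor
  · obtain ⟨φ, hφ, h0, he⟩ := exists_eigenvector hl hk hd (S := S) (r := S / 2) (by omega)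
    refine ⟨⟨φ, hφ⟩, fun h => h0 (congrArg Subtype.val h), ?_⟩
    rw [opPS_apply, he, normF_smul, mul_div_assoc, div_self (normF_pos hφ h0).ne', mul_one,
      Complex.norm_real, Real.norm_of_nonneg hpos.le]
  · rintro r ⟨φ, h0, rfl⟩
    have hn : 0 < normF (φ : Mat l k d → ℂ) :=
      normF_pos φ.2 fun h => h0 (Subtype.ext h)
    rw [div_le_iff₀ hn, opPS_apply, normF_sq_of_mem (opP_mem_spaceFS S _ φ.2),
      normF_sq_of_mem φ.2]
    have h1 := (formS_bounds hk (S := S) (B := eigP (mu l k d) (S / 2))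
      (fun r hr => eigP_monotone hmu (by omega)) (φ : Mat l k d → ℂ)).1
    calc √(sliceSq S (opP l k d φ)) ≤ √(eigP (mu l k d) (S / 2) ^ 2 * sliceSq S (φ : Mat l k d → ℂ)) :=
          Real.sqrt_le_sqrt h1
      _ = _ := by rw [Real.sqrt_mul (by positivity), Real.sqrt_sq hpos.le]

/-- For S ≥ 2 the order r = 1 occurs with eigenvalue μ, and μ² = μ with μ > 0 forces μ = 1. For S ≤
1 only r = 0 occurs, with eigenvalue 1. -/
lemma opPS_idem_iff (hl : 1 ≤ l) (hk : 2 ≤ k) (hd : 1 ≤ d) (S : ℕ) :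
    opPS l k d S ∘ₗ opPS l k d S = opPS l k d S ↔ (mu l k d = 1 ∨ S ≤ 1) := by
  constructor
  · intro h
    by_contra! hcon
    obtain ⟨φ, hφ, h0, he⟩ := exists_eigenvector hl hk hd (S := S) (r := 1) (by omega)
    have h1 := congrArg (fun F => ((F ⟨φ, hφ⟩ : spaceFS l k d S) : Mat l k d → ℂ)) h
    simp only [LinearMap.comp_apply, opPS_apply] at h1
    rw [he, map_smul, he, smul_smul, ← sub_eq_zero, ← sub_smul, smul_eq_zero] at h1
    rcases h1 with h1 | h1
    · have h2 : eigP (mu l k d) 1 = mu l k d := by simp [eigP]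
      rw [h2] at h1
      have h3 : mu l k d * mu l k d - mu l k d = 0 := by exact_mod_cast h1
      have h4 := mu_pos hl hk hd
      have h5 : mu l k d * (mu l k d - 1) = 0 := by linarith
      rcases mul_eq_zero.1 h5 with h6 | h6
      · exact h4.ne' h6
      · exact hcon.1 (by linarith)
    · exact h0 h1
  · intro h
    refine LinearMap.ext fun φ => Subtype.ext (funext fun M => ?_)
    rw [LinearMap.comp_apply, opPS_apply, opPS_apply]
    by_cases hM : matDeg M = S
    · refine opP_opP_apply hk (fun r hr => ?_) _ hM
      rcases h with h | h
      · rw [h, eigP_one_left]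
      · rw [show r = 0 by omega]; simp [eigP]
    · rw [opP_mem_spaceFS S _ (opP_mem_spaceFS S _ φ.2) M hM, opP_mem_spaceFS S _ φ.2 M hM]

lemma hasSum_fiber {E : Type*} [NormedAddCommGroup E] (S : ℕ) (f : Mat l k d → E) :
    HasSum (fun M : {M : Mat l k d // matDeg M = S} => f M) (∑ M ∈ slice l k d S, f M) := by
  have hs : {M : Mat l k d | matDeg M = S} = ↑(slice l k d S) := by
    ext M; simp [mem_slice]
  have h := Finset.hasSum (slice l k d S) f
  have h2 := (hasSum_subtype_iff_indicator (f := f) (s := {M : Mat l k d | matDeg M = S})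
    (a := ∑ M ∈ slice l k d S, f M)).2 (by
      rw [hs]
      exact hasSum_subtype_iff_indicator.1 h)
  exact h2

lemma hasSum_slices {E : Type*} [NormedAddCommGroup E] [CompleteSpace E] {f : Mat l k d → E}
    (hf : Summable f) : HasSum (fun S => ∑ M ∈ slice l k d S, f M) (∑' M, f M) := by
  have h := hf.hasSum
  rw [← (Equiv.sigmaFiberEquiv matDeg).hasSum_iff] at h
  exact h.sigma fun S => hasSum_fiber S f

lemma summable_iff_slices {f : Mat l k d → ℝ} (hf : ∀ M, 0 ≤ f M) :
    Summable f ↔ Summable fun S => ∑ M ∈ slice l k d S, f M := by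
  constructor
  · exact fun h => (hasSum_slices h).summable
  · intro h
    rw [← (Equiv.sigmaFiberEquiv matDeg).summable_iff, summable_sigma_of_nonneg (f := f ∘ Equiv.sigmaFiberEquiv matDeg) fun _ => hf _]
    refine ⟨fun S => (hasSum_fiber S f).summable, h.congr fun S => ?_⟩
    exact (hasSum_fiber S f).tsum_eq.symm

lemma mem_spaceF_iff (φ : Mat l k d → ℂ) : φ ∈ spaceF l k d ↔ Summable fun S => sliceSq S φ :=
  summable_iff_slices (f := fun M => ‖φ M‖ ^ 2 * (matFact M : ℝ)) fun _ => by positivity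

lemma summable_innerF {φ ψ : Mat l k d → ℂ} (hφ : φ ∈ spaceF l k d) (hψ : ψ ∈ spaceF l k d) :
    Summable fun M => φ M * conj (ψ M) * (matFact M : ℂ) := by
  refine Summable.of_norm_bounded (hφ.add hψ) fun M => ?_
  rw [norm_mul, norm_mul, RCLike.norm_conj, Complex.norm_natCast, ← add_mul]
  refine mul_le_mul_of_nonneg_right ?_ (by positivity)
  nlinarith [sq_nonneg (‖φ M‖ - ‖ψ M‖), sq_nonneg (‖φ M‖), sq_nonneg ‖ψ M‖]

lemma opP_mem_spaceF (hk : 2 ≤ k) (hmu : mu l k d = 1) {φ : Mat l k d → ℂ}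
    (hφ : φ ∈ spaceF l k d) : opP l k d φ ∈ spaceF l k d := by
  rw [mem_spaceF_iff] at hφ ⊢
  refine hφ.of_nonneg_of_le (fun S => sliceSq_nonneg S _) fun S => ?_
  have := (formS_bounds hk (S := S) (B := 1) (fun r _ => by rw [hmu, eigP_one_left]) φ).1
  simpa using this

/-- Both inner products converge absolutely because 𝒫 preserves ℱ when μ = 1. Summed by degree, they
agree term by term, as 𝒫 is symmetric on each finite slice. -/
lemma innerF_opP_comm (hk : 2 ≤ k) (hmu : mu l k d = 1) {φ ψ : Mat l k d → ℂ}
    (hφ : φ ∈ spaceF l k d) (hψ : ψ ∈ spaceF l k d) :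
    innerF (opP l k d φ) ψ = innerF φ (opP l k d ψ) := by
  have h1 := hasSum_slices (summable_innerF (opP_mem_spaceF hk hmu hφ) hψ)
  have h2 := hasSum_slices (summable_innerF hφ (opP_mem_spaceF hk hmu hψ))
  refine h1.unique ?_
  convert! h2 using 2 with S
  rw [← fischer_slicePoly, ← fischer_slicePoly, slicePoly_opP hk, slicePoly_opP hk, slicePolyP,
    fischer_polyP, ← fischer_conj_symm _ (slicePoly S φ), fischer_polyP, map_sum]
  refine Finset.sum_congr rfl fun r _ => ?_
  rw [fischer_conj_symm]

lemma opP_unbounded (hl : 1 ≤ l) (hk : 2 ≤ k) (hd : 1 ≤ d) (hmu : 1 < mu l k d) :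
    ¬ ∃ C : ℝ, ∀ φ ∈ spaceF l k d, opP l k d φ ∈ spaceF l k d →
        normF (opP l k d φ) ≤ C * normF φ := by
  rintro ⟨C, hC⟩
  obtain ⟨r, hr⟩ := ((tendsto_eigP_atTop hmu).eventually_gt_atTop C).exists
  obtain ⟨φ, hφ, h0, he⟩ := exists_eigenvector hl hk hd (S := 2 * r) (r := r) le_rfl
  have h1 := hC φ (spaceFS_le_spaceF _ hφ) (spaceFS_le_spaceF _ (opP_mem_spaceFS _ φ hφ))
  rw [he, normF_smul, Complex.norm_real, Real.norm_of_nonneg (eigP_pos (mu_pos hl hk hd) r).le] at h1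
  have h2 := le_of_mul_le_mul_right h1 (normF_pos hφ h0)
  linarith

end Operators

/-! ### Dilation as a bounded operator on L²(γ_d) -/

section Dilation

/-- The density of N(0,c²) carries the extra factor 1/c, and its exponential is no larger than the
standard one because c ≤ 1. -/
lemma gaussianReal_le_smul {c : ℝ} (hc0 : 0 < c) (hc1 : c ≤ 1) :
    (gaussianReal 0 1).map (fun x => c * x) ≤ ENNReal.ofReal c⁻¹ • gaussianReal 0 1 := by
  have hv : (NNReal.mk (c ^ 2) (sq_nonneg c) * 1 : NNReal) ≠ 0 := by
    intro h
    have h2 := congrArg ((↑) : NNReal → ℝ) h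
    simp at h2
    exact hc0.ne' h2
  rw [gaussianReal_map_const_mul, gaussianReal_of_var_ne_zero _ hv,
    gaussianReal_of_var_ne_zero _ one_ne_zero, ← withDensity_smul _ (measurable_gaussianPDF _ _)]
  refine withDensity_mono (ae_of_all _ fun x => ?_)
  rw [Pi.smul_apply, smul_eq_mul, gaussianPDF, gaussianPDF,
    ← ENNReal.ofReal_mul (inv_nonneg.2 hc0.le)]
  refine ENNReal.ofReal_le_ofReal ?_
  rw [gaussianPDFReal_def, gaussianPDFReal_def]
  simp only [mul_zero, sub_zero, mul_one, NNReal.coe_one]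
  have e1 : ((NNReal.mk (c ^ 2) (sq_nonneg c) : NNReal) : ℝ) = c ^ 2 := rfl
  rw [e1, Real.sqrt_mul (by positivity), Real.sqrt_sq hc0.le, mul_inv, mul_comm _ c⁻¹, mul_assoc]
  refine mul_le_mul_of_nonneg_left ?_ (inv_nonneg.2 hc0.le)
  refine mul_le_mul_of_nonneg_left ?_ (by positivity)
  refine Real.exp_le_exp.2 ?_
  rw [neg_div, neg_div, neg_le_neg_iff]
  have : c ^ 2 ≤ 1 := by nlinarith
  gcongr
  nlinarith

/-- Split off one coordinate and compare the sections by Fubini; each coordinate costs one factor C.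
-/
lemma measure_pi_le_smul {μ ν : Measure ℝ} [IsProbabilityMeasure μ] [IsProbabilityMeasure ν]
    {C : ℝ≥0∞} (h : μ ≤ C • ν) (n : ℕ) :
    (Measure.pi fun _ : Fin n => μ) ≤ C ^ n • (Measure.pi fun _ : Fin n => ν) := by
  induction n with
  | zero =>
    rw [Measure.pi_of_empty _ default, Measure.pi_of_empty _ default]
    simp
  | succ n ih =>
    have h1 := (measurePreserving_piFinSuccAbove (fun _ : Fin (n + 1) => μ) 0).symm
    have h2 := (measurePreserving_piFinSuccAbove (fun _ : Fin (n + 1) => ν) 0).symm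
    rw [← h1.map_eq, ← h2.map_eq, ← Measure.map_smul]
    refine Measure.map_mono ?_ (MeasurableEquiv.measurable _)
    refine Measure.le_iff.2 fun s hs => ?_
    rw [Measure.smul_apply, Measure.prod_apply hs, Measure.prod_apply hs, smul_eq_mul]
    calc ∫⁻ x, (Measure.pi fun _ : Fin n => μ) (Prod.mk x ⁻¹' s) ∂μ
        ≤ ∫⁻ x, (C ^ n • Measure.pi fun _ : Fin n => ν) (Prod.mk x ⁻¹' s) ∂(C • ν) :=
          lintegral_mono' h fun x => ih _
      _ = C * ∫⁻ x, C ^ n * (Measure.pi fun _ : Fin n => ν) (Prod.mk x ⁻¹' s) ∂ν := by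
          rw [lintegral_smul_measure]; rfl
      _ = _ := by
          rw [lintegral_const_mul _ (measurable_measure_prodMk_left hs), ← mul_assoc, pow_succ']

lemma gauss_map_smul_le (d : ℕ) {c : ℝ} (hc0 : 0 < c) (hc1 : c ≤ 1) :
    (gauss d).map (fun x => c • x) ≤ ENNReal.ofReal c⁻¹ ^ d • gauss d := by
  have hp : IsProbabilityMeasure ((gaussianReal 0 1).map (fun x => c * x)) :=
    Measure.isProbabilityMeasure_map (by fun_prop)
  have h : (gauss d).map (fun x => c • x) =
      Measure.pi fun _ : Fin d => (gaussianReal 0 1).map (fun x => c * x) := by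
    rw [← Measure.pi_map_pi (fun _ => by fun_prop)]
    rfl
  rw [h]
  exact measure_pi_le_smul (gaussianReal_le_smul hc0 hc1) d

variable {d : ℕ}

lemma memLp_dilate {c : ℝ} (hc0 : 0 < c) (hc1 : c ≤ 1) (f : Lp ℂ 2 (gauss d)) :
    MemLp (fun x => f (c • x)) 2 (gauss d) := by
  have h1 : MemLp f 2 ((gauss d).map (fun x => c • x)) :=
    (Lp.memLp f).of_measure_le_smul (by finiteness) (gauss_map_smul_le d hc0 hc1)
  exact (memLp_map_measure_iff h1.1 (by fun_prop)).1 h1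

lemma ae_dilate {c : ℝ} (hc0 : 0 < c) (hc1 : c ≤ 1) {p : (Fin d → ℝ) → Prop}
    (h : ∀ᵐ x ∂(gauss d), p x) : ∀ᵐ x ∂(gauss d), p (c • x) := by
  have h1 : (gauss d).map (fun x => c • x) ≪ gauss d :=
    (Measure.absolutelyContinuous_of_le (gauss_map_smul_le d hc0 hc1)).trans
      Measure.smul_absolutelyContinuous
  exact ae_of_ae_map (by fun_prop) (h1.ae_le h)

/-- The bounded operator `f ↦ f(c ·)` on `L²(γ_d)`, for `0 < c ≤ 1`. -/
def dilate (d : ℕ) {c : ℝ} (hc0 : 0 < c) (hc1 : c ≤ 1) : Lp ℂ 2 (gauss d) →L[ℂ] Lp ℂ 2 (gauss d) :=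
  LinearMap.mkContinuousOfExistsBound
    { toFun := fun f => (memLp_dilate hc0 hc1 f).toLp _
      map_add' := fun f g => by
        rw [← MemLp.toLp_add]
        refine MemLp.toLp_congr _ _ ?_
        filter_upwards [ae_dilate hc0 hc1 (Lp.coeFn_add f g)] with x hx
        exact hx
      map_smul' := fun a f => by
        rw [RingHom.id_apply, ← MemLp.toLp_const_smul]
        refine MemLp.toLp_congr _ _ ?_
        filter_upwards [ae_dilate hc0 hc1 (Lp.coeFn_smul a f)] with x hx
        exact hx }
    (by
      -- The constant is c^(-d/2), the square root of the bound c^(-d) for the image measure.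
      refine ⟨((ENNReal.ofReal c⁻¹ ^ d) ^ (1 / (2 : ℝ≥0∞)).toReal).toReal, fun f => ?_⟩
      have hle := gauss_map_smul_le d hc0 hc1
      have h1 : MemLp f 2 ((gauss d).map (fun x => c • x)) :=
        (Lp.memLp f).of_measure_le_smul (by finiteness) hle
      have h2 : eLpNorm (fun x => f (c • x)) 2 (gauss d) ≤
          (ENNReal.ofReal c⁻¹ ^ d) ^ (1 / (2 : ℝ≥0∞)).toReal * eLpNorm f 2 (gauss d) := by
        calc eLpNorm (fun x => f (c • x)) 2 (gauss d)
            = eLpNorm f 2 ((gauss d).map (fun x => c • x)) :=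
              (eLpNorm_map_measure h1.1 (by fun_prop)).symm
          _ ≤ eLpNorm f 2 (ENNReal.ofReal c⁻¹ ^ d • gauss d) := eLpNorm_mono_measure _ hle
          _ = _ := eLpNorm_smul_measure_of_ne_top (by norm_num) _ _
      change ‖(memLp_dilate hc0 hc1 f).toLp _‖ ≤ _
      rw [Lp.norm_toLp, Lp.norm_def, ← ENNReal.toReal_mul]
      refine ENNReal.toReal_mono (ENNReal.mul_ne_top ?_ (Lp.eLpNorm_ne_top f)) h2
      exact ENNReal.rpow_ne_top_of_nonneg (by positivity) (by finiteness))

lemma dilate_hermiteLp {c : ℝ} (hc0 : 0 < c) (hc1 : c ≤ 1) (m : Fin d → ℕ) :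
    dilate d hc0 hc1 (hermiteLp 1 m) = hermiteLp c m := by
  change (memLp_dilate hc0 hc1 (hermiteLp 1 m)).toLp _ = _
  refine MemLp.toLp_congr _ _ ?_
  filter_upwards [ae_dilate hc0 hc1 (memLp_hermiteMv 1 m).coeFn_toLp] with x hx
  rw [hermiteLp, hx, one_smul]

end Dilation

/-! ### Hermite series in L²(γ_d) -/

section Series

variable {d : ℕ}

lemma mfact_pos (m : Fin d → ℕ) : 0 < mfact m := Finset.prod_pos fun _ _ => Nat.factorial_pos _

lemma inner_hermiteLp (m n : Fin d → ℕ) :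
    inner ℂ (hermiteLp 1 m) (hermiteLp (d := d) 1 n) = if m = n then (mfact n : ℂ) else 0 := by
  rw [L2.inner_def]
  have h1 : ∀ᵐ x ∂(gauss d), inner ℂ (hermiteLp 1 m x) (hermiteLp (d := d) 1 n x) =
      ((∏ a, ((hermiteReal (m a)).eval (x a) * (hermiteReal (n a)).eval (x a)) : ℝ) : ℂ) := by
    filter_upwards [(memLp_hermiteMv 1 m).coeFn_toLp, (memLp_hermiteMv 1 n).coeFn_toLp] with x h1 h2
    rw [hermiteLp, hermiteLp, h1, h2, RCLike.inner_apply, Complex.conj_ofReal, ← Complex.ofReal_mul,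
      mul_comm, Finset.prod_mul_distrib]
    simp only [hermiteMv, one_smul, eval_hermiteReal]
  rw [integral_congr_ae h1, integral_complex_ofReal,
    integral_fintype_prod_eq_prod (𝕜 := ℝ)
      (fun a (y : ℝ) => (hermiteReal (m a)).eval y * (hermiteReal (n a)).eval y)]
  simp only [integral_hermite_mul_hermite]
  by_cases h : m = n
  · subst h; simp [mfact]
  · obtain ⟨a, ha⟩ := Function.ne_iff.1 h
    rw [Finset.prod_eq_zero (Finset.mem_univ a) (by simp [ha])]
    simp [h]

/-- The normalized Hermite polynomials. -/
def hermiteUnit (m : Fin d → ℕ) : Lp ℂ 2 (gauss d) :=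
  (((√(mfact m : ℝ))⁻¹ : ℝ) : ℂ) • hermiteLp 1 m

lemma sqrt_mfact_ne_zero (m : Fin d → ℕ) : √(mfact m : ℝ) ≠ 0 :=
  (Real.sqrt_pos.2 (Nat.cast_pos.2 (mfact_pos m))).ne'

lemma orthonormal_hermiteUnit : Orthonormal ℂ (hermiteUnit (d := d)) := by
  classical
  rw [orthonormal_iff_ite]
  intro m n
  rw [hermiteUnit, hermiteUnit, inner_smul_left, inner_smul_right, inner_hermiteLp]
  split_ifs with h
  · subst h
    rw [Complex.conj_ofReal, show (mfact m : ℂ) = ((mfact m : ℝ) : ℂ) by push_cast; rfl,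
      ← Complex.ofReal_mul, ← Complex.ofReal_mul, ← Complex.ofReal_one]
    congr 1
    have h1 := Real.mul_self_sqrt (Nat.cast_nonneg (α := ℝ) (mfact m))
    have h2 := sqrt_mfact_ne_zero m
    field_simp
    rw [pow_two, h1]
  · simp

/-- Coefficient sequences of elements of `L²(γ_d)`. -/
def IsCoeff (β : (Fin d → ℕ) → ℂ) : Prop := Summable fun m => ‖β m‖ ^ 2 * (mfact m : ℝ)

/-- Rescaling by √(m!) turns the series into one over an orthonormal family, where summability in
norm amounts to square summability of the coefficients. -/
lemma summable_hermiteLp_iff (β : (Fin d → ℕ) → ℂ) :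
    (Summable fun m => β m • hermiteLp 1 m) ↔ IsCoeff β := by
  have h := (orthonormal_hermiteUnit (d := d)).orthogonalFamily.summable_iff_norm_sq_summable
    (fun m => β m * ((√(mfact m : ℝ) : ℝ) : ℂ))
  have e1 : (fun m => β m • hermiteLp (d := d) 1 m) = fun m =>
      (LinearIsometry.toSpanSingleton ℂ (Lp ℂ 2 (gauss d)) (orthonormal_hermiteUnit.1 m))
        (β m * ((√(mfact m : ℝ) : ℝ) : ℂ)) := by
    funext m
    rw [LinearIsometry.toSpanSingleton_apply, hermiteUnit, smul_smul, mul_assoc,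
      ← Complex.ofReal_mul, mul_inv_cancel₀ (sqrt_mfact_ne_zero m), Complex.ofReal_one, mul_one]
  have e2 : (fun m => ‖β m * ((√(mfact m : ℝ) : ℝ) : ℂ)‖ ^ 2) =
      fun m => ‖β m‖ ^ 2 * (mfact m : ℝ) := by
    funext m
    rw [norm_mul, mul_pow, Complex.norm_real, Real.norm_of_nonneg (Real.sqrt_nonneg _),
      Real.sq_sqrt (Nat.cast_nonneg _)]
  rw [e1, h, e2, IsCoeff]

lemma inner_hermiteLp_of_hasSum {β : (Fin d → ℕ) → ℂ} {g : Lp ℂ 2 (gauss d)}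
    (h : HasSum (fun m => β m • hermiteLp 1 m) g) (m : Fin d → ℕ) :
    inner ℂ (hermiteLp 1 m) g = β m * (mfact m : ℂ) := by
  have h1 := h.mapL (innerSL ℂ (hermiteLp 1 m))
  refine h1.unique ?_
  have h2 : (fun n => (innerSL ℂ (hermiteLp 1 m)) (β n • hermiteLp 1 n)) =
      fun n => if n = m then β m * (mfact m : ℂ) else 0 := by
    funext n
    rw [innerSL_apply_apply, inner_smul_right, inner_hermiteLp]
    by_cases hmn : n = m
    · subst hmn; simp
    · simp [hmn, Ne.symm hmn]
  rw [h2]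
  exact hasSum_ite_eq m _

lemma hasSum_norm_sq {β : (Fin d → ℕ) → ℂ} {g : Lp ℂ 2 (gauss d)}
    (h : HasSum (fun m => β m • hermiteLp 1 m) g) :
    HasSum (fun m => ‖β m‖ ^ 2 * (mfact m : ℝ)) (‖g‖ ^ 2) := by
  have h1 := h.mapL (innerSL ℂ g)
  rw [innerSL_apply_apply, inner_self_eq_norm_sq_to_K] at h1
  have h2 : (fun m => (innerSL ℂ g) (β m • hermiteLp 1 m)) =
      fun m => ((‖β m‖ ^ 2 * (mfact m : ℝ) : ℝ) : ℂ) := by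
    funext m
    rw [innerSL_apply_apply, inner_smul_right, ← inner_conj_symm, inner_hermiteLp_of_hasSum h,
      map_mul, ← mul_assoc, Complex.mul_conj, Complex.normSq_eq_norm_sq]
    simp
  rw [h2] at h1
  refine Complex.hasSum_ofReal.1 ?_
  rw [Complex.ofReal_pow]
  exact h1

lemma hermiteCoeff_of_hasSum {β : (Fin d → ℕ) → ℂ} {g : Lp ℂ 2 (gauss d)}
    (h : HasSum (fun m => β m • hermiteLp 1 m) g) (m : Fin d → ℕ) : hermiteCoeff g m = β m := by
  have hm : (mfact m : ℂ) ≠ 0 := Nat.cast_ne_zero.2 (mfact_pos m).ne'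
  rw [hermiteCoeff, div_eq_iff hm, ← inner_hermiteLp_of_hasSum h m, L2.inner_def]
  refine integral_congr_ae ?_
  filter_upwards [(memLp_hermiteMv 1 m).coeFn_toLp] with x hx
  rw [hermiteLp, hx, RCLike.inner_apply, Complex.conj_ofReal, one_smul, mul_comm]

/-- The function `∑ β(m) H_m(c ·)` in `L²(γ_d)`. -/
def hermiteSeries (c : ℝ) (β : (Fin d → ℕ) → ℂ) : Lp ℂ 2 (gauss d) := ∑' m, β m • hermiteLp c m

lemma hasSum_hermiteSeries {c : ℝ} (hc0 : 0 < c) (hc1 : c ≤ 1) {β : (Fin d → ℕ) → ℂ}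
    (hβ : IsCoeff β) : HasSum (fun m => β m • hermiteLp c m) (hermiteSeries c β) := by
  have h1 := ((summable_hermiteLp_iff β).2 hβ).hasSum.mapL (dilate d hc0 hc1)
  simp only [map_smul, dilate_hermiteLp] at h1
  rw [hermiteSeries, h1.tsum_eq]
  exact h1

/-- The dilated functions H_m(c ·) are not orthogonal in general; the bound is Parseval for c = 1
followed by the bounded dilation. -/
lemma exists_norm_hermiteSeries_le {c : ℝ} (hc0 : 0 < c) (hc1 : c ≤ 1) :
    ∃ K : ℝ, ∀ β : (Fin d → ℕ) → ℂ, IsCoeff β →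
      ‖hermiteSeries c β‖ ≤ K * √(∑' m, ‖β m‖ ^ 2 * (mfact m : ℝ)) := by
  refine ⟨‖dilate d hc0 hc1‖, fun β hβ => ?_⟩
  have h0 := ((summable_hermiteLp_iff β).2 hβ).hasSum
  have h1 := h0.mapL (dilate d hc0 hc1)
  simp only [map_smul, dilate_hermiteLp] at h1
  rw [hermiteSeries, h1.tsum_eq, (hasSum_norm_sq h0).tsum_eq, Real.sqrt_sq (norm_nonneg _)]
  exact ContinuousLinearMap.le_opNorm _ _

lemma IsCoeff.mul {w β : (Fin d → ℕ) → ℂ} (hβ : IsCoeff β) {B : ℝ} (hw : ∀ m, ‖w m‖ ≤ B) :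
    IsCoeff fun m => w m * β m := by
  refine Summable.of_nonneg_of_le (fun m => by positivity) (fun m => ?_) (hβ.mul_left (B ^ 2))
  rw [norm_mul, mul_pow, mul_assoc]
  gcongr
  exact hw m

/-- Dominated convergence for the squared coefficient norm of the difference, with majorant 4|β(m)|²
m!. It covers phases, truncations, damping and Fejér multipliers alike. -/
lemma tendsto_hermiteSeries {c : ℝ} (hc0 : 0 < c) (hc1 : c ≤ 1) {β : (Fin d → ℕ) → ℂ}
    (hβ : IsCoeff β) {ι : Type*} {F : Filter ι} {w : ι → (Fin d → ℕ) → ℂ} {w₀ : (Fin d → ℕ) → ℂ}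
    (hw : ∀ i m, ‖w i m‖ ≤ 1) (hw₀ : ∀ m, ‖w₀ m‖ ≤ 1)
    (hlim : ∀ m, Tendsto (fun i => w i m) F (𝓝 (w₀ m))) :
    Tendsto (fun i => hermiteSeries c fun m => w i m * β m) F
      (𝓝 (hermiteSeries c fun m => w₀ m * β m)) := by
  obtain ⟨K, hK⟩ := exists_norm_hermiteSeries_le (d := d) hc0 hc1
  rw [tendsto_iff_norm_sub_tendsto_zero]
  have hbd : ∀ i m, ‖w i m - w₀ m‖ ≤ 2 := fun i m =>
    (norm_sub_le _ _).trans (by linarith [hw i m, hw₀ m])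
  have hcoef : ∀ i, IsCoeff fun m => (w i m - w₀ m) * β m := fun i => hβ.mul (hbd i)
  have h1 : ∀ i, hermiteSeries c (fun m => w i m * β m) - hermiteSeries c (fun m => w₀ m * β m) =
      hermiteSeries c fun m => (w i m - w₀ m) * β m := by
    intro i
    have h2 := (hasSum_hermiteSeries hc0 hc1 (hβ.mul (hw i))).sub
      (hasSum_hermiteSeries hc0 hc1 (hβ.mul hw₀))
    refine h2.unique ?_
    have h3 := hasSum_hermiteSeries hc0 hc1 (hcoef i)
    simpa only [sub_mul, sub_smul] using h3
  simp only [h1]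
  have h2 : Tendsto (fun i => K * √(∑' m, ‖(w i m - w₀ m) * β m‖ ^ 2 * (mfact m : ℝ))) F
      (𝓝 (K * √(∑' _ : Fin d → ℕ, 0))) := by
    refine (Tendsto.sqrt ?_).const_mul K
    refine tendsto_tsum_of_dominated_convergence
      (bound := fun m => 4 * (‖β m‖ ^ 2 * (mfact m : ℝ))) (hβ.mul_left 4) (fun m => ?_)
      (Eventually.of_forall fun i m => ?_)
    · have h3 : Tendsto (fun i => ‖(w i m - w₀ m) * β m‖ ^ 2 * (mfact m : ℝ)) F
          (𝓝 (‖(w₀ m - w₀ m) * β m‖ ^ 2 * (mfact m : ℝ))) :=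
        (((((hlim m).sub_const _).mul_const _).norm).pow 2).mul_const _
      simpa using h3
    · rw [Real.norm_of_nonneg (by positivity), norm_mul, mul_pow, mul_assoc]
      have h5 : ‖w i m - w₀ m‖ ^ 2 ≤ 4 := by
        have := hbd i m
        nlinarith [norm_nonneg (w i m - w₀ m)]
      gcongr
  simp only [tsum_zero, Real.sqrt_zero, mul_zero] at h2
  exact squeeze_zero (fun i => norm_nonneg _) (fun i => hK _ (hcoef i)) h2

end Series

/-! ### Lower semicontinuity, convexity and shift invariance of the space-time integral -/

section Energy

variable {d : ℕ}

/-- The quantity `(∫ |f|^{2k} dγ_d)^ℓ`. -/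
def powEnergy (k l : ℕ) (f : Lp ℂ 2 (gauss d)) : ℝ≥0∞ := (∫⁻ x, ‖f x‖ₑ ^ (2 * k) ∂(gauss d)) ^ l

/-- An L²-convergent sequence has a subsequence converging almost everywhere, and Fatou's lemma then
shows that sublevel sets are closed. Continuity fails to be available since 2k > 2 for k ≥ 2. -/
lemma lowerSemicontinuous_powEnergy (k l : ℕ) :
    LowerSemicontinuous (powEnergy (d := d) k l) := by
  have h : LowerSemicontinuous fun f : Lp ℂ 2 (gauss d) => ∫⁻ x, ‖f x‖ₑ ^ (2 * k) ∂(gauss d) := by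
    rw [lowerSemicontinuous_iff_isClosed_preimage]
    intro y
    refine IsSeqClosed.isClosed fun u f hu hf => ?_
    obtain ⟨ns, -, hns⟩ := (tendstoInMeasure_of_tendsto_Lp hf).exists_seq_tendsto_ae
    have h1 : ∫⁻ x, ‖f x‖ₑ ^ (2 * k) ∂(gauss d) ≤
        ∫⁻ x, liminf (fun i => ‖u (ns i) x‖ₑ ^ (2 * k)) atTop ∂(gauss d) := by
      refine lintegral_mono_ae ?_
      filter_upwards [hns] with x hx
      exact ((ENNReal.continuous_pow (2 * k)).continuousAt.tendsto.comp hx.enorm).liminf_eq.ge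
    refine h1.trans ((lintegral_liminf_le' fun i => ?_).trans ?_)
    · exact (Lp.aestronglyMeasurable _).enorm.pow_const _
    · refine liminf_le_of_frequently_le' (Frequently.of_forall fun i => ?_)
      exact hu (ns i)
  exact (ENNReal.continuous_pow l).comp_lowerSemicontinuous h (pow_left_mono l)

lemma powEnergy_eq_eLpNorm {k : ℕ} (hk : 1 ≤ k) (l : ℕ) (f : Lp ℂ 2 (gauss d)) :
    powEnergy k l f = eLpNorm f ((2 * k : ℕ) : ℝ≥0∞) (gauss d) ^ (2 * k * l) := by
  have h0 : (2 * k : ℕ) ≠ 0 := by omega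
  rw [eLpNorm_eq_lintegral_rpow_enorm_toReal (by exact_mod_cast h0) (by finiteness), pow_mul,
    powEnergy]
  congr 1
  simp only [ENNReal.toReal_natCast, ENNReal.rpow_natCast]
  rw [← ENNReal.rpow_natCast, ← ENNReal.rpow_mul, one_div, inv_mul_cancel₀ (by exact_mod_cast h0),
    ENNReal.rpow_one]

/-- The quantity is the power 2kℓ of an L^(2k) norm: Minkowski's inequality, then Jensen's for the
power. -/
lemma powEnergy_sum_le {k l : ℕ} (hk : 1 ≤ k) (hl : 1 ≤ l) {ι : Type*} (s : Finset ι)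
    (w : ι → NNReal) (hw : ∑ i ∈ s, w i = 1) (f : ι → Lp ℂ 2 (gauss d)) :
    powEnergy k l (∑ i ∈ s, ((w i : ℝ) : ℂ) • f i) ≤ ∑ i ∈ s, (w i : ℝ≥0∞) * powEnergy k l (f i) := by
  simp only [powEnergy_eq_eLpNorm hk]
  have h1 : eLpNorm (∑ i ∈ s, ((w i : ℝ) : ℂ) • f i : Lp ℂ 2 (gauss d)) ((2 * k : ℕ) : ℝ≥0∞)
      (gauss d) ≤ ∑ i ∈ s, (w i : ℝ≥0∞) * eLpNorm (f i) ((2 * k : ℕ) : ℝ≥0∞) (gauss d) := by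
    rw [eLpNorm_congr_ae (Lp.coeFn_finsetSum s _)]
    refine (eLpNorm_sum_le (fun i _ => Lp.aestronglyMeasurable _) ?_).trans ?_
    · exact_mod_cast (by omega : 1 ≤ 2 * k)
    · refine Finset.sum_le_sum fun i _ => ?_
      rw [eLpNorm_congr_ae (Lp.coeFn_smul _ _), eLpNorm_const_smul]
      refine mul_le_mul_left ?_ _
      rw [← ofReal_norm, Complex.norm_real, Real.norm_of_nonneg (NNReal.coe_nonneg (w i)), ENNReal.ofReal_coe_nnreal]
  refine (pow_le_pow_left' h1 _).trans ?_
  have h2 := ENNReal.rpow_arith_mean_le_arith_mean_rpow s (fun i => (w i : ℝ≥0∞))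
    (fun i => eLpNorm (f i) ((2 * k : ℕ) : ℝ≥0∞) (gauss d)) (by exact_mod_cast hw)
    (p := ((2 * k * l : ℕ) : ℝ)) (by
      have : 1 ≤ 2 * k * l := Nat.mul_pos (by omega) hl
      exact_mod_cast this)
  simpa only [ENNReal.rpow_natCast] using h2

/-- The phase `e^{2π |m| i t}`. -/
def phase (t : ℝ) (m : Fin d → ℕ) : ℂ := Complex.exp (2 * Real.pi * (deg m : ℂ) * Complex.I * t)

lemma norm_phase (t : ℝ) (m : Fin d → ℕ) : ‖phase t m‖ = 1 := by
  rw [phase, show 2 * Real.pi * (deg m : ℂ) * Complex.I * t =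
    ((2 * Real.pi * deg m * t : ℝ) : ℂ) * Complex.I by push_cast; ring, Complex.norm_exp_ofReal_mul_I]

lemma phase_add (t s : ℝ) (m : Fin d → ℕ) : phase (t + s) m = phase t m * phase s m := by
  rw [phase, phase, phase, ← Complex.exp_add]
  congr 1
  push_cast
  ring

lemma phase_one (m : Fin d → ℕ) : phase 1 m = 1 := by
  rw [phase, Complex.exp_eq_one_iff]
  exact ⟨deg m, by push_cast; ring⟩

lemma continuous_phase (m : Fin d → ℕ) : Continuous fun t => phase t m := by
  unfold phase
  fun_prop

/-- The quantity `∫_I (∫ |∑ β(m) e^{2π|m|it} H_m(c x)|^{2k} dγ_d)^ℓ dt`. -/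
def energy (k l : ℕ) (c : ℝ) (β : (Fin d → ℕ) → ℂ) : ℝ≥0∞ :=
  ∫⁻ t in Set.Ioo (-1 / 2 : ℝ) (1 / 2), powEnergy k l (hermiteSeries c fun m => phase t m * β m)

variable {c : ℝ} {k l : ℕ}

lemma measurable_powEnergy_phase (hc0 : 0 < c) (hc1 : c ≤ 1) {β : (Fin d → ℕ) → ℂ} (hβ : IsCoeff β) :
    Measurable fun t => powEnergy k l (hermiteSeries c fun m => phase t m * β m) := by
  have h : Continuous fun t : ℝ => hermiteSeries c fun m => phase t m * β m :=
    continuous_iff_continuousAt.2 fun t =>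
      tendsto_hermiteSeries hc0 hc1 hβ (fun i m => (norm_phase i m).le)
        (fun m => (norm_phase t m).le) fun m => (continuous_phase m).continuousAt
  exact ((lowerSemicontinuous_powEnergy k l).comp h).measurable

/-- For each fixed t the series converge in L², so lower semicontinuity applies; Fatou's lemma in t
finishes. -/
lemma energy_le_liminf (hc0 : 0 < c) (hc1 : c ≤ 1) {β : (Fin d → ℕ) → ℂ} (hβ : IsCoeff β)
    {w : ℕ → (Fin d → ℕ) → ℂ} {w₀ : (Fin d → ℕ) → ℂ}
    (hw : ∀ i m, ‖w i m‖ ≤ 1) (hw₀ : ∀ m, ‖w₀ m‖ ≤ 1)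
    (hlim : ∀ m, Tendsto (fun i => w i m) atTop (𝓝 (w₀ m))) :
    energy k l c (fun m => w₀ m * β m) ≤ liminf (fun i => energy k l c fun m => w i m * β m) atTop := by
  refine le_trans (lintegral_mono fun t => ?_)
    (lintegral_liminf_le fun i => measurable_powEnergy_phase hc0 hc1 (hβ.mul (hw i)))
  have h1 : Tendsto (fun i => hermiteSeries c fun m => phase t m * (w i m * β m)) atTop
      (𝓝 (hermiteSeries c fun m => phase t m * (w₀ m * β m))) := by
    simp only [← mul_assoc]
    refine tendsto_hermiteSeries hc0 hc1 hβ (fun i m => ?_) (fun m => ?_)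
      (fun m => (hlim m).const_mul _)
    · rw [norm_mul, norm_phase, one_mul]; exact hw i m
    · rw [norm_mul, norm_phase, one_mul]; exact hw₀ m
  refine ((lowerSemicontinuous_powEnergy k l).lowerSemicontinuousAt _).le_liminf.trans ?_
  exact liminf_le_liminf_of_le (u := powEnergy k l) h1

lemma lintegral_Ioo_add_of_periodic {F : ℝ → ℝ≥0∞} (hF : Function.Periodic F 1) (τ : ℝ) :
    ∫⁻ t in Set.Ioo (-1 / 2 : ℝ) (1 / 2), F (t + τ) = ∫⁻ t in Set.Ioo (-1 / 2 : ℝ) (1 / 2), F t := by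
  rw [setLIntegral_congr (Ioo_ae_eq_Ioc (μ := volume) (a := (-1 / 2 : ℝ)) (b := 1 / 2)),
    setLIntegral_congr (Ioo_ae_eq_Ioc (μ := volume) (a := (-1 / 2 : ℝ)) (b := 1 / 2))]
  have h1 := (measurePreserving_add_right (volume : Measure ℝ) τ).setLIntegral_comp_preimage_emb
    (measurableEmbedding_addRight τ) F (Set.Ioc (-1 / 2 + τ) (-1 / 2 + τ + 1))
  rw [Set.preimage_add_const_Ioc] at h1
  have e1 : -1 / 2 + τ - τ = -1 / 2 := by ring
  have e2 : -1 / 2 + τ + 1 - τ = 1 / 2 := by ring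
  rw [e1, e2] at h1
  rw [h1]
  -- Two half-open unit intervals are fundamental domains for ℤ, so a 1-periodic function has the
  -- same integral over both.
  have h2 := (isAddFundamentalDomain_Ioc one_pos (-1 / 2 + τ)).setLIntegral_eq
    (isAddFundamentalDomain_Ioc one_pos (-1 / 2 : ℝ)) F fun g x => by
      obtain ⟨g, hg⟩ := g
      obtain ⟨n, rfl⟩ := AddSubgroup.mem_zmultiples_iff.1 hg
      change F (n • (1 : ℝ) + x) = F x
      rw [add_comm]
      exact hF.zsmul n x
  rw [h2]
  norm_num

/-- The multiplier is a convex combination of phases, each of which is a time shift. Convexity of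
`powEnergy` and invariance of the t-integral under shifts give the bound. -/
lemma energy_average_le (hc0 : 0 < c) (hc1 : c ≤ 1) (hk : 1 ≤ k) (hl : 1 ≤ l) {β : (Fin d → ℕ) → ℂ} (hβ : IsCoeff β)
    {ι : Type*} (s : Finset ι) (w : ι → NNReal) (hw : ∑ i ∈ s, w i = 1) (τ : ι → ℝ) :
    energy k l c (fun m => (∑ i ∈ s, ((w i : ℝ) : ℂ) * phase (τ i) m) * β m) ≤ energy k l c β := by
  set F : ℝ → ℝ≥0∞ := fun t => powEnergy k l (hermiteSeries c fun m => phase t m * β m) with hF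
  have hper : Function.Periodic F 1 := by
    intro t
    simp only [hF, phase_add, phase_one, mul_one]
  have hco : ∀ t, IsCoeff fun m => phase t m * β m := fun t => hβ.mul fun m => (norm_phase t m).le
  have h1 : ∀ t, hermiteSeries c (fun m => phase t m * ((∑ i ∈ s, ((w i : ℝ) : ℂ) * phase (τ i) m) * β m)) =
      ∑ i ∈ s, ((w i : ℝ) : ℂ) • hermiteSeries c fun m => phase (t + τ i) m * β m := by
    intro t
    have h2 := hasSum_sum (s := s) fun i _ =>
      (hasSum_hermiteSeries hc0 hc1 (hco (t + τ i))).const_smul ((w i : ℝ) : ℂ)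
    rw [hermiteSeries, ← h2.tsum_eq]
    congr 1
    funext m
    simp only [phase_add, smul_smul, ← Finset.sum_smul]
    congr 1
    rw [Finset.sum_mul, Finset.mul_sum]
    exact Finset.sum_congr rfl fun i _ => by ring
  calc energy k l c (fun m => (∑ i ∈ s, ((w i : ℝ) : ℂ) * phase (τ i) m) * β m)
      ≤ ∫⁻ t in Set.Ioo (-1 / 2 : ℝ) (1 / 2), ∑ i ∈ s, (w i : ℝ≥0∞) * F (t + τ i) := by
        refine lintegral_mono fun t => ?_
        simp only [h1]
        exact powEnergy_sum_le hk hl s w hw _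
    _ = ∑ i ∈ s, (w i : ℝ≥0∞) * energy k l c β := by
        have hm : Measurable F := measurable_powEnergy_phase hc0 hc1 hβ
        rw [lintegral_finsetSum]
        · refine Finset.sum_congr rfl fun i _ => ?_
          rw [lintegral_const_mul _ (by fun_prop), lintegral_Ioo_add_of_periodic hper]
          rfl
        · intro i _
          fun_prop
    _ = energy k l c β := by
        rw [← Finset.sum_mul, show ∑ i ∈ s, (w i : ℝ≥0∞) = 1 by exact_mod_cast hw, one_mul]

end Energy

/-! ### The identity for finitely many coefficients -/

section FiniteIdentity

variable {l k d : ℕ}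

lemma integrable_prod_hermiteMv (c : ℝ) (n n' : Fin k → Fin d → ℕ) :
    Integrable (fun x : Fin d → ℝ => ∏ j, (hermiteMv (n j) (c • x) * hermiteMv (n' j) (c • x)))
      (gauss d) := by
  have h := Integrable.fintype_prod (𝕜 := ℝ) (ι := Fin d) (μ := fun _ => gaussianReal 0 1)
    (f := fun a (y : ℝ) => (∏ j, ((hermiteReal (n j a)).comp (Polynomial.C c * Polynomial.X) *
      (hermiteReal (n' j a)).comp (Polynomial.C c * Polynomial.X))).eval y)
    (fun a => integrable_aeval_gaussian _)
  refine h.congr (ae_of_all _ fun x => ?_)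
  simp only [Polynomial.eval_prod, Polynomial.eval_mul, Polynomial.eval_comp, Polynomial.eval_C,
    Polynomial.eval_X]
  rw [Finset.prod_comm]
  refine Finset.prod_congr rfl fun j _ => ?_
  simp only [hermiteMv, eval_hermiteReal, Finset.prod_mul_distrib, Pi.smul_apply, smul_eq_mul]

lemma integrable_coeffP (c : ℝ) (M N : Mat l k d) :
    Integrable (fun x : Fin l → Fin d → ℝ =>
      ∏ i, ∏ j, (hermiteMv (M i j) (c • x i) * hermiteMv (N i j) (c • x i)))
      (Measure.pi fun _ => gauss d) :=
  Integrable.fintype_prod (𝕜 := ℝ) (ι := Fin l) (μ := fun _ => gauss d)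
    (f := fun i x => ∏ j, (hermiteMv (M i j) (c • x) * hermiteMv (N i j) (c • x)))
    fun i => integrable_prod_hermiteMv c (M i) (N i)

/-- A finite Hermite sum, as a function. -/
def hermiteSum (A : Finset (Fin d → ℕ)) (c : ℝ) (b : (Fin d → ℕ) → ℂ) (x : Fin d → ℝ) : ℂ :=
  ∑ m ∈ A, b m * (hermiteMv m (c • x) : ℂ)

lemma prod_hermiteSum (A : Finset (Fin d → ℕ)) (c : ℝ) (b : (Fin d → ℕ) → ℂ) (x : Fin d → ℝ) :
    hermiteSum A c b x ^ k = ∑ n ∈ Fintype.piFinset fun _ : Fin k => A,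
      (∏ j, b (n j)) * ((∏ j, hermiteMv (n j) (c • x) : ℝ) : ℂ) := by
  rw [← Fin.prod_const, hermiteSum, Finset.prod_univ_sum]
  refine Finset.sum_congr rfl fun n _ => ?_
  rw [Finset.prod_mul_distrib]
  push_cast
  rfl

/-- The matrices with all entries in `A`. -/
def matBox (l k : ℕ) (A : Finset (Fin d → ℕ)) : Finset (Mat l k d) :=
  Fintype.piFinset fun _ : Fin l => Fintype.piFinset fun _ : Fin k => A

lemma prod_prod_hermiteSum (A : Finset (Fin d → ℕ)) (c : ℝ) (b : (Fin d → ℕ) → ℂ)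
    (x : Fin l → Fin d → ℝ) :
    ∏ i, hermiteSum A c b (x i) ^ k = ∑ M ∈ matBox l k A,
      tensor l k b M * ((∏ i, ∏ j, hermiteMv (M i j) (c • x i) : ℝ) : ℂ) := by
  simp only [prod_hermiteSum]
  rw [Finset.prod_univ_sum]
  refine Finset.sum_congr rfl fun M _ => ?_
  rw [Finset.prod_mul_distrib, tensor]
  push_cast
  rfl

lemma ofReal_norm_pow_two_mul (z : ℂ) (k : ℕ) : ((‖z‖ ^ (2 * k) : ℝ) : ℂ) = z ^ k * conj (z ^ k) := by
  rw [Complex.mul_conj, Complex.normSq_eq_norm_sq, norm_pow, ← pow_mul, mul_comm]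

lemma integrable_norm_hermiteSum_pow (A : Finset (Fin d → ℕ)) (c : ℝ) (b : (Fin d → ℕ) → ℂ) (k : ℕ) :
    Integrable (fun x => ‖hermiteSum A c b x‖ ^ (2 * k)) (gauss d) := by
  have h : Integrable (fun x => ((‖hermiteSum A c b x‖ ^ (2 * k) : ℝ) : ℂ)) (gauss d) := by
    have h1 : (fun x => ((‖hermiteSum A c b x‖ ^ (2 * k) : ℝ) : ℂ)) = fun x =>
        ∑ n ∈ Fintype.piFinset fun _ : Fin k => A, ∑ n' ∈ Fintype.piFinset fun _ : Fin k => A,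
          ((∏ j, b (n j)) * conj (∏ j, b (n' j))) *
            ((∏ j, (hermiteMv (n j) (c • x) * hermiteMv (n' j) (c • x)) : ℝ) : ℂ) := by
      funext x
      rw [ofReal_norm_pow_two_mul, prod_hermiteSum, map_sum, Finset.sum_mul_sum]
      refine Finset.sum_congr rfl fun n _ => Finset.sum_congr rfl fun n' _ => ?_
      rw [map_mul, Complex.conj_ofReal, Finset.prod_mul_distrib, Complex.ofReal_mul]
      ring
    rw [h1]
    exact integrable_finsetSum _ fun n _ => integrable_finsetSum _ fun n' _ =>
      ((integrable_prod_hermiteMv c n n').ofReal).const_mul _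
  exact h.re

lemma integral_norm_hermiteSum_pow (A : Finset (Fin d → ℕ)) (b : (Fin d → ℕ) → ℂ) :
    (((∫ x, ‖hermiteSum A √(1 / (k : ℝ)) b x‖ ^ (2 * k) ∂(gauss d)) ^ l : ℝ) : ℂ) =
      ∑ M ∈ matBox l k A, ∑ N ∈ matBox l k A,
        tensor l k b M * conj (tensor l k b N) * (coeffP M N : ℂ) := by
  have h0 := integral_fintype_prod_eq_pow (𝕜 := ℝ) (ι := Fin l) (μ := gauss d)
    (fun x => ‖hermiteSum A √(1 / (k : ℝ)) b x‖ ^ (2 * k))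
  rw [Fintype.card_fin] at h0
  rw [← h0, ← integral_complex_ofReal]
  have h1 : ∀ x : Fin l → Fin d → ℝ,
      ((∏ i, ‖hermiteSum A √(1 / (k : ℝ)) b (x i)‖ ^ (2 * k) : ℝ) : ℂ) =
      ∑ M ∈ matBox l k A, ∑ N ∈ matBox l k A, (tensor l k b M * conj (tensor l k b N)) *
        ((∏ i, ∏ j, (hermiteMv (M i j) (√(1 / (k : ℝ)) • x i) *
          hermiteMv (N i j) (√(1 / (k : ℝ)) • x i)) : ℝ) : ℂ) := by
    intro x
    rw [Complex.ofReal_prod]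
    simp only [ofReal_norm_pow_two_mul, Finset.prod_mul_distrib]
    rw [← map_prod, prod_prod_hermiteSum, map_sum, Finset.sum_mul_sum]
    refine Finset.sum_congr rfl fun M _ => Finset.sum_congr rfl fun N _ => ?_
    rw [map_mul, Complex.conj_ofReal, Complex.ofReal_mul]
    ring
  simp only [h1]
  rw [integral_finsetSum _ fun M _ => integrable_finsetSum _ fun N _ =>
    ((integrable_coeffP _ M N).ofReal).const_mul _]
  refine Finset.sum_congr rfl fun M _ => ?_
  rw [integral_finsetSum _ fun N _ => ((integrable_coeffP _ M N).ofReal).const_mul _]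
  refine Finset.sum_congr rfl fun N _ => ?_
  rw [integral_const_mul, coeffP]
  congr 1
  exact integral_complex_ofReal

lemma powEnergy_hermiteSeries {A : Finset (Fin d → ℕ)} {b : (Fin d → ℕ) → ℂ}
    (hb : ∀ m ∉ A, b m = 0) (c : ℝ) (k l : ℕ) :
    powEnergy k l (hermiteSeries c b) =
      ENNReal.ofReal ((∫ x, ‖hermiteSum A c b x‖ ^ (2 * k) ∂(gauss d)) ^ l) := by
  have h1 : hermiteSeries c b = ∑ m ∈ A, b m • hermiteLp c m :=
    tsum_eq_sum fun m hm => by rw [hb m hm, zero_smul]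
  have h2 : ∀ᵐ x ∂(gauss d), hermiteSeries c b x = hermiteSum A c b x := by
    rw [h1]
    have h3 : ∀ m ∈ A, ∀ᵐ x ∂(gauss d), (b m • hermiteLp c m) x = b m * (hermiteMv m (c • x) : ℂ) := by
      intro m _
      filter_upwards [Lp.coeFn_smul (b m) (hermiteLp c m), (memLp_hermiteMv c m).coeFn_toLp]
        with x hx hx'
      rw [hx, Pi.smul_apply, hermiteLp, hx', smul_eq_mul]
    filter_upwards [Lp.coeFn_fun_finsetSum A fun m => b m • hermiteLp c m,
      (Filter.eventually_all_finset A).2 h3] with x hx hx'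
    rw [hx, hermiteSum]
    exact Finset.sum_congr rfl hx'
  rw [powEnergy, ENNReal.ofReal_pow (integral_nonneg fun x => by positivity),
    ofReal_integral_eq_lintegral_ofReal (integrable_norm_hermiteSum_pow A c b k)
      (ae_of_all _ fun x => by positivity)]
  congr 1
  refine lintegral_congr_ae ?_
  filter_upwards [h2] with x hx
  rw [hx, ← ofReal_norm, ENNReal.ofReal_pow (norm_nonneg _)]

lemma tensor_phase_mul (t : ℝ) (β : (Fin d → ℕ) → ℂ) (M : Mat l k d) :
    tensor l k (fun m => phase t m * β m) M =
      Complex.exp (2 * Real.pi * (matDeg M : ℂ) * Complex.I * t) * tensor l k β M := by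
  simp only [tensor, Finset.prod_mul_distrib]
  congr 1
  simp only [phase, ← Complex.exp_sum]
  congr 1
  simp only [matDeg, Nat.cast_sum, Finset.mul_sum, Finset.sum_mul]

lemma integral_phase (n : ℤ) :
    ∫ t in Set.Ioo (-1 / 2 : ℝ) (1 / 2), Complex.exp (2 * Real.pi * Complex.I * n * t) =
      if n = 0 then 1 else 0 := by
  rw [← integral_Ioc_eq_integral_Ioo, ← intervalIntegral.integral_of_le (by norm_num)]
  split_ifs with h
  · subst h; norm_num
  · have h1 : (2 * Real.pi * Complex.I * n : ℂ) ≠ 0 := by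
      simp [Real.pi_ne_zero, h]
    rw [integral_exp_mul_complex h1, div_eq_zero_iff]
    left
    rw [sub_eq_zero, Complex.exp_eq_exp_iff_exists_int]
    exact ⟨n, by push_cast; ring⟩

/-- Orthogonality of the characters on an interval of length one leaves the pairs of equal degree,
which is why 𝒫 couples only these. -/
lemma integral_quadratic_phase (B : Finset (Mat l k d)) (φ : Mat l k d → ℂ) :
    ∫ t in Set.Ioo (-1 / 2 : ℝ) (1 / 2), ∑ M ∈ B, ∑ N ∈ B,
        (Complex.exp (2 * Real.pi * (matDeg M : ℂ) * Complex.I * t) * φ M) *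
        conj (Complex.exp (2 * Real.pi * (matDeg N : ℂ) * Complex.I * t) * φ N) * (coeffP M N : ℂ) =
      ∑ M ∈ B, ∑ N ∈ B, if matDeg N = matDeg M then φ M * conj (φ N) * (coeffP M N : ℂ) else 0 := by
  have h1 : ∀ (M N : Mat l k d) (t : ℝ),
      (Complex.exp (2 * Real.pi * (matDeg M : ℂ) * Complex.I * t) * φ M) *
        conj (Complex.exp (2 * Real.pi * (matDeg N : ℂ) * Complex.I * t) * φ N) * (coeffP M N : ℂ) =
      (φ M * conj (φ N) * (coeffP M N : ℂ)) *
        Complex.exp (2 * Real.pi * Complex.I * ((matDeg M - matDeg N : ℤ) : ℂ) * t) := by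
    intro M N t
    have h2 : Complex.exp (2 * Real.pi * Complex.I * ((matDeg M - matDeg N : ℤ) : ℂ) * t) =
        Complex.exp (2 * Real.pi * (matDeg M : ℂ) * Complex.I * t) *
          conj (Complex.exp (2 * Real.pi * (matDeg N : ℂ) * Complex.I * t)) := by
      rw [← Complex.exp_conj, ← Complex.exp_add]
      congr 1
      simp only [map_mul, Complex.conj_I, Complex.conj_ofReal, map_natCast, map_ofNat]
      push_cast
      ring
    rw [h2, map_mul]
    ring
  simp only [h1]
  have hint : ∀ (a : ℂ) (n : ℤ), Integrable
      (fun t : ℝ => a * Complex.exp (2 * Real.pi * Complex.I * (n : ℂ) * t))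
      (volume.restrict (Set.Ioo (-1 / 2 : ℝ) (1 / 2))) := by
    intro a n
    have hc : Continuous fun t : ℝ => a * Complex.exp (2 * Real.pi * Complex.I * (n : ℂ) * t) := by
      fun_prop
    exact (hc.integrableOn_Icc (a := -1 / 2) (b := 1 / 2)).mono_set Set.Ioo_subset_Icc_self
  rw [integral_finsetSum _ fun M _ => integrable_finsetSum _ fun N _ => hint _ _]
  refine Finset.sum_congr rfl fun M _ => ?_
  rw [integral_finsetSum _ fun N _ => hint _ _]
  refine Finset.sum_congr rfl fun N _ => ?_
  rw [integral_const_mul, integral_phase]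
  by_cases h : matDeg N = matDeg M
  · simp [h]
  · rw [if_neg (by omega), if_neg h, mul_zero]

lemma mem_matBox {A : Finset (Fin d → ℕ)} {M : Mat l k d} : M ∈ matBox l k A ↔ ∀ i j, M i j ∈ A := by
  simp [matBox]

lemma tensor_eq_zero {A : Finset (Fin d → ℕ)} {b : (Fin d → ℕ) → ℂ} (hb : ∀ m ∉ A, b m = 0)
    {M : Mat l k d} (hM : M ∉ matBox l k A) : tensor l k b M = 0 := by
  rw [mem_matBox] at hM
  push Not at hM
  obtain ⟨i, j, hij⟩ := hM
  exact Finset.prod_eq_zero (Finset.mem_univ i)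
    (Finset.prod_eq_zero (Finset.mem_univ j) (hb _ hij))

lemma hasSum_formS {B : Finset (Mat l k d)} {φ : Mat l k d → ℂ} (hφ : ∀ M ∉ B, φ M = 0) :
    HasSum (fun S => formS S φ) (∑ M ∈ B, ∑ N ∈ B,
      if matDeg N = matDeg M then φ M * conj (φ N) * (coeffP M N : ℂ) else 0) := by
  have h1 : HasSum (fun M => φ M * conj (opP l k d φ M) * (matFact M : ℂ))
      (∑ M ∈ B, φ M * conj (opP l k d φ M) * (matFact M : ℂ)) :=
    hasSum_sum_of_ne_finset_zero fun M hM => by simp [hφ M hM]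
  have h2 := hasSum_slices h1.summable
  rw [h1.tsum_eq] at h2
  convert! h2 using 1
  refine Finset.sum_congr rfl fun M _ => ?_
  have hM0 : (matFact M : ℂ) ≠ 0 := Nat.cast_ne_zero.2 (matFact_pos M).ne'
  have h3 : opP l k d φ M = ∑ N ∈ B,
      if matDeg N = matDeg M then φ N * ((coeffP M N / matFact M : ℝ) : ℂ) else 0 := by
    change ∑ N ∈ slice l k d (matDeg M), φ N * ((coeffP M N / matFact M : ℝ) : ℂ) = _
    rw [← Finset.sum_filter]
    refine (Finset.sum_subset (fun N hN => ?_) fun N hN hN' => ?_).symm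
    · exact mem_slice.2 (Finset.mem_filter.1 hN).2
    · rw [hφ N fun h => hN' (Finset.mem_filter.2 ⟨h, mem_slice.1 hN⟩), zero_mul]
  rw [h3, map_sum, Finset.mul_sum, Finset.sum_mul]
  refine Finset.sum_congr rfl fun N _ => ?_
  split_ifs
  · rw [map_mul, Complex.conj_ofReal]
    push_cast
    field_simp
  · simp

lemma formS_re_nonneg (hk : 2 ≤ k) (S : ℕ) (φ : Mat l k d → ℂ) : 0 ≤ (formS S φ).re := by
  rw [formS_eq_sum hk, Complex.ofReal_re]
  exact Finset.sum_nonneg fun r _ => compSq_nonneg _ _ _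

/-- The 2k-th power of the modulus is a product of k factors and k conjugates, and the ℓ-th power of
its integral is an integral over ℓ copies of space. This produces the matrices; integration in t and
regrouping by degree give the forms. -/
lemma energy_of_finite (hk : 2 ≤ k) {A : Finset (Fin d → ℕ)} {β : (Fin d → ℕ) → ℂ}
    (hβ : ∀ m ∉ A, β m = 0) :
    energy k l √(1 / (k : ℝ)) β = ∑' S, ENNReal.ofReal (formS S (tensor l k β)).re := by
  set c := √(1 / (k : ℝ)) with hc
  set V : ℝ → ℝ := fun t =>
    (∫ x, ‖hermiteSum A c (fun m => phase t m * β m) x‖ ^ (2 * k) ∂(gauss d)) ^ l with hV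
  set G : ℝ → ℂ := fun t => ∑ M ∈ matBox l k A, ∑ N ∈ matBox l k A,
        (Complex.exp (2 * Real.pi * (matDeg M : ℂ) * Complex.I * t) * tensor l k β M) *
        conj (Complex.exp (2 * Real.pi * (matDeg N : ℂ) * Complex.I * t) * tensor l k β N) *
          (coeffP M N : ℂ) with hG
  have hVG : ∀ t, (V t : ℂ) = G t := by
    intro t
    rw [hV, hG]
    simp only
    rw [hc, integral_norm_hermiteSum_pow]
    simp only [tensor_phase_mul]
  have hGc : Continuous G := by
    simp only [hG]
    fun_prop
  have hVc : Continuous V := by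
    have : V = fun t => (G t).re := funext fun t => by rw [← hVG, Complex.ofReal_re]
    rw [this]
    fun_prop
  have hV0 : ∀ t, 0 ≤ V t := fun t => pow_nonneg (integral_nonneg fun x => by positivity) _
  have h1 : energy k l c β = ENNReal.ofReal (∫ t in Set.Ioo (-1 / 2 : ℝ) (1 / 2), V t) := by
    rw [ofReal_integral_eq_lintegral_ofReal _ (ae_of_all _ hV0)]
    · refine lintegral_congr fun t => ?_
      exact powEnergy_hermiteSeries (fun m hm => by rw [hβ m hm, mul_zero]) c k l
    · exact (hVc.integrableOn_Icc (a := -1 / 2) (b := 1 / 2)).mono_set Set.Ioo_subset_Icc_self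
  have h2 := hasSum_formS (B := matBox l k A) (φ := tensor l k β) fun M hM => tensor_eq_zero hβ hM
  rw [← integral_quadratic_phase] at h2
  have h3 : ((∫ t in Set.Ioo (-1 / 2 : ℝ) (1 / 2), V t : ℝ) : ℂ) =
      ∫ t in Set.Ioo (-1 / 2 : ℝ) (1 / 2), G t := by
    rw [← integral_complex_ofReal]
    simp only [hVG]
  have h2' : HasSum (fun S => formS S (tensor l k β)) (∫ t in Set.Ioo (-1 / 2 : ℝ) (1 / 2), G t) := h2
  rw [← h3] at h2'
  have h4 := Complex.hasSum_re h2'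
  rw [Complex.ofReal_re] at h4
  rw [h1, ← h4.tsum_eq, ENNReal.ofReal_tsum_of_nonneg (fun S => formS_re_nonneg hk S _) h4.summable]

end FiniteIdentity

/-! ### Norm and forms of tensor products -/

section TensorNorm

variable {l k d : ℕ}

lemma hasSum_prod_fin {ι : Type*} {f : ι → ℝ} {a : ℝ} (hf0 : ∀ i, 0 ≤ f i) (hf : HasSum f a)
    (n : ℕ) : HasSum (fun x : Fin n → ι => ∏ i, f (x i)) (a ^ n) := by
  induction n with
  | zero => simp [hasSum_unique]
  | succ n ih =>
    have h0 : ∀ x : Fin n → ι, 0 ≤ ∏ i, f (x i) := fun x => Finset.prod_nonneg fun i _ => hf0 _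
    have hs : Summable fun x : ι × (Fin n → ι) => f x.1 * ∏ i, f (x.2 i) :=
      Summable.mul_of_nonneg (f := f) (g := fun x : Fin n → ι => ∏ i, f (x i))
        hf.summable ih.summable (fun i => hf0 i) (fun x => h0 x)
    have h : HasSum (fun x : ι × (Fin n → ι) => f x.1 * ∏ i, f (x.2 i)) (a * a ^ n) :=
      HasSum.mul (f := f) (g := fun x : Fin n → ι => ∏ i, f (x i)) hf ih hs
    rw [pow_succ', ← (Fin.consEquiv fun _ : Fin (n + 1) => ι).hasSum_iff]
    refine h.congr_fun fun x => ?_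
    simp [Fin.consEquiv, Fin.prod_univ_succ]

lemma hasSum_norm_tensor {α : (Fin d → ℕ) → ℂ} {a : ℝ}
    (h : HasSum (fun m => ‖α m‖ ^ 2 * (mfact m : ℝ)) a) :
    HasSum (fun M => ‖tensor l k α M‖ ^ 2 * (matFact M : ℝ)) (a ^ (k * l)) := by
  have h1 := hasSum_prod_fin (fun n => Finset.prod_nonneg fun j _ => by positivity)
    (hasSum_prod_fin (fun m => by positivity) h k) l
  rw [← pow_mul] at h1
  convert! h1 using 2 with M
  simp only [tensor, norm_prod, matFact, Finset.prod_mul_distrib, Finset.prod_pow, Nat.cast_prod]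

lemma formS_congr_smul (hk : 2 ≤ k) {S : ℕ} {φ ψ : Mat l k d → ℂ} {a : ℝ}
    (h : ∀ M, matDeg M = S → φ M = a * ψ M) : (formS S φ).re = a ^ 2 * (formS S ψ).re := by
  have h1 : slicePoly S φ = (a : ℂ) • slicePoly S ψ := by
    rw [slicePoly, slicePoly, Finset.smul_sum]
    refine Finset.sum_congr rfl fun M hM => ?_
    rw [MvPolynomial.smul_monomial, smul_eq_mul, h M (mem_slice.1 hM)]
  rw [formS_eq_fischer hk, h1, (slicePolyP l k d S).map_smul, fischer_smul_left, fischer_smul_right,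
    ← formS_eq_fischer hk, ← mul_assoc, ← Complex.ofReal_mul, Complex.re_ofReal_mul, pow_two]

lemma sliceSq_le_of_hasSum {φ : Mat l k d → ℂ} {a : ℝ}
    (h : HasSum (fun M => ‖φ M‖ ^ 2 * (matFact M : ℝ)) a) (S : ℕ) : sliceSq S φ ≤ a :=
  sum_le_hasSum _ (fun _ _ => by positivity) h

/-- In the topology of pointwise convergence: the form of degree S involves only finitely many
coefficients. -/
lemma continuous_formS_tensor (S : ℕ) :
    Continuous fun α : (Fin d → ℕ) → ℂ => (formS S (tensor l k α)).re := by
  have h1 : ∀ M : Mat l k d, Continuous fun α : (Fin d → ℕ) → ℂ => tensor l k α M := by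
    intro M
    unfold tensor
    fun_prop
  refine Complex.continuous_re.comp ?_
  refine continuous_finsetSum _ fun M _ => ?_
  refine ((h1 M).mul (Complex.continuous_conj.comp ?_)).mul continuous_const
  change Continuous fun α => ∑ N ∈ slice l k d (matDeg M),
    tensor l k α N * ((coeffP M N / matFact M : ℝ) : ℂ)
  exact continuous_finsetSum _ fun N _ => (h1 N).mul continuous_const

end TensorNorm

/-! ### Upper bound by Abel means -/

section UpperBound

variable {l k d : ℕ}

lemma scale_pos (hk : 2 ≤ k) : 0 < √(1 / (k : ℝ)) := by
  have : (0 : ℝ) < k := by exact_mod_cast (by omega : 0 < k)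
  positivity

lemma scale_le_one (hk : 2 ≤ k) : √(1 / (k : ℝ)) ≤ 1 := by
  have h2 : (2 : ℝ) ≤ k := by exact_mod_cast hk
  rw [Real.sqrt_le_one, div_le_one (by linarith)]
  linarith

lemma tensor_mul (w α : (Fin d → ℕ) → ℂ) (M : Mat l k d) :
    tensor l k (fun m => w m * α m) M = tensor l k w M * tensor l k α M := by
  simp only [tensor, Finset.prod_mul_distrib]

lemma tensor_pow_deg (r : ℂ) (M : Mat l k d) :
    tensor l k (fun m => r ^ deg m) M = r ^ matDeg M := by
  simp only [tensor, matDeg, Finset.prod_pow_eq_pow_sum]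

lemma deg_le_matDeg (M : Mat l k d) (i : Fin l) (j : Fin k) : deg (M i j) ≤ matDeg M :=
  (Finset.single_le_sum (f := fun j => deg (M i j)) (fun _ _ => Nat.zero_le _)
    (Finset.mem_univ j)).trans
    (Finset.single_le_sum (f := fun i => ∑ j, deg (M i j)) (fun _ _ => Nat.zero_le _)
      (Finset.mem_univ i))

/-- The truncation to degrees below `N`. -/
def truncate (N : ℕ) (m : Fin d → ℕ) : ℂ := if deg m < N then 1 else 0

lemma norm_truncate_le (N : ℕ) (m : Fin d → ℕ) : ‖truncate N m‖ ≤ 1 := by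
  unfold truncate
  split_ifs <;> simp

/-- The finite set of multi-indices of degree below `N`. -/
def degBelow (d N : ℕ) : Finset (Fin d → ℕ) := (Finset.Iic fun _ => N).filter fun m => deg m < N

lemma mem_degBelow {N : ℕ} {m : Fin d → ℕ} : m ∈ degBelow d N ↔ deg m < N := by
  simp only [degBelow, Finset.mem_filter, Finset.mem_Iic, and_iff_right_iff_imp]
  intro h a
  exact (Finset.single_le_sum (f := m) (fun _ _ => Nat.zero_le _) (Finset.mem_univ a)).trans h.le

lemma tensor_truncate_of_lt {N : ℕ} {M : Mat l k d} (h : matDeg M < N) :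
    tensor l k (truncate N) M = 1 := by
  refine Finset.prod_eq_one fun i _ => Finset.prod_eq_one fun j _ => ?_
  rw [truncate, if_pos ((deg_le_matDeg M i j).trans_lt h)]

lemma norm_tensor_le_one {w : (Fin d → ℕ) → ℂ} (hw : ∀ m, ‖w m‖ ≤ 1) (M : Mat l k d) :
    ‖tensor l k w M‖ ≤ 1 := by
  rw [tensor, norm_prod]
  refine Finset.prod_le_one (fun _ _ => norm_nonneg _) fun i _ => ?_
  rw [norm_prod]
  exact Finset.prod_le_one (fun _ _ => norm_nonneg _) fun j _ => hw _

lemma summable_eigP_mul_geometric {m ρ : ℝ} (hm : 0 ≤ m) (hρ0 : 0 < ρ) (hρ1 : ρ < 1) :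
    Summable fun S : ℕ => ρ ^ S * eigP m (S / 2) := by
  obtain ⟨n, hn⟩ := exists_nat_ge m
  have h1 : Summable fun S : ℕ => (S : ℝ) ^ n * ρ ^ S :=
    summable_pow_mul_geometric_of_norm_lt_one n (by rwa [Real.norm_of_nonneg hρ0.le])
  have h2 := ((summable_nat_add_iff 1).2 h1).mul_left ρ⁻¹
  refine Summable.of_nonneg_of_le (fun S => ?_) (fun S => ?_) h2
  · refine mul_nonneg (by positivity) (div_nonneg (Finset.prod_nonneg fun j _ => by positivity) ?_)
    positivity
  · have h3 : eigP m (S / 2) ≤ ((S : ℝ) + 1) ^ n := by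
      refine (eigP_mono_left hm hn _).trans ((eigP_natCast_le n _).trans ?_)
      have : ((S / 2 : ℕ) : ℝ) ≤ S := by exact_mod_cast Nat.div_le_self S 2
      gcongr
    calc ρ ^ S * eigP m (S / 2) ≤ ρ ^ S * ((S : ℝ) + 1) ^ n := by gcongr
      _ = _ := by
        push_cast
        rw [pow_succ]
        field_simp

/-- The eigenvalues for μ need not increase in r when μ < 1; those for μ + 1 dominate them and do
increase. -/
lemma formS_tensor_le (hl : 1 ≤ l) (hk : 2 ≤ k) (hd : 1 ≤ d) {φ : Mat l k d → ℂ} {a : ℝ}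
    (h : HasSum (fun M => ‖φ M‖ ^ 2 * (matFact M : ℝ)) a) (S : ℕ) :
    (formS S φ).re ≤ eigP (mu l k d + 1) (S / 2) * a := by
  have hmu := mu_pos hl hk hd
  have h1 := (formS_bounds hk (S := S) (B := eigP (mu l k d + 1) (S / 2)) (fun r hr =>
    (eigP_mono_left hmu.le (by linarith) r).trans (eigP_monotone (by linarith) (by omega))) φ).2
  refine h1.trans (mul_le_mul_of_nonneg_left (sliceSq_le_of_hasSum h S) ?_)
  exact (eigP_pos (by linarith) _).le

/-- Truncations have finitely many coefficients, so the identity holds for them. Damping multiplies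
the form of degree S by r^(2S), which beats the polynomial growth of the eigenvalues uniformly in
the truncation; hence the sums converge to the damped sum for α, at most the undamped one. -/
lemma energy_abel_le (hl : 1 ≤ l) (hk : 2 ≤ k) (hd : 1 ≤ d) {α : (Fin d → ℕ) → ℂ}
    (hα : IsCoeff α) {r : ℝ} (hr0 : 0 < r) (hr1 : r < 1) :
    energy k l √(1 / (k : ℝ)) (fun m => (r : ℂ) ^ deg m * α m) ≤
      ∑' S, ENNReal.ofReal (formS S (tensor l k α)).re := by
  have hnr : ∀ m : Fin d → ℕ, ‖(r : ℂ) ^ deg m‖ ≤ 1 := fun m => by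
    rw [norm_pow, Complex.norm_real, Real.norm_of_nonneg hr0.le]
    exact pow_le_one₀ hr0.le hr1.le
  have h1 := energy_le_liminf (k := k) (l := l) (scale_pos hk) (scale_le_one hk) hα
    (w := fun N m => truncate N m * (r : ℂ) ^ deg m) (w₀ := fun m => (r : ℂ) ^ deg m)
    (fun N m => by
      rw [norm_mul]
      exact mul_le_one₀ (norm_truncate_le N m) (norm_nonneg _) (hnr m)) hnr
    (fun m => by
      refine tendsto_const_nhds.congr' ?_
      filter_upwards [eventually_gt_atTop (deg m)] with N hN
      rw [truncate, if_pos hN, one_mul])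
  refine h1.trans ?_
  have hform : ∀ N S, (formS S (tensor l k fun m => truncate N m * (r : ℂ) ^ deg m * α m)).re =
      (r ^ S) ^ 2 * (formS S (tensor l k fun m => truncate N m * α m)).re := by
    intro N S
    refine formS_congr_smul hk fun M hM => ?_
    simp only [tensor_mul, tensor_pow_deg, hM]
    push_cast
    ring
  have hE : ∀ N, energy k l √(1 / (k : ℝ)) (fun m => truncate N m * (r : ℂ) ^ deg m * α m) =
      ∑' S, ENNReal.ofReal ((r ^ S) ^ 2 * (formS S (tensor l k fun m => truncate N m * α m)).re) := by
    intro N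
    rw [energy_of_finite hk (A := degBelow d N)]
    · simp only [hform]
    · intro m hm
      rw [mem_degBelow] at hm
      rw [truncate, if_neg hm, zero_mul, zero_mul]
  simp only [hE]
  obtain ⟨a, ha⟩ := hα
  have hbound : ∀ w : (Fin d → ℕ) → ℂ, (∀ m, ‖w m‖ ≤ 1) → ∀ S,
      (formS S (tensor l k fun m => w m * α m)).re ≤ eigP (mu l k d + 1) (S / 2) * a ^ (k * l) := by
    intro w hw S
    have h2 := hasSum_norm_tensor (l := l) (k := k) ha
    have hsum : Summable fun M : Mat l k d =>
        ‖tensor l k (fun m => w m * α m) M‖ ^ 2 * (matFact M : ℝ) := by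
      refine h2.summable.of_nonneg_of_le (fun M => by positivity) fun M => ?_
      rw [tensor_mul, norm_mul]
      gcongr
      exact mul_le_of_le_one_left (norm_nonneg _) (norm_tensor_le_one hw M)
    refine (formS_tensor_le hl hk hd hsum.hasSum S).trans ?_
    refine mul_le_mul_of_nonneg_left ?_ (eigP_pos (by linarith [mu_pos hl hk hd]) _).le
    refine hasSum_le (fun M => ?_) hsum.hasSum h2
    rw [tensor_mul, norm_mul]
    gcongr
    exact mul_le_of_le_one_left (norm_nonneg _) (norm_tensor_le_one hw M)
  have hρ1 : r ^ 2 < 1 := pow_lt_one₀ hr0.le hr1 (by norm_num)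
  have hsb : Summable fun S : ℕ => (r ^ 2) ^ S * eigP (mu l k d + 1) (S / 2) * a ^ (k * l) :=
    (summable_eigP_mul_geometric (by linarith [mu_pos hl hk hd]) (by positivity) hρ1).mul_right _
  have hle : ∀ (w : (Fin d → ℕ) → ℂ), (∀ m, ‖w m‖ ≤ 1) → ∀ S,
      (r ^ S) ^ 2 * (formS S (tensor l k fun m => w m * α m)).re ≤
        (r ^ 2) ^ S * eigP (mu l k d + 1) (S / 2) * a ^ (k * l) := by
    intro w hw S
    rw [← pow_mul, mul_comm S 2, pow_mul, mul_assoc]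
    exact mul_le_mul_of_nonneg_left (hbound w hw S) (by positivity)
  have hnn : ∀ (φ : Mat l k d → ℂ) S, 0 ≤ (r ^ S) ^ 2 * (formS S φ).re := fun φ S =>
    mul_nonneg (by positivity) (formS_re_nonneg hk S φ)
  have hlim : Tendsto (fun N => ∑' S, ENNReal.ofReal
      ((r ^ S) ^ 2 * (formS S (tensor l k fun m => truncate N m * α m)).re)) atTop
      (𝓝 (ENNReal.ofReal (∑' S, (r ^ S) ^ 2 * (formS S (tensor l k α)).re))) := by
    have e1 : ∀ N, ∑' S, ENNReal.ofReal
        ((r ^ S) ^ 2 * (formS S (tensor l k fun m => truncate N m * α m)).re) =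
        ENNReal.ofReal (∑' S, (r ^ S) ^ 2 * (formS S (tensor l k fun m => truncate N m * α m)).re) :=
      fun N => (ENNReal.ofReal_tsum_of_nonneg (hnn _)
        (hsb.of_nonneg_of_le (hnn _) (hle _ (norm_truncate_le N)))).symm
    simp only [e1]
    refine ENNReal.tendsto_ofReal ?_
    refine tendsto_tsum_of_dominated_convergence hsb (fun S => ?_)
      (Eventually.of_forall fun N S => ?_)
    -- A truncation beyond S does not affect the form of degree S, so the terms are eventually
    -- constant.
    · refine tendsto_const_nhds.congr' ?_
      filter_upwards [eventually_gt_atTop S] with N hN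
      have e := formS_congr_smul hk (S := S) (φ := tensor l k fun m => truncate N m * α m)
        (ψ := tensor l k α) (a := 1) fun M hM => by
          rw [tensor_mul, tensor_truncate_of_lt (hM ▸ hN), Complex.ofReal_one]
      rw [e, one_pow, one_mul]
    · rw [Real.norm_of_nonneg (hnn _ S)]
      exact hle _ (norm_truncate_le N) S
  rw [hlim.liminf_eq]
  have hsα : Summable fun S => (r ^ S) ^ 2 * (formS S (tensor l k α)).re := by
    refine hsb.of_nonneg_of_le (hnn _) fun S => ?_
    have := hle (fun _ => 1) (fun _ => by simp) S
    simpa only [one_mul] using this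
  rw [ENNReal.ofReal_tsum_of_nonneg (hnn _) hsα]
  refine ENNReal.tsum_le_tsum fun S => ENNReal.ofReal_le_ofReal ?_
  refine mul_le_of_le_one_left (formS_re_nonneg hk S _) ?_
  exact pow_le_one₀ (by positivity) (pow_le_one₀ hr0.le hr1.le)

lemma energy_le_tsum (hl : 1 ≤ l) (hk : 2 ≤ k) (hd : 1 ≤ d) {α : (Fin d → ℕ) → ℂ}
    (hα : IsCoeff α) :
    energy k l √(1 / (k : ℝ)) α ≤ ∑' S, ENNReal.ofReal (formS S (tensor l k α)).re := by
  -- The shift by 2 keeps r positive already at n = 0.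
  set r : ℕ → ℝ := fun n => 1 - 1 / ((n : ℝ) + 2) with hr
  have hr0 : ∀ n, 0 < r n := fun n => by
    have : 1 / ((n : ℝ) + 2) < 1 := by
      rw [div_lt_one (by positivity)]
      have : (0 : ℝ) ≤ n := Nat.cast_nonneg n
      linarith
    simp only [hr]; linarith
  have hr1 : ∀ n, r n < 1 := fun n => by
    have : 0 < 1 / ((n : ℝ) + 2) := by positivity
    simp only [hr]; linarith
  have hlim : Tendsto r atTop (𝓝 1) := by
    have h1 : Tendsto (fun n : ℕ => 1 / ((n : ℝ) + 2)) atTop (𝓝 0) := by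
      refine tendsto_const_nhds.div_atTop ?_
      exact tendsto_atTop_add_const_right _ _ tendsto_natCast_atTop_atTop
    have h2 := h1.const_sub 1
    rw [sub_zero] at h2
    exact h2
  have h1 := energy_le_liminf (k := k) (l := l) (scale_pos hk) (scale_le_one hk) hα
    (w := fun n m => (r n : ℂ) ^ deg m) (w₀ := fun m => 1)
    (fun n m => by
      rw [norm_pow, Complex.norm_real, Real.norm_of_nonneg (hr0 n).le]
      exact pow_le_one₀ (hr0 n).le (hr1 n).le) (fun m => by simp)
    (fun m => by
      have := (((Complex.continuous_ofReal.tendsto 1).comp hlim).pow (deg m))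
      simpa using this)
  simp only [one_mul] at h1
  refine h1.trans (liminf_le_of_frequently_le' (Frequently.of_forall fun n => ?_))
  exact energy_abel_le hl hk hd hα (hr0 n) (hr1 n)

end UpperBound

/-! ### Lower bound by Fejér means -/

section LowerBound

variable {l k d : ℕ}

lemma sum_exp_div_eq_zero {Q : ℕ} {z : ℤ} (hz : z ≠ 0) (hzQ : |z| < Q) :
    ∑ j ∈ Finset.range Q, Complex.exp (2 * Real.pi * Complex.I * z * (j / Q : ℝ)) = 0 := by
  have hQ : (Q : ℂ) ≠ 0 := by
    have : (0 : ℤ) < Q := (abs_nonneg z).trans_lt hzQ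
    exact_mod_cast this.ne'
  set ζ : ℂ := Complex.exp (2 * Real.pi * Complex.I * z / Q) with hζ
  have h1 : ∀ j : ℕ, Complex.exp (2 * Real.pi * Complex.I * z * (j / Q : ℝ)) = ζ ^ j := by
    intro j
    rw [hζ, ← Complex.exp_nat_mul]
    congr 1
    push_cast
    ring
  simp only [h1]
  have h2 : ζ ^ Q = 1 := by
    rw [hζ, ← Complex.exp_nat_mul, Complex.exp_eq_one_iff]
    exact ⟨z, by field_simp⟩
  have h3 : ζ ≠ 1 := by
    intro h
    rw [hζ, Complex.exp_eq_one_iff] at h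
    obtain ⟨n, hn⟩ := h
    have h4 : (z : ℂ) = n * Q := by
      have h5 : (2 * Real.pi * Complex.I : ℂ) ≠ 0 := by simp [Real.pi_ne_zero]
      field_simp at hn
      refine mul_left_cancel₀ h5 ?_
      linear_combination (2 * Real.pi * Complex.I : ℂ) * hn
    have h6 : z = n * Q := by exact_mod_cast h4
    rw [h6, abs_mul, Nat.abs_cast] at hzQ
    have hn0 : n ≠ 0 := by rintro rfl; simp at h6; exact hz h6
    have := Int.one_le_abs hn0
    nlinarith
  have h4 := geom_sum_mul ζ Q
  rw [h2, sub_self] at h4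
  exact (mul_eq_zero.1 h4).resolve_right (sub_ne_zero.2 h3)

/-- The values of the Fejér kernel of order `N` at the points `j/Q`, divided by `Q`. -/
def fejerWeight (N Q : ℕ) (j : ℕ) : NNReal :=
  ‖∑ a ∈ Finset.range N, Complex.exp (2 * Real.pi * Complex.I * (a : ℤ) * (j / Q : ℝ))‖₊ ^ 2 / (N * Q)

/-- Expanding the square, only pairs b = a + n survive the sum over Q-th roots of unity, and N - n
of them lie in range. The condition N + n ≤ Q excludes aliasing, as |a - b + n| < Q. -/
lemma sum_fejerWeight {N Q n : ℕ} (hN : 0 < N) (hQ : N + n ≤ Q) :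
    ∑ j ∈ Finset.range Q, ((fejerWeight N Q j : ℝ) : ℂ) *
      Complex.exp (2 * Real.pi * Complex.I * (n : ℤ) * (j / Q : ℝ)) = ((N - n : ℕ) : ℂ) / N := by
  have hQ0 : (Q : ℂ) ≠ 0 := by exact_mod_cast (by omega : Q ≠ 0)
  have hN0 : (N : ℂ) ≠ 0 := by exact_mod_cast hN.ne'
  have h1 : ∀ j : ℕ, ((fejerWeight N Q j : ℝ) : ℂ) *
      Complex.exp (2 * Real.pi * Complex.I * (n : ℤ) * (j / Q : ℝ)) =
      ∑ a ∈ Finset.range N, ∑ b ∈ Finset.range N, (N * Q : ℂ)⁻¹ *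
        Complex.exp (2 * Real.pi * Complex.I * ((a - b + n : ℤ) : ℂ) * (j / Q : ℝ)) := by
    intro j
    have h2 : ((fejerWeight N Q j : ℝ) : ℂ) = (N * Q : ℂ)⁻¹ *
        ((∑ a ∈ Finset.range N, Complex.exp (2 * Real.pi * Complex.I * (a : ℤ) * (j / Q : ℝ))) *
        conj (∑ a ∈ Finset.range N, Complex.exp (2 * Real.pi * Complex.I * (a : ℤ) * (j / Q : ℝ)))) := by
      rw [Complex.mul_conj, Complex.normSq_eq_norm_sq, fejerWeight]
      push_cast
      rw [div_eq_inv_mul]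
    rw [h2, map_sum, Finset.sum_mul_sum, mul_assoc, Finset.sum_mul, Finset.mul_sum]
    refine Finset.sum_congr rfl fun a _ => ?_
    rw [Finset.sum_mul, Finset.mul_sum]
    refine Finset.sum_congr rfl fun b _ => ?_
    congr 1
    rw [← Complex.exp_conj, ← Complex.exp_add, ← Complex.exp_add]
    congr 1
    simp only [map_mul, Complex.conj_I, Complex.conj_ofReal, map_ofNat, map_intCast]
    push_cast
    ring
  simp only [h1]
  rw [Finset.sum_comm]
  have h3 : ∀ a ∈ Finset.range N, ∑ j ∈ Finset.range Q, ∑ b ∈ Finset.range N, (N * Q : ℂ)⁻¹ *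
        Complex.exp (2 * Real.pi * Complex.I * ((a - b + n : ℤ) : ℂ) * (j / Q : ℝ)) =
      if a < N - n then (N : ℂ)⁻¹ else 0 := by
    intro a ha
    rw [Finset.sum_comm]
    have h4 : ∀ b ∈ Finset.range N, ∑ j ∈ Finset.range Q, (N * Q : ℂ)⁻¹ *
        Complex.exp (2 * Real.pi * Complex.I * ((a - b + n : ℤ) : ℂ) * (j / Q : ℝ)) =
        if b = a + n then (N : ℂ)⁻¹ else 0 := by
      intro b hb
      rw [Finset.mem_range] at ha hb
      rw [← Finset.mul_sum]
      split_ifs with h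
      · subst h
        have : ∀ j : ℕ, Complex.exp (2 * Real.pi * Complex.I *
            ((a - (a + n : ℕ) + n : ℤ) : ℂ) * (j / Q : ℝ)) = 1 := by
          intro j
          rw [show ((a : ℤ) - (a + n : ℕ) + n) = 0 by push_cast; ring]
          simp
        simp only [this, Finset.sum_const, Finset.card_range, nsmul_eq_mul, mul_one]
        field_simp
      · rw [sum_exp_div_eq_zero (by omega) (by rw [abs_lt]; constructor <;> omega), mul_zero]
    rw [Finset.sum_congr rfl h4, Finset.sum_ite_eq']
    have h5 : a + n ∈ Finset.range N ↔ a < N - n := by rw [Finset.mem_range]; omega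
    simp only [h5]
  rw [Finset.sum_congr rfl h3, ← Finset.sum_filter]
  have h6 : (Finset.range N).filter (fun a => a < N - n) = Finset.range (N - n) := by
    ext a; simp only [Finset.mem_filter, Finset.mem_range]; omega
  rw [h6, Finset.sum_const, Finset.card_range, nsmul_eq_mul, div_eq_mul_inv]

/-- The Fejér multiplier of order `N`. -/
def fejer (N : ℕ) (m : Fin d → ℕ) : ℂ := ((N - deg m : ℕ) : ℂ) / N

lemma norm_fejer_le (N : ℕ) (m : Fin d → ℕ) : ‖fejer N m‖ ≤ 1 := by
  rw [fejer, norm_div, Complex.norm_natCast, Complex.norm_natCast]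
  refine div_le_one_of_le₀ ?_ (Nat.cast_nonneg _)
  exact_mod_cast Nat.sub_le _ _

lemma tendsto_fejer (m : Fin d → ℕ) : Tendsto (fun N => fejer N m) atTop (𝓝 1) := by
  have h1 : Tendsto (fun N : ℕ => (1 : ℂ) - (deg m : ℂ) / N) atTop (𝓝 (1 - 0)) :=
    (tendsto_const_div_atTop_nhds_zero_nat (deg m : ℂ)).const_sub 1
  rw [sub_zero] at h1
  refine h1.congr' ?_
  filter_upwards [eventually_gt_atTop (deg m)] with N hN
  have hN0 : (N : ℂ) ≠ 0 := by exact_mod_cast (by omega : N ≠ 0)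
  rw [fejer, Nat.cast_sub hN.le]
  field_simp

/-- The Fejér mean is approximated by finite averages over the shifts j/Q with Q = N + i. At each m
the multipliers are exact once i ≥ |m|, and lower semicontinuity as i → ∞ handles all degrees at
once. -/
lemma energy_fejer_le (hl : 1 ≤ l) (hk : 2 ≤ k) {α : (Fin d → ℕ) → ℂ} (hα : IsCoeff α) {N : ℕ}
    (hN : 0 < N) :
    energy k l √(1 / (k : ℝ)) (fun m => fejer N m * α m) ≤ energy k l √(1 / (k : ℝ)) α := by
  set w : ℕ → (Fin d → ℕ) → ℂ := fun i m => ∑ j ∈ Finset.range (N + i),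
    ((fejerWeight N (N + i) j : ℝ) : ℂ) * phase ((j : ℝ) / (N + i : ℕ)) m with hw
  have hphase : ∀ (t : ℝ) (m : Fin d → ℕ),
      phase t m = Complex.exp (2 * Real.pi * Complex.I * ((deg m : ℤ) : ℂ) * t) := by
    intro t m
    rw [phase]
    congr 1
    push_cast
    ring
  have hsum : ∀ i, ∑ j ∈ Finset.range (N + i), fejerWeight N (N + i) j = 1 := by
    intro i
    have h := sum_fejerWeight (Q := N + i) (n := 0) hN (by omega)
    have hN0 : (N : ℂ) ≠ 0 := by exact_mod_cast hN.ne'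
    simp only [Nat.cast_zero, Int.cast_zero, mul_zero, zero_mul, Complex.exp_zero, mul_one,
      Nat.sub_zero, div_self hN0] at h
    exact_mod_cast h
  have hnorm : ∀ i m, ‖w i m‖ ≤ 1 := by
    intro i m
    refine (norm_sum_le _ _).trans ?_
    simp only [norm_mul, norm_phase, mul_one, Complex.norm_real, NNReal.norm_eq]
    exact_mod_cast (hsum i).le
  have h1 := energy_le_liminf (k := k) (l := l) (scale_pos hk) (scale_le_one hk) hα (w := w)
    (w₀ := fejer N) hnorm (norm_fejer_le N) (fun m => by
      refine tendsto_const_nhds.congr' ?_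
      filter_upwards [eventually_ge_atTop (deg m)] with i hi
      rw [hw]
      simp only [hphase]
      rw [sum_fejerWeight hN (by omega), fejer])
  refine h1.trans (liminf_le_of_frequently_le' (Frequently.of_forall fun i => ?_))
  exact energy_average_le (scale_pos hk) (scale_le_one hk) (by omega) hl hα _ _ (hsum i) _

/-- A finite partial sum of forms is the limit of those for Fejér means, and each of these is
bounded by the energy of the mean, hence by that of α. -/
lemma tsum_le_energy (hl : 1 ≤ l) (hk : 2 ≤ k) {α : (Fin d → ℕ) → ℂ} (hα : IsCoeff α) :
    ∑' S, ENNReal.ofReal (formS S (tensor l k α)).re ≤ energy k l √(1 / (k : ℝ)) α := by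
  have hlim : Tendsto (fun N : ℕ => fun m : Fin d → ℕ => fejer N m * α m) atTop (𝓝 α) := by
    rw [tendsto_pi_nhds]
    intro m
    simpa using (tendsto_fejer m).mul_const (α m)
  rw [ENNReal.tsum_eq_iSup_sum]
  refine iSup_le fun s => ?_
  have h1 : Tendsto (fun N : ℕ => ∑ S ∈ s,
      ENNReal.ofReal (formS S (tensor l k fun m => fejer N m * α m)).re) atTop
      (𝓝 (∑ S ∈ s, ENNReal.ofReal (formS S (tensor l k α)).re)) :=
    tendsto_finsetSum _ fun S _ => ENNReal.tendsto_ofReal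
      (((continuous_formS_tensor S).tendsto α).comp hlim)
  refine le_of_tendsto h1 ?_
  filter_upwards [eventually_gt_atTop 0] with N hN
  refine (ENNReal.sum_le_tsum s).trans ?_
  rw [← energy_of_finite hk (A := degBelow d N)]
  · exact energy_fejer_le hl hk hα hN
  · intro m hm
    rw [mem_degBelow, not_lt] at hm
    rw [fejer, Nat.sub_eq_zero_of_le hm]
    simp

lemma energy_eq_tsum (hl : 1 ≤ l) (hk : 2 ≤ k) (hd : 1 ≤ d) {α : (Fin d → ℕ) → ℂ}
    (hα : IsCoeff α) :
    energy k l √(1 / (k : ℝ)) α = ∑' S, ENNReal.ofReal (formS S (tensor l k α)).re :=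
  le_antisymm (energy_le_tsum hl hk hd hα) (tsum_le_energy hl hk hα)

end LowerBound

/-! ### Return to the flow and to the inner product of ℱ -/

section SpaceTime

variable {l k d : ℕ}

lemma hasSum_hermiteFlow (hk : 2 ≤ k) {g : Lp ℂ 2 (gauss d)} {α : (Fin d → ℕ) → ℂ}
    (h : HasSum (fun m => α m • hermiteLp 1 m) g) (t : ℝ) :
    HasSum (fun m => (α m * Complex.exp (2 * Real.pi * (deg m : ℂ) * Complex.I * t)) •
      hermiteLp √(2 / (2 * k : ℝ)) m) (hermiteFlow (2 * k) t g) ∧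
    hermiteFlow (2 * k) t g = hermiteSeries √(1 / (k : ℝ)) fun m => phase t m * α m := by
  have hα := (summable_hermiteLp_iff α).1 h.summable
  have hs : √(2 / (2 * k : ℝ)) = √(1 / (k : ℝ)) := by
    congr 1
    rw [div_mul_eq_div_div, div_self two_ne_zero]
  have h1 := hasSum_hermiteSeries (scale_pos hk) (scale_le_one hk)
    (hα.mul fun m => (norm_phase t m).le)
  have h2 : hermiteFlow (2 * k) t g = hermiteSeries √(1 / (k : ℝ)) fun m => phase t m * α m := by
    rw [hermiteFlow, hermiteSeries]
    congr 1
    funext m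
    rw [hermiteCoeff_of_hasSum h, hs, mul_comm, phase]
  refine ⟨?_, h2⟩
  rw [h2, hs]
  refine h1.congr_fun fun m => ?_
  rw [phase, mul_comm]

lemma spaceTime_eq_energy (hk : 2 ≤ k) {g : Lp ℂ 2 (gauss d)} {α : (Fin d → ℕ) → ℂ}
    (h : HasSum (fun m => α m • hermiteLp 1 m) g) :
    spaceTime k l g = energy k l √(1 / (k : ℝ)) α := by
  rw [spaceTime, energy]
  simp only [(hasSum_hermiteFlow hk h _).2, powEnergy]

lemma tensor_mem_spaceF {g : Lp ℂ 2 (gauss d)} {α : (Fin d → ℕ) → ℂ}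
    (h : HasSum (fun m => α m • hermiteLp 1 m) g) :
    tensor l k α ∈ spaceF l k d ∧
      (∫ x, ‖g x‖ ^ 2 ∂(gauss d)) ^ (k * l) = normF (tensor l k α) ^ 2 := by
  have h1 := hasSum_norm_tensor (l := l) (k := k) (hasSum_norm_sq h)
  refine ⟨h1.summable, ?_⟩
  have h2 : ∫ x, ‖g x‖ ^ 2 ∂(gauss d) = ‖g‖ ^ 2 := by
    have h3 := inner_self_eq_norm_sq_to_K (𝕜 := ℂ) g
    rw [L2.inner_def] at h3
    simp only [inner_self_eq_norm_sq_to_K] at h3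
    have h4 : ((∫ x, ‖g x‖ ^ 2 ∂(gauss d) : ℝ) : ℂ) = ((‖g‖ ^ 2 : ℝ) : ℂ) := by
      rw [← integral_complex_ofReal, Complex.ofReal_pow]
      refine Eq.trans ?_ h3
      simp only [Complex.ofReal_pow]
      rfl
    exact_mod_cast h4
  rw [h2, normF, h1.tsum_eq, Real.sq_sqrt (by positivity)]

/-- With both functions in ℱ the inner product converges absolutely and may be summed by degree; the
degree terms are real and nonnegative, so the sum in [0, ∞] is finite and agrees with it. -/
lemma spaceTime_eq_innerF {φ : Mat l k d → ℂ} (hk : 2 ≤ k) (hφ : φ ∈ spaceF l k d)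
    (hP : opP l k d φ ∈ spaceF l k d) :
    ∑' S, ENNReal.ofReal (formS S φ).re ≠ ∞ ∧
      ((∑' S, ENNReal.ofReal (formS S φ).re).toReal : ℂ) = innerF φ (opP l k d φ) := by
  have h1 : HasSum (fun S => formS S φ) (innerF φ (opP l k d φ)) :=
    hasSum_slices (summable_innerF hφ hP)
  have hre := Complex.hasSum_re h1
  have him := Complex.hasSum_im h1
  have h0 : ∀ S, (formS S φ).im = 0 := fun S => by rw [formS_eq_sum hk, Complex.ofReal_im]
  simp only [h0] at him
  have him0 : (innerF φ (opP l k d φ)).im = 0 := him.unique hasSum_zero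
  have hnn := fun S => formS_re_nonneg hk S φ
  rw [← ENNReal.ofReal_tsum_of_nonneg hnn hre.summable, hre.tsum_eq]
  refine ⟨ENNReal.ofReal_ne_top, ?_⟩
  rw [ENNReal.toReal_ofReal (hre.nonneg hnn)]
  refine Complex.ext (by simp) ?_
  rw [Complex.ofReal_im, him0]

end SpaceTime

end HermiteStrichartz

end

theorem mainTheorem4 (l k d : ℕ) (hl : 1 ≤ l) (hk : 2 ≤ k) (hd : 1 ≤ d) :
    -- the two integral identities, for `g = ∑ α(m) H_m` in `L²(γ_d)`
    (∀ (g : Lp ℂ 2 (gauss d)) (α : (Fin d → ℕ) → ℂ),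
      HasSum (fun m => α m • hermiteLp 1 m) g →
        -- the series defining `H^t g` converges
        (∀ t : ℝ, HasSum (fun m => (α m * Complex.exp (2 * Real.pi * (deg m : ℂ) * Complex.I * t)) •
          hermiteLp √(2 / (2 * k : ℝ)) m) (hermiteFlow (2 * k) t g)) ∧
        -- first identity, in `[0, ∞]`, with `⟨φ, 𝒫φ⟩` summed by degree
        (∀ S, (formS S (tensor l k α)).im = 0 ∧ 0 ≤ (formS S (tensor l k α)).re) ∧
        spaceTime k l g = ∑' S, ENNReal.ofReal (formS S (tensor l k α)).re ∧
        -- first identity, for `φ` in the domain of `𝒫`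
        (opP l k d (tensor l k α) ∈ spaceF l k d →
          spaceTime k l g ≠ ∞ ∧
          ((spaceTime k l g).toReal : ℂ) =
            innerF (tensor l k α) (opP l k d (tensor l k α))) ∧
        -- second identity
        tensor l k α ∈ spaceF l k d ∧
        (∫ x, ‖g x‖ ^ 2 ∂(gauss d)) ^ (k * l) = normF (tensor l k α) ^ 2) ∧
    -- `𝒫_S² = 𝒫_S` (automatic for `S ≤ 1`) if and only if `μ = 1`
    (∀ S, opPS l k d S ∘ₗ opPS l k d S = opPS l k d S ↔ (mu l k d = 1 ∨ S ≤ 1)) ∧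
    ((∀ S, opPS l k d S ∘ₗ opPS l k d S = opPS l k d S) ↔ mu l k d = 1) ∧
    -- for `μ = 1`, `𝒫` is an (orthogonal) projection on the whole of `ℱ`
    (mu l k d = 1 →
      (∀ φ ∈ spaceF l k d, opP l k d φ ∈ spaceF l k d ∧ opP l k d (opP l k d φ) = opP l k d φ) ∧
      (∀ φ ∈ spaceF l k d, ∀ ψ ∈ spaceF l k d,
        innerF (opP l k d φ) ψ = innerF φ (opP l k d ψ))) ∧
    -- for `μ > 1`, the norm of `𝒫_S`, its growth, and the unboundedness of `𝒫`
    (1 < mu l k d →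
      (∀ S, IsLUB (ratioPS l k d S) (normPS l k d S) ∧
        normPS l k d S = (∏ j ∈ Finset.range (S / 2), (mu l k d + j)) / ((S / 2).factorial : ℝ)) ∧
      (fun S : ℕ => normPS l k d S) ~[atTop]
        (fun S : ℕ => (S : ℝ) ^ (mu l k d - 1) /
          ((2 : ℝ) ^ (mu l k d - 1) * Real.Gamma (mu l k d))) ∧
      ¬ ∃ C : ℝ, ∀ φ ∈ spaceF l k d, opP l k d φ ∈ spaceF l k d →
        normF (opP l k d φ) ≤ C * normF φ) := by
  refine ⟨fun g α h => ?_, fun S => opPS_idem_iff hl hk hd S, ⟨fun h => ?_, fun h S => ?_⟩,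
    fun h => ⟨fun φ hφ => ⟨opP_mem_spaceF hk h hφ, ?_⟩, fun φ hφ ψ hψ =>
      innerF_opP_comm hk h hφ hψ⟩, fun h => ⟨fun S => ?_, ?_, opP_unbounded hl hk hd h⟩⟩
  · have hST : spaceTime k l g = ∑' S, ENNReal.ofReal (formS S (tensor l k α)).re :=
      (spaceTime_eq_energy hk h).trans
        (energy_eq_tsum hl hk hd ((summable_hermiteLp_iff α).1 h.summable))
    refine ⟨fun t => (hasSum_hermiteFlow hk h t).1,
      fun S => ⟨by rw [formS_eq_sum hk, Complex.ofReal_im], formS_re_nonneg hk S _⟩, hST,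
      fun hP => ?_, tensor_mem_spaceF h⟩
    rw [hST]
    exact spaceTime_eq_innerF hk (tensor_mem_spaceF h).1 hP
  -- Degree 2 is the first at which the eigenvalue μ appears.
  · exact ((opPS_idem_iff hl hk hd 2).1 (h 2)).resolve_right (by norm_num)
  · exact (opPS_idem_iff hl hk hd S).2 (Or.inl h)
  · funext M
    exact opP_opP_apply hk (fun r _ => by rw [h, eigP_one_left]) φ rfl
  · have hg := isGreatest_ratioPS hl hk hd h.le S
    have hn : normPS l k d S = eigP (mu l k d) (S / 2) := hg.csSup_eq
    exact ⟨hn ▸ hg.isLUB, hn⟩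
  · have hn : (fun S : ℕ => normPS l k d S) = fun S => eigP (mu l k d) (S / 2) :=
      funext fun S => (isGreatest_ratioPS hl hk hd h.le S).csSup_eq
    rw [hn]
    exact eigP_half_isEquivalent (mu_pos hl hk hd)
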